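/- Fix a finite alphabet $\Sigma$. A DFA $A$ over $\Sigma$ has a finite state set, one initial state, a set of final states and a partial transition function; $|A|$ is its number of states and $L(A)$ its language. A language $L\subseteq\Sigma^*$ is slender if there is a constant $C$ with $|L\cap\Sigma^n|\le C$ for all $n\ge 0$. The push-pop-right distance of two words is the least number of operations turning the first into the second, where an operation either appends a letter at the end of the word or removes the last letter of a non-empty word; an edit script is a finite sequence of such operations. For $d\in\mathbb N$, a language is $d$-orderable if its words can be listed without repetition in a finite or infinite sequence $w_1,w_2,\dots$ in which consecutive words are at push-pop-right distance at most $d$; it is $(t,d)$-partition-orderable if it is the disjoint union of $t$ languages that are each $d$-orderable. A sequence of edit scripts $\sigma_1,\sigma_2,\dots$ (finite or infinite) enumerates $L$ if, starting from the empty word and applying the scripts successively, each script is applicable, and the words $w_1,w_2,\dots$ obtained after $\sigma_1,\sigma_2,\dots$ are pairwise distinct and are exactly the words of $L$. Theorem. (1) For every DFA $A$ over $\Sigma$: $L(A)$ is $(t,d)$-partition-orderable for some $t,d\in\mathbb N$ if and only if $L(A)$ is slender. (2) There is a polynomial-time algorithm that, given a DFA $A$ over $\Sigma$ such that $L(A)$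 is slender, computes (in binary) the smallest $t$ such that $L(A)$ is $(t,d)$-partition-orderable for some $d\in\mathbb N$. (3) There is an algorithm that, given a DFA $A$ over $\Sigma$ for which this smallest $t$ is $1$, computes finite lists $u$ and $v$ of edit scripts, each script having at most $2|A|$ operations, such that the ultimately periodic sequence $u\,v\,v\,v\cdots$ (the finite sequence $u$ if $v$ is empty) enumerates $L(A)$. In particular, consecutive words of the enumeration are at push-pop-right distance at most $2|A|$. -/

import Mathlib

namespace PushPopRight

/-! ### Words, slender languages, partial deterministic automata -/

/-- Words over the alphabet `Fin k`; the right end of the word is the end of the list. -/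
abbrev Word (k : ℕ) : Type := List (Fin k)

/-- A language is slender if the number of its words of each length is bounded by a constant. -/
def Slender {k : ℕ} (L : Set (Word k)) : Prop :=
  ∃ C : ℕ, ∀ n : ℕ, {w ∈ L | w.length = n}.encard ≤ (C : ℕ∞)

/-- A deterministic finite automaton over the alphabet `Fin k`, with state set
`Fin numStates` and a partial transition function. -/
structure PDFA (k : ℕ) where
  /-- the number of states -/
  numStates : ℕ
  /-- the initial state -/
  start : Fin numStates
  /-- the (indicator function of the) set of final states -/
  accept : Fin numStates → Bool
  /-- the partial transition function -/
  step : Fin numStates → Fin k → Option (Fin numStates)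

/-- The state reached from `q` by reading `w`, if all the transitions exist. -/
def PDFA.run {k : ℕ} (A : PDFA k) : Fin A.numStates → Word k → Option (Fin A.numStates)
  | q, [] => some q
  | q, a :: w => (A.step q a).bind fun p => A.run p w

/-- The language accepted by the automaton. -/
def PDFA.language {k : ℕ} (A : PDFA k) : Set (Word k) :=
  {w | ∃ q, A.run A.start w = some q ∧ A.accept q = true}

/-! ### The push-pop-right distance -/

/-- The edit operations at the right end of a word. -/
inductive Edit (k : ℕ) : Type where
  /-- append a letter at the end of the word -/
  | pushR (a : Fin k) : Edit k
  /-- remove the last letter of the word -/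
  | popR : Edit k

/-- Edit operations correspond to `Option (Fin k)`: `none` is the pop operation. -/
def Edit.equivOption (k : ℕ) : Edit k ≃ Option (Fin k) where
  toFun
    | .pushR a => some a
    | .popR => none
  invFun
    | some a => .pushR a
    | none => .popR
  left_inv e := by cases e <;> rfl
  right_inv o := by cases o <;> rfl

instance Edit.instPrimcodable (k : ℕ) : Primcodable (Edit k) :=
  Primcodable.ofEquiv (Option (Fin k)) (Edit.equivOption k)

/-- Edit scripts. -/
abbrev Script (k : ℕ) : Type := List (Edit k)

/-- The effect of one operation; a pop is not applicable to the empty word. -/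
def Edit.apply {k : ℕ} : Edit k → Word k → Option (Word k)
  | .pushR a, w => some (w ++ [a])
  | .popR, w => if w = [] then none else some w.dropLast

/-- The effect of a script, whose operations are applied from first to last. -/
def Script.apply {k : ℕ} : Script k → Word k → Option (Word k)
  | [], w => some w
  | e :: s, w => (e.apply w).bind fun w' => Script.apply s w'

/-- The push-pop-right distance: the least length of a script that turns `u` into `v`. -/
noncomputable def pprDist {k : ℕ} (u v : Word k) : ℕ :=
  sInf {n : ℕ | ∃ s : Script k, s.length = n ∧ s.apply u = some v}

theorem Script.apply_append {k : ℕ} (s t : Script k) (w : Word k) :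
    Script.apply (s ++ t) w = (Script.apply s w).bind (Script.apply t) := by
  induction s generalizing w with
  | nil => rfl
  | cons e s ih =>
    simp only [List.cons_append, Script.apply]
    cases e.apply w with
    | none => rfl
    | some w' => simpa using ih w'

/-- Every word can be turned into every other one, so `pprDist` is a minimum. -/
theorem exists_script {k : ℕ} (u v : Word k) : ∃ s : Script k, s.apply u = some v := by
  have h1 : ∀ u : Word k, ∃ s : Script k, s.apply u = some [] := by
    intro u
    induction u using List.reverseRecOn with
    | nil => exact ⟨[], rfl⟩
    | append_singleton u a ih =>
      obtain ⟨s, hs⟩ := ih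
      exact ⟨.popR :: s, by simpa [Script.apply, Edit.apply] using hs⟩
  have h2 : ∀ v : Word k, ∃ s : Script k, s.apply [] = some v := by
    intro v
    induction v using List.reverseRecOn with
    | nil => exact ⟨[], rfl⟩
    | append_singleton v a ih =>
      obtain ⟨s, hs⟩ := ih
      exact ⟨s ++ [.pushR a], by simp [Script.apply_append, hs, Script.apply, Edit.apply]⟩
  obtain ⟨s, hs⟩ := h1 u
  obtain ⟨t, ht⟩ := h2 v
  exact ⟨s ++ t, by simp [Script.apply_append, hs, ht]⟩

/-! ### Orderability -/

/-- `L` is `d`-orderable for the distance `δ`: there is a finite or infinite sequence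
`s 0, s 1, …` (of length `N`, possibly `⊤`) without repetition, whose set of terms is `L`,
and whose consecutive terms are at distance at most `d`. -/
def Orderable {k : ℕ} (δ : Word k → Word k → ℕ) (d : ℕ) (L : Set (Word k)) : Prop :=
  ∃ (N : ℕ∞) (s : ℕ → Word k),
    (∀ i j : ℕ, (i : ℕ∞) < N → (j : ℕ∞) < N → s i = s j → i = j) ∧
    L = {w | ∃ i : ℕ, (i : ℕ∞) < N ∧ s i = w} ∧
    ∀ i : ℕ, ((i + 1 : ℕ) : ℕ∞) < N → δ (s i) (s (i + 1)) ≤ d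

/-- `L` is `(t, d)`-partition-orderable for the distance `δ`: it is the disjoint union of
`t` languages that are `d`-orderable. -/
def PartitionOrderable {k : ℕ} (δ : Word k → Word k → ℕ) (t d : ℕ) (L : Set (Word k)) : Prop :=
  ∃ P : Fin t → Set (Word k),
    L = (⋃ i, P i) ∧ Pairwise (fun i j => Disjoint (P i) (P j)) ∧ ∀ i, Orderable δ d (P i)

/-! ### Sequences of edit scripts -/

/-- The word obtained from the empty word by applying the first `i` scripts of a finite or
infinite sequence `σ` (`σ i = none` past the end of the sequence). -/
def wordAfter {k : ℕ} (σ : ℕ → Option (Script k)) : ℕ → Option (Word k)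
  | 0 => some []
  | i + 1 => (wordAfter σ i).bind fun w => (σ i).bind fun s => s.apply w

/-- The sequence of scripts `σ` enumerates `L`: every script can be applied, the words
produced are pairwise distinct, and they are exactly the words of `L`. -/
def Enumerates {k : ℕ} (σ : ℕ → Option (Script k)) (L : Set (Word k)) : Prop :=
  (∀ i, (σ i).isSome → (wordAfter σ (i + 1)).isSome) ∧
  (∀ i j w, wordAfter σ (i + 1) = some w → wordAfter σ (j + 1) = some w → i = j) ∧
  ∀ w, w ∈ L ↔ ∃ i, wordAfter σ (i + 1) = some w

/-- The ultimately periodic sequence `u v v v …`; it is the finite sequence `u` when `v`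
is empty. -/
def ultimatelyPeriodic {β : Type} (u v : List β) (i : ℕ) : Option β :=
  if i < u.length then u[i]? else v[(i - u.length) % v.length]?

/-! ### Automata as inputs of algorithms -/

/-- The number `m` in unary, with an end marker. -/
def unary (m : ℕ) : List Bool := List.replicate m true ++ [false]

/-- The row of the transition table at a state: finality (`1` or `0`), then for every letter
the successor, where `0` stands for an undefined transition and `p + 1` for the state `p`. -/
def PDFA.row {k : ℕ} (A : PDFA k) (q : Fin A.numStates) : List ℕ :=
  (if A.accept q then 1 else 0) ::
    (List.finRange k).map fun a =>
      match A.step q a with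
      | none => 0
      | some p => (p : ℕ) + 1

/-- The automaton as a bit string: the number of states, the initial state, and the rows of
the transition table, all numbers in unary. Its length is polynomial in the number of states. -/
def PDFA.code {k : ℕ} (A : PDFA k) : List Bool :=
  (A.numStates :: (A.start : ℕ) :: (List.finRange A.numStates).flatMap A.row).flatMap unary

theorem unary_append_inj {m n : ℕ} {s t : List Bool} (h : unary m ++ s = unary n ++ t) :
    m = n ∧ s = t := by
  induction m generalizing n with
  | zero => cases n <;> simp_all [unary, List.replicate_succ]
  | succ m ih =>
    cases n with
    | zero => simp [unary, List.replicate_succ] at h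
    | succ n =>
      have := @ih n (by simpa [unary, List.replicate_succ] using h)
      exact ⟨by rw [this.1], this.2⟩

theorem flatMap_unary_injective : Function.Injective (fun l : List ℕ => l.flatMap unary) := by
  intro l
  induction l with
  | nil => intro l' h; cases l' <;> simp_all [unary]
  | cons m l ih =>
    intro l' h
    cases l' with
    | nil => simp [unary] at h
    | cons n l' =>
      obtain ⟨h1, h2⟩ := unary_append_inj (by simpa only [List.flatMap_cons] using h)
      rw [h1, ih h2]

theorem flatMap_inj_of_length {α β : Type} {f g : α → List β}
    (hl : ∀ x, (f x).length = (g x).length) :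
    ∀ l : List α, l.flatMap f = l.flatMap g → ∀ x ∈ l, f x = g x
  | [], _ => by simp
  | y :: l, h => by
    rw [List.flatMap_cons, List.flatMap_cons] at h
    obtain ⟨h1, h2⟩ := List.append_inj h (hl y)
    intro x hx
    rcases List.mem_cons.1 hx with rfl | hx
    · exact h1
    · exact flatMap_inj_of_length hl l h2 x hx

/-- Different automata have different codes. -/
theorem PDFA.code_injective (k : ℕ) : Function.Injective (PDFA.code (k := k)) := by
  intro A B h
  have h' := flatMap_unary_injective h
  obtain ⟨n, a, F, T⟩ := A
  obtain ⟨n', a', F', T'⟩ := B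
  simp only [List.cons.injEq] at h'
  obtain ⟨hn, ha, hr⟩ := h'
  subst hn
  have hrow := flatMap_inj_of_length (by intro q; simp [PDFA.row]) _ hr
  have ha' : a = a' := Fin.ext ha
  have hF : F = F' := by
    funext q
    have := hrow q (List.mem_finRange q)
    simp only [PDFA.row, List.cons.injEq] at this
    have h1 := this.1
    cases hF : F q <;> cases hF' : F' q <;> simp_all
  have hT : T = T' := by
    funext q c
    have := hrow q (List.mem_finRange q)
    simp only [PDFA.row, List.cons.injEq] at this
    have h1 := List.map_inj_left.1 this.2 c (List.mem_finRange c)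
    cases hq : T q c <;> cases hq' : T' q c <;> simp_all [Fin.ext_iff]
  subst ha' hF hT
  rfl

/-- `f` is computable in polynomial time by a Turing machine that reads the code of the
automaton and writes the number `f A` in binary. -/
def PolyTime {k : ℕ} (f : PDFA k → ℕ) : Prop :=
  Nonempty (Turing.TM2ComputableInPolyTime (PDFA.code (k := k)) Computability.encodeNat f)

end PushPopRight

open PushPopRight

/-! Let n be the number of states. A state is live if it accepts words of unbounded length,
equivalently some word of length at least n. A live word is one that leads from the initial state to
a live state; these are the words with infinitely many accepted extensions. The least number of
parts is the number of live words of length n, except that a finite nonempty language has no such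
word and needs one part.

Lower bound. In an infinite listing without repetition, all but finitely many words are long. Once
their lengths exceed m + d, steps of at most d operations no longer change the first m letters.
Hence a part contains infinitely many extensions of at most one word of each length
(`Orderable.eq_of_infinite`), and there are at least as many parts as live words of any given length
(`PartitionOrderable.card_le`). An accepted word of length at least n is a live word followed by n
letters, so boundedly many live words also force slenderness.

Upper bound. If the language is slender, the number of live words is bounded, and a live state on a
loop can be continued to live states in only one way (`card_liveWords_of_loop`). A live word of
length n has already met a loop, so it has a single infinite live continuation, the spine. Accepted
words leave the spine at most n letters before their end. Sorting them by the depth at which they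
leave makes all steps bounded (`orderable_of_chain`). The finitely many words without a live prefix
of length n may join any part.

Polynomial time. The number of parts results from three groups of n rounds of dynamic programming on
the transition table: which states reach a final state, which states are live, and how many words of
length n lead to live states. The binary numbers gain at most k bits per round. The computation is
written as a structured stack program with explicit time bounds and compiled to a machine
(`Runs.reaches`).

Enumeration. If one part suffices and the language is infinite, the spine starts at the initial
state. The ends by which accepted words leave the spine depend only on the state reached there, and
these states repeat with period n! from depth n on, so the scripts are ultimately periodic. A step
removes at most n letters, and by a pumping argument it appends at most n (`length_le_of_gap`). All
objects are found by bounded searches with a membership test read off the code, so the algorithm is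
primitive recursive. -/

open PushPopRight

/-! ### Structured stack programs and their compilation to machines -/

namespace StackProgram

/-- Structured programs on a family of stacks of bits. -/
inductive Prog (K : Type) : Type where
  | skip : Prog K
  /-- push a bit -/
  | push (k : K) (b : Bool) : Prog K
  | seq (p q : Prog K) : Prog K
  /-- pop a stack and continue according to the result (empty, `false`, `true`) -/
  | popCase (k : K) (pe pf pt : Prog K) : Prog K
  /-- pop a stack until it is empty, running `pf` or `pt` after each pop -/
  | drain (k : K) (pf pt : Prog K) : Prog K
  /-- pop a stack as long as `true` is popped, running `p` after each such pop -/
  | whileTrue (k : K) (p : Prog K) : Prog K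

variable {K : Type} [DecidableEq K]

open Function (update)

/-- `Runs p s s' t`: started on the stacks `s`, the program `p` stops after at most `t` steps
with the stacks `s'`. -/
inductive Runs : Prog K → (K → List Bool) → (K → List Bool) → ℕ → Prop
  | skip {s t} : 1 ≤ t → Runs .skip s s t
  | push {k b s t} : 1 ≤ t → Runs (.push k b) s (update s k (b :: s k)) t
  | seq {p q s s' s'' t t' T} : Runs p s s' t → Runs q s' s'' t' → t + t' ≤ T →
      Runs (.seq p q) s s'' T
  | popCase_nil {k pe pf pt s s' t T} : s k = [] → Runs pe s s' t → t + 1 ≤ T →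
      Runs (.popCase k pe pf pt) s s' T
  | popCase_cons {k pe pf pt s s' t T b l} : s k = b :: l →
      Runs (bif b then pt else pf) (update s k l) s' t → t + 1 ≤ T →
      Runs (.popCase k pe pf pt) s s' T
  | drain_nil {k pf pt s T} : s k = [] → 1 ≤ T → Runs (.drain k pf pt) s s T
  | drain_cons {k pf pt s s' s'' t t' T b l} : s k = b :: l →
      Runs (bif b then pt else pf) (update s k l) s' t → Runs (.drain k pf pt) s' s'' t' →
      t + t' + 1 ≤ T → Runs (.drain k pf pt) s s'' T
  | whileTrue_false {k p s T l} : s k = false :: l → 1 ≤ T →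
      Runs (.whileTrue k p) s (update s k l) T
  | whileTrue_true {k p s s' s'' t t' T l} : s k = true :: l →
      Runs p (update s k l) s' t → Runs (.whileTrue k p) s' s'' t' →
      t + t' + 1 ≤ T → Runs (.whileTrue k p) s s'' T

theorem Runs.mono {p : Prog K} {s s' : K → List Bool} {t T : ℕ} (h : Runs p s s' t)
    (hT : t ≤ T) : Runs p s s' T := by
  cases h with
  | skip h => exact .skip (h.trans hT)
  | push h => exact .push (h.trans hT)
  | seq h1 h2 h => exact .seq h1 h2 (h.trans hT)
  | popCase_nil h1 h2 h => exact .popCase_nil h1 h2 (h.trans hT)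
  | popCase_cons h1 h2 h => exact .popCase_cons h1 h2 (h.trans hT)
  | drain_nil h1 h => exact .drain_nil h1 (h.trans hT)
  | drain_cons h1 h2 h3 h => exact .drain_cons h1 h2 h3 (h.trans hT)
  | whileTrue_false h1 h => exact .whileTrue_false h1 (h.trans hT)
  | whileTrue_true h1 h2 h3 h => exact .whileTrue_true h1 h2 h3 (h.trans hT)

/-! ### Compilation to Turing machines with stacks -/

/-- The labels of the compiled program. -/
def Lab : Prog K → Type
  | .skip => Unit
  | .push _ _ => Unit
  | .seq p q => Lab p ⊕ Lab q
  | .popCase _ pe pf pt => Option (Lab pe ⊕ Lab pf ⊕ Lab pt)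
  | .drain _ pf pt => Option (Lab pf ⊕ Lab pt)
  | .whileTrue _ p => Option (Lab p)

instance Lab.fintype : (p : Prog K) → Fintype (Lab p)
  | .skip => inferInstanceAs (Fintype Unit)
  | .push _ _ => inferInstanceAs (Fintype Unit)
  | .seq p q =>
    haveI := Lab.fintype p
    haveI := Lab.fintype q
    inferInstanceAs (Fintype (Lab p ⊕ Lab q))
  | .popCase _ pe pf pt =>
    haveI := Lab.fintype pe
    haveI := Lab.fintype pf
    haveI := Lab.fintype pt
    inferInstanceAs (Fintype (Option (Lab pe ⊕ Lab pf ⊕ Lab pt)))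
  | .drain _ pf pt =>
    haveI := Lab.fintype pf
    haveI := Lab.fintype pt
    inferInstanceAs (Fintype (Option (Lab pf ⊕ Lab pt)))
  | .whileTrue _ p =>
    haveI := Lab.fintype p
    inferInstanceAs (Fintype (Option (Lab p)))

/-- The label at which the compiled program starts. -/
def entry : (p : Prog K) → Lab p
  | .skip => ()
  | .push _ _ => ()
  | .seq p _ => Sum.inl (entry p)
  | .popCase _ _ _ _ => (none : Option _)
  | .drain _ _ _ => (none : Option _)
  | .whileTrue _ _ => (none : Option _)

/-- Pop the stack `k` and jump according to the result. -/
def popGoto {Λ : Type} (k : K) (le lf lt : Λ) :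
    Turing.TM2.Stmt (fun _ : K => Bool) Λ (Option Bool) :=
  .pop k (fun _ o => o) (.goto fun o => o.elim le fun b => bif b then lt else lf)

/-- The compiled program, with its labels embedded in `Λ` and leaving to the label `exit`. -/
def code {Λ : Type} : (p : Prog K) → (Lab p → Λ) → Λ → Lab p →
    Turing.TM2.Stmt (fun _ : K => Bool) Λ (Option Bool)
  | .skip, _, exit => fun _ => .goto fun _ => exit
  | .push k b, _, exit => fun _ => .push k (fun _ => b) (.goto fun _ => exit)
  | .seq p q, emb, exit => fun l => Sum.elim
      (code p (fun x => emb (Sum.inl x)) (emb (Sum.inr (entry q))))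
      (code q (fun x => emb (Sum.inr x)) exit) l
  | .popCase k pe pf pt, emb, exit => fun l => Option.elim l
      (popGoto k (emb (some (.inl (entry pe)))) (emb (some (.inr (.inl (entry pf)))))
        (emb (some (.inr (.inr (entry pt))))))
      (Sum.elim (code pe (fun x => emb (some (.inl x))) exit)
        (Sum.elim (code pf (fun x => emb (some (.inr (.inl x)))) exit)
          (code pt (fun x => emb (some (.inr (.inr x)))) exit)))
  | .drain k pf pt, emb, exit => fun l => Option.elim l
      (popGoto k exit (emb (some (.inl (entry pf)))) (emb (some (.inr (entry pt)))))
      (Sum.elim (code pf (fun x => emb (some (.inl x))) (emb none))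
        (code pt (fun x => emb (some (.inr x))) (emb none)))
  | .whileTrue k p, emb, exit => fun l => Option.elim l
      (popGoto k exit exit (emb (some (entry p))))
      (code p (fun x => emb (some x)) (emb none))

/-- `t` steps of the machine `M`. -/
def steps {Λ : Type} (M : Λ → Turing.TM2.Stmt (fun _ : K => Bool) Λ (Option Bool)) (t : ℕ)
    (c : Option (Turing.TM2.Cfg (fun _ : K => Bool) Λ (Option Bool))) :
    Option (Turing.TM2.Cfg (fun _ : K => Bool) Λ (Option Bool)) :=
  (flip bind (Turing.TM2.step M))^[t] c

/-- From the label `l` and the stacks `s`, the machine reaches the label `l'` and the stacks `s'`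
within `T` steps, whatever its internal state. -/
def Reaches {Λ : Type} (M : Λ → Turing.TM2.Stmt (fun _ : K => Bool) Λ (Option Bool))
    (l l' : Λ) (s s' : K → List Bool) (T : ℕ) : Prop :=
  ∀ v, ∃ t ≤ T, ∃ v', steps M t (some ⟨some l, v, s⟩) = some ⟨some l', v', s'⟩

section
variable {Λ : Type} {M : Λ → Turing.TM2.Stmt (fun _ : K => Bool) Λ (Option Bool)}

theorem Reaches.trans {l l' l'' : Λ} {s s' s'' : K → List Bool} {t t' T : ℕ}
    (h : Reaches M l l' s s' t) (h' : Reaches M l' l'' s' s'' t') (hT : t + t' ≤ T) :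
    Reaches M l l'' s s'' T := by
  intro v
  obtain ⟨n, hn, w, e⟩ := h v
  obtain ⟨n', hn', w', e'⟩ := h' w
  refine ⟨n' + n, by omega, w', ?_⟩
  rw [steps, Function.iterate_add_apply]
  exact (congrArg _ e).trans e'

theorem Reaches.of_step {l l' : Λ} {s s' : K → List Bool} {T : ℕ} (hT : 1 ≤ T)
    (h : ∀ v, ∃ v', Turing.TM2.stepAux (M l) v s = ⟨some l', v', s'⟩) :
    Reaches M l l' s s' T := by
  intro v
  obtain ⟨v', e⟩ := h v
  exact ⟨1, hT, v', by simp [steps, flip, e]⟩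

theorem reaches_popGoto_nil {l le lf lt : Λ} {k : K} {s : K → List Bool}
    (hM : M l = popGoto k le lf lt) (hs : s k = []) : Reaches M l le s s 1 := by
  refine Reaches.of_step le_rfl fun v => ⟨none, ?_⟩
  have : update s k [] = s := by rw [← hs]; exact Function.update_eq_self k s
  simp [hM, popGoto, hs, this]

theorem reaches_popGoto_cons {l le lf lt : Λ} {k : K} {s : K → List Bool} {b : Bool}
    {r : List Bool} (hM : M l = popGoto k le lf lt) (hs : s k = b :: r) :
    Reaches M l (bif b then lt else lf) s (update s k r) 1 := by
  refine Reaches.of_step le_rfl fun v => ⟨some b, ?_⟩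
  simp [hM, popGoto, hs]

/-- Embedding and exit label are arbitrary, so a subprogram is a piece of the same machine whose
exit is the entry of what follows. The body of a loop exits to the test label of the loop, where the
remaining iterations start again. -/
theorem Runs.reaches {p : Prog K} {s s' : K → List Bool} {T : ℕ} (h : Runs p s s' T) :
    ∀ (emb : Lab p → Λ) (exit : Λ), (∀ l, M (emb l) = code p emb exit l) →
      Reaches M (emb (entry p)) exit s s' T := by
  induction h with
  | skip ht =>
    intro emb exit hM
    exact Reaches.of_step ht fun v => ⟨v, by rw [hM]; rfl⟩
  | push ht =>
    intro emb exit hM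
    exact Reaches.of_step ht fun v => ⟨v, by rw [hM]; rfl⟩
  | seq _ _ hT ih1 ih2 =>
    intro emb exit hM
    exact Reaches.trans (ih1 (fun x => emb (Sum.inl x)) _ fun l => hM (Sum.inl l))
      (ih2 (fun x => emb (Sum.inr x)) exit fun l => hM (Sum.inr l)) hT
  | popCase_nil hs _ hT ih =>
    intro emb exit hM
    exact Reaches.trans (reaches_popGoto_nil (hM none) hs)
      (ih (fun x => emb (some (.inl x))) exit fun l => hM (some (.inl l))) (by omega)
  | @popCase_cons k pe pf pt s s' t T b l hs _ hT ih =>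
    intro emb exit hM
    refine Reaches.trans (reaches_popGoto_cons (hM none) hs) (t' := t) ?_ (by omega)
    cases b
    · exact ih (fun x => emb (some (.inr (.inl x)))) exit fun l => hM (some (.inr (.inl l)))
    · exact ih (fun x => emb (some (.inr (.inr x)))) exit fun l => hM (some (.inr (.inr l)))
  | drain_nil hs hT =>
    intro emb exit hM v
    obtain ⟨t, ht, h⟩ := reaches_popGoto_nil (hM none) hs v
    exact ⟨t, ht.trans hT, h⟩
  | @drain_cons k pf pt s s' s'' t t' T b l hs _ _ hT ih1 ih2 =>
    intro emb exit hM
    refine Reaches.trans (reaches_popGoto_cons (hM none) hs) (t' := t + t') ?_ (by omega)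
    refine Reaches.trans (t := t) ?_ (ih2 emb exit hM) le_rfl
    cases b
    · exact ih1 (fun x => emb (some (.inl x))) (emb none) fun l => hM (some (.inl l))
    · exact ih1 (fun x => emb (some (.inr x))) (emb none) fun l => hM (some (.inr l))
  | whileTrue_false hs hT =>
    intro emb exit hM v
    obtain ⟨t, ht, h⟩ := reaches_popGoto_cons (hM none) hs v
    exact ⟨t, ht.trans hT, h⟩
  | @whileTrue_true k p s s' s'' t t' T l hs _ _ hT ih1 ih2 =>
    intro emb exit hM
    refine Reaches.trans (reaches_popGoto_cons (hM none) hs) (t' := t + t') ?_ (by omega)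
    exact Reaches.trans (ih1 (fun x => emb (some x)) (emb none) fun l => hM (some l))
      (ih2 emb exit hM) le_rfl

end

/-- The machine running the program `p`, with input stack `i` and output stack `o`. -/
def machine [Fintype K] (p : Prog K) (i o : K) : Turing.FinTM2 where
  K := K
  k₀ := i
  k₁ := o
  Γ _ := Bool
  Λ := Option (Lab p)
  main := some (entry p)
  σ := Option Bool
  initialState := none
  Γk₀Fin := inferInstanceAs (Fintype Bool)
  m l := l.elim (.load (fun _ => none) .halt) (code p some none)

theorem dite_eq_update (i k : K) (l : List Bool) :
    (dite (k = i) (fun _ => l) fun _ => []) = update (fun _ => []) i l k := by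
  rw [Function.update_apply]
  split_ifs <;> rfl

/-- A program that on every input word `ea a` computes the output word `eb (f a)` in polynomial
time gives a polynomial time machine. -/
theorem computableInPolyTime [Fintype K] {α β : Type} {ea : α → List Bool} {eb : β → List Bool}
    {f : α → β} (p : Prog K) (i o : K) (time : Polynomial ℕ)
    (h : ∀ a, Runs p (update (fun _ => []) i (ea a)) (update (fun _ => []) o (eb (f a)))
      (time.eval (ea a).length)) :
    Nonempty (Turing.TM2ComputableInPolyTime ea eb f) := by
  -- The additional step executes the exit label `none`, which resets the internal state and halts,
  -- as the final configuration demands.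
  refine ⟨⟨⟨machine p i o, Equiv.refl Bool, Equiv.refl Bool⟩, time + 1, fun a => ?_⟩⟩
  have key : ∃ t ≤ time.eval (ea a).length + 1,
      steps (machine p i o).m t (some (Turing.initList (machine p i o) (ea a))) =
        some (Turing.haltList (machine p i o) (eb (f a))) := by
    have e1 : Turing.initList (machine p i o) (ea a) =
        ⟨some (some (entry p)), none, update (fun _ => []) i (ea a)⟩ := by
      unfold Turing.initList
      congr 1
      exact funext fun k : K => dite_eq_update i k _
    have e2 : Turing.haltList (machine p i o) (eb (f a)) =
        ⟨none, none, update (fun _ => []) o (eb (f a))⟩ := by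
      unfold Turing.haltList
      congr 1
      exact funext fun k : K => dite_eq_update o k _
    obtain ⟨t, ht, v, e⟩ :=
      (h a).reaches (M := (machine p i o).m) some none (fun _ => rfl) none
    refine ⟨1 + t, by omega, ?_⟩
    rw [e1, e2]
    unfold steps
    rw [Function.iterate_add_apply]
    refine (congrArg _ e).trans ?_
    rfl
  refine Classical.choice ?_
  obtain ⟨t, ht, e⟩ := key
  refine ⟨⟨⟨t, ?_⟩, by simpa using ht⟩⟩
  have hid : ∀ l : List Bool, l.map (Equiv.refl Bool).invFun = l := fun l => List.map_id l
  have e' : ∀ l l' : List Bool, l = ea a → l' = eb (f a) →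
      steps (machine p i o).m t (some (Turing.initList (machine p i o) l)) =
        some (Turing.haltList (machine p i o) l') := by
    rintro _ _ rfl rfl
    exact e
  exact e' _ _ (hid _) (hid _)

end StackProgram

/-! ### Stack programs for binary numbers -/

namespace StackProgram

/-! ### The stacks of the counting program -/

/-- Names of the stacks of the counting program. -/
inductive Stk : Type where
  | tab | tab' | vec | vec' | acc | tmp | car | new | cnt | cnt' | st | st' | out
  deriving DecidableEq

instance : Fintype Stk where
  elems := {.tab, .tab', .vec, .vec', .acc, .tmp, .car, .new, .cnt, .cnt', .st, .st', .out}
  complete k := by cases k <;> decide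

/-- Contents of the stacks of the counting program. -/
structure Mem : Type where
  (tab tab' vec vec' acc tmp car new cnt cnt' st st' out : List Bool)

/-- The contents of a stack. -/
def Mem.get (m : Mem) : Stk → List Bool
  | .tab => m.tab | .tab' => m.tab' | .vec => m.vec | .vec' => m.vec' | .acc => m.acc
  | .tmp => m.tmp | .car => m.car | .new => m.new | .cnt => m.cnt | .cnt' => m.cnt'
  | .st => m.st | .st' => m.st' | .out => m.out

/-- Replace the contents of a stack. -/
def Mem.set (m : Mem) (k : Stk) (l : List Bool) : Mem :=
  match k with
  | .tab => { m with tab := l } | .tab' => { m with tab' := l }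
  | .vec => { m with vec := l } | .vec' => { m with vec' := l }
  | .acc => { m with acc := l } | .tmp => { m with tmp := l }
  | .car => { m with car := l } | .new => { m with new := l }
  | .cnt => { m with cnt := l } | .cnt' => { m with cnt' := l }
  | .st => { m with st := l } | .st' => { m with st' := l } | .out => { m with out := l }

theorem Mem.get_set (m : Mem) (k : Stk) (l : List Bool) :
    (m.set k l).get = Function.update m.get k l := by
  funext k'
  cases k <;> cases k' <;> rfl

theorem Mem.get_set_self (m : Mem) (k : Stk) (l : List Bool) : (m.set k l).get k = l := by
  rw [get_set, Function.update_self]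

theorem Mem.get_set_of_ne (m : Mem) {k k' : Stk} (h : k' ≠ k) (l : List Bool) :
    (m.set k l).get k' = m.get k' := by
  rw [get_set, Function.update_of_ne h]

theorem Mem.set_set (m : Mem) (k : Stk) (l l' : List Bool) :
    (m.set k l).set k l' = m.set k l' := by
  cases k <;> rfl

theorem Mem.set_comm (m : Mem) {k k' : Stk} (h : k' ≠ k) (l l' : List Bool) :
    (m.set k l).set k' l' = (m.set k' l').set k l := by
  cases k <;> cases k' <;> first | rfl | exact absurd rfl h

theorem Mem.set_get (m : Mem) (k : Stk) : m.set k (m.get k) = m := by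
  cases k <;> rfl

/-- `Runs` for the counting program. -/
def RunsM (p : Prog Stk) (m m' : Mem) (t : ℕ) : Prop := Runs p m.get m'.get t

namespace RunsM

variable {p q pe pf pt : Prog Stk} {k a b : Stk} {m m' m'' : Mem} {t t' T : ℕ} {l : List Bool}

theorem of_eq (h : RunsM p m m' t) (hm : m' = m'') (hT : t ≤ T) : RunsM p m m'' T :=
  hm ▸ Runs.mono h hT

theorem of_eq_left (h : RunsM p m m' t) (hm : m'' = m) : RunsM p m'' m' t := hm ▸ h

theorem mono (h : RunsM p m m' t) (hT : t ≤ T) : RunsM p m m' T := Runs.mono h hT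

theorem skip : RunsM .skip m m 1 := Runs.skip le_rfl

theorem push (k : Stk) (b : Bool) : RunsM (.push k b) m (m.set k (b :: m.get k)) 1 := by
  rw [RunsM, Mem.get_set]
  exact Runs.push le_rfl

theorem seq (h : RunsM p m m' t) (h' : RunsM q m' m'' t') : RunsM (.seq p q) m m'' (t + t') :=
  Runs.seq h h' le_rfl

theorem popCase_nil (h : m.get k = []) (h' : RunsM pe m m' t) :
    RunsM (.popCase k pe pf pt) m m' (t + 1) := Runs.popCase_nil h h' le_rfl

theorem popCase_cons {b : Bool} (h : m.get k = b :: l)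
    (h' : RunsM (bif b then pt else pf) (m.set k l) m' t) :
    RunsM (.popCase k pe pf pt) m m' (t + 1) := by
  rw [RunsM, Mem.get_set] at h'
  exact Runs.popCase_cons h h' le_rfl

theorem drain_nil (h : m.get k = []) : RunsM (.drain k pf pt) m m 1 := Runs.drain_nil h le_rfl

theorem drain_cons {b : Bool} (h : m.get k = b :: l)
    (h' : RunsM (bif b then pt else pf) (m.set k l) m' t)
    (h'' : RunsM (.drain k pf pt) m' m'' t') :
    RunsM (.drain k pf pt) m m'' (t + t' + 1) := by
  rw [RunsM, Mem.get_set] at h'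
  exact Runs.drain_cons h h' h'' le_rfl

theorem whileTrue_false (h : m.get k = false :: l) :
    RunsM (.whileTrue k p) m (m.set k l) 1 := by
  rw [RunsM, Mem.get_set]
  exact Runs.whileTrue_false h le_rfl

theorem whileTrue_true (h : m.get k = true :: l)
    (h' : RunsM p (m.set k l) m' t) (h'' : RunsM (.whileTrue k p) m' m'' t') :
    RunsM (.whileTrue k p) m m'' (t + t' + 1) := by
  rw [RunsM, Mem.get_set] at h'
  exact Runs.whileTrue_true h h' h'' le_rfl

end RunsM

/-! ### Moving and clearing stacks -/

/-- Pour the stack `a` onto the stack `b`. -/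
def move (a b : Stk) : Prog Stk := .drain a (.push b false) (.push b true)

theorem runs_move {a b : Stk} (hab : a ≠ b) (m : Mem) :
    RunsM (move a b) m ((m.set a []).set b ((m.get a).reverse ++ m.get b))
      (2 * (m.get a).length + 1) := by
  generalize hl : m.get a = l
  induction l generalizing m with
  | nil =>
    refine (RunsM.drain_nil hl).of_eq ?_ (by simp)
    have : m.set a [] = m := by rw [← hl, Mem.set_get]
    rw [this]
    exact (Mem.set_get m b).symm
  | cons x l ih =>
    have h1 : RunsM (bif x then Prog.push b true else Prog.push b false) (m.set a l)
        ((m.set a l).set b (x :: m.get b)) 1 := by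
      rw [← Mem.get_set_of_ne m hab.symm l]
      cases x
      · exact RunsM.push b false
      · exact RunsM.push b true
    have h2 := ih ((m.set a l).set b (x :: m.get b)) (by
      rw [Mem.get_set_of_ne _ hab, Mem.get_set_self])
    have h3 := RunsM.drain_cons hl h1 h2
    rw [Mem.get_set_self, Mem.set_comm _ hab, Mem.set_set, Mem.set_set] at h3
    refine h3.of_eq ?_ (by simp only [List.length_cons]; omega)
    rw [List.reverse_cons, List.append_assoc]
    rfl

/-- Empty the stack `a`. -/
def clear (a : Stk) : Prog Stk := .drain a .skip .skip

theorem runs_clear (a : Stk) (m : Mem) :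
    RunsM (clear a) m (m.set a []) (2 * (m.get a).length + 1) := by
  generalize hl : m.get a = l
  induction l generalizing m with
  | nil =>
    have : m.set a [] = m := by rw [← hl, Mem.set_get]
    rw [this]
    exact RunsM.drain_nil hl
  | cons x l ih =>
    have h1 : RunsM (bif x then Prog.skip else Prog.skip) (m.set a l) (m.set a l) 1 := by
      cases x <;> exact RunsM.skip
    have h3 := RunsM.drain_cons hl h1 (ih (m.set a l) (Mem.get_set_self ..))
    rw [Mem.set_set] at h3
    exact h3.mono (by simp only [List.length_cons]; omega)

/-! ### Binary numbers on the stack of the vector -/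

/-- A list of bits with an end marker: every bit is preceded by `true`, and `false` ends. -/
def item (x : List Bool) : List Bool := x.flatMap (fun b => [true, b]) ++ [false]

@[simp] theorem item_nil : item [] = [false] := rfl

@[simp] theorem item_cons (b : Bool) (x : List Bool) : item (b :: x) = true :: b :: item x := rfl

@[simp] theorem length_item (x : List Bool) : (item x).length = 2 * x.length + 1 := by
  induction x with
  | nil => rfl
  | cons b x ih => simp only [item_cons, List.length_cons, ih]; ring

/-- Pop the next item of the vector and run `pf` or `pt` for each bit. -/
def forItem (pf pt : Prog Stk) : Prog Stk := .whileTrue .vec (.popCase .vec .skip pf pt)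

/-- Pop the next item of the vector. -/
def dropItem : Prog Stk := forItem .skip .skip

theorem runs_dropItem (x : List Bool) {v : List Bool} {m : Mem} (h : m.vec = item x ++ v) :
    RunsM dropItem m { m with vec := v } (3 * x.length + 1) := by
  induction x generalizing m with
  | nil => exact RunsM.whileTrue_false h
  | cons b x ih =>
    have h1 : RunsM (.popCase .vec .skip .skip .skip) { m with vec := b :: (item x ++ v) }
        { m with vec := item x ++ v } 2 := by
      refine RunsM.popCase_cons (l := item x ++ v) (b := b) rfl ?_
      cases b <;> exact RunsM.skip
    exact (RunsM.whileTrue_true (k := .vec) h h1 (ih (m := { m with vec := item x ++ v }) rfl)).mono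
      (by simp only [List.length_cons]; omega)

/-- Move the next item of the vector to the top of another stack, as bare bits. -/
def itemBits : Prog Stk := forItem (.push .tmp false) (.push .tmp true)

theorem runs_itemBits (x : List Bool) {v : List Bool} {m : Mem} (h : m.vec = item x ++ v) :
    RunsM itemBits m { m with vec := v, tmp := x.reverse ++ m.tmp } (3 * x.length + 1) := by
  induction x generalizing m with
  | nil => exact RunsM.whileTrue_false h
  | cons b x ih =>
    have h1 : RunsM (.popCase .vec .skip (.push .tmp false) (.push .tmp true))
        { m with vec := b :: (item x ++ v) }
        { m with vec := item x ++ v, tmp := b :: m.tmp } 2 := by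
      refine RunsM.popCase_cons (l := item x ++ v) (b := b) rfl ?_
      cases b
      · exact RunsM.push .tmp false
      · exact RunsM.push .tmp true
    have h2 := (RunsM.whileTrue_true (k := .vec) h h1
      (ih (m := { m with vec := item x ++ v, tmp := b :: m.tmp }) rfl))
    exact h2.of_eq (by simp) (by simp only [List.length_cons]; omega)

/-- Move the next item of the vector to the auxiliary stack, running `p b` for each bit `b`. -/
def passItem (pf pt : Prog Stk) : Prog Stk :=
  .seq (.whileTrue .vec (.seq (.push .vec' true)
    (.popCase .vec .skip (.seq (.push .vec' false) pf) (.seq (.push .vec' true) pt))))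
    (.push .vec' false)

/-- Move the next item of the vector to the auxiliary stack. -/
def moveItem : Prog Stk := passItem .skip .skip

theorem runs_moveItem (x : List Bool) {v : List Bool} {m : Mem} (h : m.vec = item x ++ v) :
    RunsM moveItem m { m with vec := v, vec' := (item x).reverse ++ m.vec' }
      (5 * x.length + 2) := by
  have key : RunsM (.whileTrue .vec (.seq (.push .vec' true)
      (.popCase .vec .skip (.seq (.push .vec' false) .skip) (.seq (.push .vec' true) .skip)))) m
      { m with vec := v, vec' := (x.flatMap (fun b => [true, b])).reverse ++ m.vec' }
      (5 * x.length + 1) := by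
    induction x generalizing m with
    | nil => exact RunsM.whileTrue_false h
    | cons b x ih =>
      have h1 : RunsM (.seq (.push .vec' true)
          (.popCase .vec .skip (.seq (.push .vec' false) .skip) (.seq (.push .vec' true) .skip)))
          { m with vec := b :: (item x ++ v) }
          { m with vec := item x ++ v, vec' := b :: true :: m.vec' } (1 + (1 + 1 + 1)) := by
        refine RunsM.seq (RunsM.push .vec' true) ?_
        refine RunsM.popCase_cons (l := item x ++ v) (b := b) rfl ?_
        cases b
        · exact RunsM.seq (RunsM.push .vec' false) RunsM.skip
        · exact RunsM.seq (RunsM.push .vec' true) RunsM.skip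
      have h2 := (RunsM.whileTrue_true (k := .vec) h h1
        (ih (m := { m with vec := item x ++ v, vec' := b :: true :: m.vec' }) rfl)).mono
        (T := 5 * (b :: x).length + 1) (by simp only [List.length_cons]; omega)
      simpa using h2
  exact (RunsM.seq key (RunsM.push .vec' false)).of_eq
    (by simp [item, Mem.set, Mem.get]) (by omega)

/-! ### Addition -/

/-- The carry of the sum of three bits. -/
def carry (b c d : Bool) : Bool := (b && c) || (d && (b || c))

/-- The sum of a binary number and a bit, least significant bits first. -/
def addCarry : List Bool → Bool → List Bool
  | [], d => if d then [true] else []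
  | c :: y, d => (c ^^ d) :: addCarry y (carry false c d)

/-- The sum of two binary numbers and a bit, least significant bits first. -/
def addBits : List Bool → List Bool → Bool → List Bool
  | [], y, d => addCarry y d
  | b :: x, y, d => (b ^^ y.headD false ^^ d) :: addBits x y.tail (carry b (y.headD false) d)

theorem length_addCarry (y : List Bool) (d : Bool) : (addCarry y d).length ≤ y.length + 1 := by
  induction y generalizing d with
  | nil => cases d <;> simp [addCarry]
  | cons c y ih => simp [addCarry, ih]

/-- Only the final carry can lengthen a sum. This keeps the numbers of polynomial length throughout
the computation. -/
theorem length_addBits (x y : List Bool) (d : Bool) :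
    (addBits x y d).length ≤ max x.length y.length + 1 := by
  induction x generalizing y d with
  | nil => simpa [addBits] using length_addCarry y d
  | cons b x ih =>
    have := ih y.tail (carry b (y.headD false) d)
    simp only [addBits, List.length_cons]
    have h2 : y.tail.length = y.length - 1 := List.length_tail
    omega

/-- Push the sum of the bits `b`, `c`, `d` and the new carry. -/
def sumOut (b c d : Bool) : Prog Stk :=
  .seq (.push .tmp (b ^^ c ^^ d)) (.push .car (carry b c d))

/-- Add the bits `b`, `c` and the carry. -/
def sumCarry (b c : Bool) : Prog Stk := .popCase .car .skip (sumOut b c false) (sumOut b c true)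

theorem runs_sumCarry (b c d : Bool) {m : Mem} (h : m.car = [d]) :
    RunsM (sumCarry b c) m { m with car := [carry b c d], tmp := (b ^^ c ^^ d) :: m.tmp } 3 := by
  refine RunsM.popCase_cons (l := []) (b := d) h ?_
  cases d
  · exact RunsM.seq (RunsM.push .tmp _) (RunsM.push .car _)
  · exact RunsM.seq (RunsM.push .tmp _) (RunsM.push .car _)

/-- Add the bit `b`, the next bit of the accumulator and the carry. -/
def sumAcc (b : Bool) : Prog Stk :=
  .popCase .acc (sumCarry b false) (sumCarry b false) (sumCarry b true)

theorem runs_sumAcc (b d : Bool) {m : Mem} (h : m.car = [d]) :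
    RunsM (sumAcc b) m { m with
      acc := m.acc.tail, car := [carry b (m.acc.headD false) d],
      tmp := (b ^^ m.acc.headD false ^^ d) :: m.tmp } 4 := by
  obtain ⟨tab, tab', vec, vec', acc, tmp, car, new, cnt, cnt', st, st', out⟩ := m
  rcases acc with _ | ⟨c, y⟩
  · exact RunsM.popCase_nil (k := .acc) rfl (runs_sumCarry b false d h)
  · refine RunsM.popCase_cons (l := y) (b := c) rfl ?_
    cases c
    · exact runs_sumCarry b false d h
    · exact runs_sumCarry b true d h

/-- Add the next item of the vector to the accumulator, moving the item to the auxiliary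
stack. -/
def addItem : Prog Stk :=
  .seq (.push .car false) (.seq (passItem (sumAcc false) (sumAcc true))
    (.seq (.drain .acc (sumCarry false false) (sumCarry false true))
      (.seq (.popCase .car .skip .skip (.push .tmp true)) (move .tmp .acc))))

/-- The item may end before the accumulator does. The invariant splits the sum into the bits `z`
already emitted and the addition of the carry `d'` to the unread rest `y'`, which is left to
`runs_drain_sumCarry`. -/
theorem runs_passItem_sumAcc (x : List Bool) {v : List Bool} {m : Mem} {d : Bool}
    (h : m.vec = item x ++ v) (hd : m.car = [d]) :
    ∃ z y' d', addBits x m.acc d = z ++ addCarry y' d' ∧ y'.length ≤ m.acc.length ∧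
      RunsM (passItem (sumAcc false) (sumAcc true)) m { m with
        vec := v, vec' := (item x).reverse ++ m.vec', acc := y', car := [d'],
        tmp := z.reverse ++ m.tmp } (8 * x.length + 2) := by
  have key : ∃ z y' d', addBits x m.acc d = z ++ addCarry y' d' ∧ y'.length ≤ m.acc.length ∧
      RunsM (.whileTrue .vec (.seq (.push .vec' true)
        (.popCase .vec .skip (.seq (.push .vec' false) (sumAcc false))
          (.seq (.push .vec' true) (sumAcc true))))) m
      { m with vec := v, vec' := (x.flatMap (fun b => [true, b])).reverse ++ m.vec',
               acc := y', car := [d'], tmp := z.reverse ++ m.tmp } (8 * x.length + 1) := by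
    induction x generalizing m d with
    | nil =>
      refine ⟨[], m.acc, d, rfl, le_rfl, ?_⟩
      exact (RunsM.whileTrue_false (k := .vec) (m := m) (l := v) h).of_eq
        (by rw [← hd]; rfl) le_rfl
    | cons b x ih =>
      set m1 : Mem := { m with
        vec := item x ++ v, vec' := b :: true :: m.vec', acc := m.acc.tail,
        car := [carry b (m.acc.headD false) d],
        tmp := (b ^^ m.acc.headD false ^^ d) :: m.tmp } with hm1
      have h1 : RunsM (.seq (.push .vec' true)
          (.popCase .vec .skip (.seq (.push .vec' false) (sumAcc false))
            (.seq (.push .vec' true) (sumAcc true))))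
          { m with vec := b :: (item x ++ v) } m1 (1 + (1 + 4 + 1)) := by
        refine RunsM.seq (RunsM.push .vec' true) ?_
        refine RunsM.popCase_cons (l := item x ++ v) (b := b) rfl ?_
        cases b
        · exact RunsM.seq (RunsM.push .vec' false) (runs_sumAcc false d hd)
        · exact RunsM.seq (RunsM.push .vec' true) (runs_sumAcc true d hd)
      obtain ⟨z, y', d', e, hl, hr⟩ := ih (m := m1) (d := carry b (m.acc.headD false) d) rfl rfl
      refine ⟨(b ^^ m.acc.headD false ^^ d) :: z, y', d', ?_, ?_, ?_⟩
      · rw [addBits]; exact congrArg _ e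
      · refine hl.trans ?_
        simp [hm1]
      · exact (RunsM.whileTrue_true (k := .vec) h h1 hr).of_eq (by simp [hm1])
          (by simp only [List.length_cons]; omega)
  obtain ⟨z, y', d', e, hl, hr⟩ := key
  refine ⟨z, y', d', e, hl, ?_⟩
  exact (RunsM.seq hr (RunsM.push .vec' false)).of_eq
    (by simp [item, Mem.set, Mem.get]) (by omega)

/-- The rest of the accumulator is added to the carry alone. A final bit is emitted only if the last
carry is `true`, so it never creates a superfluous zero. -/
theorem runs_drain_sumCarry {m : Mem} {d : Bool} (hd : m.car = [d]) :
    RunsM (.seq (.drain .acc (sumCarry false false) (sumCarry false true))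
      (.popCase .car .skip .skip (.push .tmp true))) m
      { m with acc := [], car := [], tmp := (addCarry m.acc d).reverse ++ m.tmp }
      (4 * m.acc.length + 3) := by
  have key : ∀ y, m.acc = y → ∃ z d', addCarry y d = z ++ addCarry [] d' ∧
      RunsM (.drain .acc (sumCarry false false) (sumCarry false true)) m
      { m with acc := [], car := [d'], tmp := z.reverse ++ m.tmp } (4 * y.length + 1) := by
    intro y hy
    induction y generalizing m d with
    | nil =>
      refine ⟨[], d, rfl, ?_⟩
      refine (RunsM.drain_nil (k := .acc) hy).of_eq ?_ le_rfl
      obtain ⟨tab, tab', vec, vec', acc, tmp, car, new, cnt, cnt', st, st', out⟩ := m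
      subst hd hy
      rfl
    | cons c y ih =>
      set m1 : Mem := { m with
        acc := y, car := [carry false c d], tmp := (false ^^ c ^^ d) :: m.tmp } with hm1
      have h1 : RunsM (bif c then sumCarry false true else sumCarry false false)
          { m with acc := y } m1 3 := by
        cases c
        · exact runs_sumCarry false false d (m := { m with acc := y }) hd
        · exact runs_sumCarry false true d (m := { m with acc := y }) hd
      obtain ⟨z, d', e, hr⟩ := ih (m := m1) (d := carry false c d) rfl rfl
      refine ⟨(c ^^ d) :: z, d', ?_, ?_⟩
      · change (c ^^ d) :: addCarry y (carry false c d) = _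
        rw [e]; rfl
      · exact (RunsM.drain_cons (k := .acc) hy h1 hr).of_eq (by simp [hm1])
          (by simp only [List.length_cons]; omega)
  obtain ⟨z, d', e, hr⟩ := key _ rfl
  have h2 : RunsM (.popCase .car .skip .skip (.push .tmp true))
      { m with acc := [], car := [d'], tmp := z.reverse ++ m.tmp }
      { m with acc := [], car := [], tmp := (addCarry m.acc d).reverse ++ m.tmp } 2 := by
    refine RunsM.popCase_cons (l := []) (b := d') rfl ?_
    rw [e]
    cases d'
    · exact RunsM.skip.of_eq (by simp [addCarry, Mem.set]) le_rfl
    · exact (RunsM.push .tmp true).of_eq (by simp [addCarry, Mem.set, Mem.get]) le_rfl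
  exact (RunsM.seq hr h2).mono (by omega)

/-- Needed because `addItem` is nested to the right, whereas `runs_drain_sumCarry` treats two of its
stages as one program. -/
theorem RunsM.seq_assoc {p q r : Prog Stk} {m m' : Mem} {t : ℕ}
    (h : RunsM (.seq (.seq p q) r) m m' t) : RunsM (.seq p (.seq q r)) m m' t := by
  cases h with
  | seq h1 h3 hT =>
    cases h1 with
    | seq h1 h2 hT' => exact Runs.seq h1 (Runs.seq h2 h3 le_rfl) (by omega)

theorem runs_addItem (x : List Bool) {v : List Bool} {m : Mem} (h : m.vec = item x ++ v)
    (hcar : m.car = []) (htmp : m.tmp = []) :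
    RunsM addItem m { m with
      vec := v, vec' := (item x).reverse ++ m.vec', acc := addBits x m.acc false }
      (11 * (x.length + m.acc.length) + 10) := by
  obtain ⟨tab, tab', vec, vec', acc, tmp, car, new, cnt, cnt', st, st', out⟩ := m
  simp only at h hcar htmp ⊢
  subst hcar htmp h
  obtain ⟨z, y', d', e, hl, hr⟩ := runs_passItem_sumAcc x (v := v) (d := false)
    (m := ⟨tab, tab', item x ++ v, vec', acc, [], [false], new, cnt, cnt', st, st', out⟩) rfl rfl
  have h3 := RunsM.seq (runs_drain_sumCarry (d := d') (m := ⟨tab, tab', v, (item x).reverse ++ vec',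
    y', z.reverse ++ [], [d'], new, cnt, cnt', st, st', out⟩) rfl)
    (runs_move (a := .tmp) (b := .acc) (by decide) _)
  have h4 := RunsM.seq (RunsM.push (m := ⟨tab, tab', item x ++ v, vec', acc, [], [], new,
    cnt, cnt', st, st', out⟩) .car false) (RunsM.seq hr (RunsM.seq_assoc h3))
  have hlen := length_addBits x acc false
  simp only at e hl
  rw [e] at hlen
  simp only [List.length_append] at hlen
  refine h4.of_eq ?_ ?_
  · simp [Mem.set, Mem.get, e]
  · simp [Mem.get]
    omega

end StackProgram

/-! ### Dynamic programming on the transition table -/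

namespace StackProgram

/-! ### One step of the count -/

/-- A vector of binary numbers, as a list of bits. -/
def encVec (V : List (List Bool)) : List Bool := V.flatMap item

/-- A row of the table: finality, then the successors. -/
def encRow (r : Bool × List ℕ) : List Bool :=
  unary (if r.1 then 1 else 0) ++ r.2.flatMap unary

@[simp] theorem encVec_nil : encVec [] = [] := rfl

@[simp] theorem encVec_cons (x : List Bool) (V : List (List Bool)) :
    encVec (x :: V) = item x ++ encVec V := rfl

@[simp] theorem encVec_append (U V : List (List Bool)) :
    encVec (U ++ V) = encVec U ++ encVec V := by simp [encVec]

theorem length_le_encVec {x : List Bool} {V : List (List Bool)} (h : x ∈ V) :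
    2 * x.length + 1 ≤ (encVec V).length := by
  obtain ⟨U, W, rfl⟩ := List.append_of_mem h
  simp
  omega

theorem length_encVec_le {V : List (List Bool)} {D : ℕ} (h : ∀ x ∈ V, x.length ≤ D) :
    (encVec V).length ≤ V.length * (2 * D + 1) := by
  induction V with
  | nil => simp
  | cons x V ih =>
    have h1 := h x (by simp)
    have h2 := ih fun y hy => h y (by simp [hy])
    simp only [encVec_cons, List.length_append, length_item, List.length_cons]
    nlinarith

theorem unary_succ (e : ℕ) : unary (e + 1) = true :: unary e := rfl

theorem unary_zero : unary 0 = [false] := rfl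

/-- Read an entry of the table and add the corresponding item of the vector to the
accumulator. -/
def readEntry : Prog Stk :=
  .seq (.whileTrue .tab (.seq (.push .tab' true) moveItem))
    (.seq (.push .tab' false) (.seq addItem (move .vec' .vec)))

variable (tab tab' vec vec' acc tmp car new cnt cnt' st st' out : List Bool)

/-- The unary entry serves as a loop counter: each `true` moves one item aside, until the item
indexed by the entry is on top. -/
theorem runs_skipItems (U W : List (List Bool)) (r : List Bool) :
    RunsM (.whileTrue .tab (.seq (.push .tab' true) moveItem))
      ⟨unary U.length ++ r, tab', encVec (U ++ W), vec', acc, tmp, car, new, cnt, cnt', st, st', out⟩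
      ⟨r, List.replicate U.length true ++ tab', encVec W, (encVec U).reverse ++ vec', acc, tmp, car,
        new, cnt, cnt', st, st', out⟩
      (4 * (encVec U).length + 1) := by
  induction U generalizing tab' vec' with
  | nil => exact RunsM.whileTrue_false (k := .tab) rfl
  | cons x U ih =>
    have h1 := RunsM.seq (RunsM.push (m := ⟨unary U.length ++ r, tab', encVec (x :: U ++ W), vec',
      acc, tmp, car, new, cnt, cnt', st, st', out⟩) .tab' true)
      (runs_moveItem x (v := encVec (U ++ W)) (by
        simp [Mem.set]))
    have h2 := RunsM.whileTrue_true (k := .tab) (l := unary U.length ++ r)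
      (m := ⟨unary (x :: U).length ++ r, tab', encVec (x :: U ++ W), vec',
        acc, tmp, car, new, cnt, cnt', st, st', out⟩) rfl h1 (ih _ _)
    refine h2.of_eq ?_ ?_
    · simp [Mem.get, Mem.set, List.replicate_succ']
    · simp
      omega

theorem unary_reverse (e : ℕ) : (unary e).reverse = false :: List.replicate e true := by
  simp [unary]

/-- The items passed over and the item added lie reversed on `vec'`; pouring them back restores the
vector for the next entry. -/
theorem runs_readEntry {V : List (List Bool)} {e : ℕ} (he : e < V.length) (r : List Bool) :
    RunsM readEntry
      ⟨unary e ++ r, tab', encVec V, [], acc, [], [], new, cnt, cnt', st, st', out⟩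
      ⟨r, (unary e).reverse ++ tab', encVec V, [], addBits (V.getD e []) acc false, [], [], new,
        cnt, cnt', st, st', out⟩
      (20 * ((encVec V).length + acc.length + 1)) := by
  obtain ⟨U, x, W, rfl, rfl⟩ : ∃ U x W, V = U ++ x :: W ∧ e = U.length := by
    refine ⟨V.take e, V[e], V.drop (e + 1), ?_, ?_⟩
    · simp
    · simp; omega
  have h1 := runs_skipItems tab' [] acc [] [] new cnt cnt' st st' out U (x :: W) r
  have h2 := RunsM.seq h1 (RunsM.seq (RunsM.push .tab' false)
    (RunsM.seq (runs_addItem x (v := encVec W) rfl rfl rfl)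
      (runs_move (a := .vec') (b := .vec) (by decide) _)))
  refine h2.of_eq ?_ ?_
  · simp [Mem.get, Mem.set, unary_reverse]
  · simp [Mem.get, Mem.set]
    omega

/-- Read `k` entries of the table. -/
def readEntries : ℕ → Prog Stk
  | 0 => .skip
  | k + 1 => .seq readEntry (readEntries k)

/-- The sum of the items of `V` with the given indices, and `y`. -/
def sumEntries (V : List (List Bool)) (es : List ℕ) (y : List Bool) : List Bool :=
  es.foldl (fun y e => addBits (V.getD e []) y false) y

theorem length_sumEntries {V : List (List Bool)} {D : ℕ} (hV : ∀ x ∈ V, x.length ≤ D)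
    (es : List ℕ) (y : List Bool) :
    (sumEntries V es y).length ≤ max D y.length + es.length := by
  induction es generalizing y with
  | nil => simp [sumEntries]
  | cons e es ih =>
    have h1 := ih (addBits (V.getD e []) y false)
    have h2 := length_addBits (V.getD e []) y false
    have h3 : (V.getD e []).length ≤ D := by
      by_cases he : e < V.length
      · rw [List.getD_eq_getElem _ _ he]
        exact hV _ (List.getElem_mem he)
      · rw [List.getD_eq_default _ _ (by omega)]
        simp
    simp only [sumEntries, List.foldl_cons, List.length_cons] at h1 ⊢
    omega

/-- `A` bounds the vector and the accumulator throughout: an addition lengthens the accumulator by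
at most one bit, while the list of remaining entries gets shorter by one. -/
theorem runs_readEntries {V : List (List Bool)} {es : List ℕ} (he : ∀ e ∈ es, e < V.length)
    (r : List Bool) {A : ℕ} (hA : max (encVec V).length acc.length + es.length ≤ A) :
    RunsM (readEntries es.length)
      ⟨es.flatMap unary ++ r, tab', encVec V, [], acc, [], [], new, cnt, cnt', st, st', out⟩
      ⟨r, (es.flatMap unary).reverse ++ tab', encVec V, [], sumEntries V es acc, [], [], new,
        cnt, cnt', st, st', out⟩
      (es.length * (20 * (2 * A + 1)) + 1) := by
  induction es generalizing acc tab' with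
  | nil => exact RunsM.skip.mono (by simp)
  | cons e es ih =>
    have hlen := length_addBits (V.getD e []) acc false
    have hx : (V.getD e []).length ≤ (encVec V).length := by
      rw [List.getD_eq_getElem _ _ (he e (by simp))]
      have := length_le_encVec (List.getElem_mem (he e (by simp)))
      omega
    simp only [List.length_cons] at hA
    have h1 := RunsM.seq (runs_readEntry tab' acc new cnt cnt' st st' out (he e (by simp))
      (es.flatMap unary ++ r)) (ih ((unary e).reverse ++ tab') (addBits (V.getD e []) acc false)
        (fun e' h' => he e' (by simp [h'])) (by omega))
    rw [← List.append_assoc] at h1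
    refine h1.of_eq ?_ ?_
    · simp [sumEntries]
    · simp only [List.length_cons]
      have : 20 * ((encVec V).length + acc.length + 1) ≤ 20 * (2 * A + 1) := by omega
      linarith [add_mul es.length 1 (20 * (2 * A + 1))]

/-- Move the accumulator to the new vector. -/
def flush : Prog Stk :=
  .seq (.drain .acc (.seq (.push .new true) (.push .new false))
    (.seq (.push .new true) (.push .new true))) (.push .new false)

theorem runs_flush : RunsM flush
    ⟨tab, tab', vec, vec', acc, tmp, car, new, cnt, cnt', st, st', out⟩
    ⟨tab, tab', vec, vec', [], tmp, car, (item acc).reverse ++ new, cnt, cnt', st, st', out⟩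
    (3 * acc.length + 2) := by
  have key : RunsM (.drain .acc (.seq (.push .new true) (.push .new false))
      (.seq (.push .new true) (.push .new true)))
      ⟨tab, tab', vec, vec', acc, tmp, car, new, cnt, cnt', st, st', out⟩
      ⟨tab, tab', vec, vec', [], tmp, car, (acc.flatMap (fun b => [true, b])).reverse ++ new,
        cnt, cnt', st, st', out⟩
      (3 * acc.length + 1) := by
    induction acc generalizing new with
    | nil => exact RunsM.drain_nil (k := .acc) rfl
    | cons b acc ih =>
      have h1 : RunsM (bif b then (.seq (.push .new true) (.push .new true)) else
          (.seq (.push .new true) (.push .new false)))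
          ⟨tab, tab', vec, vec', acc, tmp, car, new, cnt, cnt', st, st', out⟩
          ⟨tab, tab', vec, vec', acc, tmp, car, b :: true :: new, cnt, cnt', st, st', out⟩ 2 := by
        cases b
        · exact RunsM.seq (RunsM.push .new true) (RunsM.push .new false)
        · exact RunsM.seq (RunsM.push .new true) (RunsM.push .new true)
      exact (RunsM.drain_cons (k := .acc) rfl h1 (ih _)).of_eq (by simp)
        (by simp only [List.length_cons]; omega)
  exact (RunsM.seq key (RunsM.push .new false)).of_eq (by simp [item, Mem.set, Mem.get])
    (by omega)

/-- Read the `k` successors of a row, and put their sum on the new vector. -/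
def rowRest (k : ℕ) : Prog Stk := .seq (readEntries k) flush

/-- Read the whole table, putting the result for each row on the new vector. If `flag`, the
final states count. -/
def readTable (flag : Bool) (k : ℕ) : Prog Stk :=
  .drain .tab (.seq (.push .tab' false) (rowRest k))
    (.seq (.push .tab' true) (.seq (if flag then .push .acc true else .skip)
      (.seq (.popCase .tab .skip (.push .tab' false) .skip) (rowRest k))))

/-- The result for a row. -/
def rowVal (flag : Bool) (V : List (List Bool)) (r : Bool × List ℕ) : List Bool :=
  sumEntries V r.2 (if flag && r.1 then [true] else [])

/-- A bound for the time needed by a row. -/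
def rowTime (k L : ℕ) : ℕ := (k + 1) * (80 * (L + k + 2))

/-- The 10 steps subtracted from the generous bound `rowTime` pay for reading the finality mark in
`runs_readTable`. -/
theorem runs_rowRest {V : List (List Bool)} {es : List ℕ} (he : ∀ e ∈ es, e < V.length)
    (r : List Bool) (hacc : acc.length ≤ 1) :
    RunsM (rowRest es.length)
      ⟨es.flatMap unary ++ r, tab', encVec V, [], acc, [], [], new, cnt, cnt', st, st', out⟩
      ⟨r, (es.flatMap unary).reverse ++ tab', encVec V, [], [], [], [],
        (item (sumEntries V es acc)).reverse ++ new, cnt, cnt', st, st', out⟩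
      (rowTime es.length (encVec V).length - 10) := by
  have h1 := RunsM.seq (runs_readEntries tab' acc new cnt cnt' st st' out he r
    (A := (encVec V).length + 1 + es.length) (by omega))
    (runs_flush _ _ _ _ _ _ _ _ _ _ _ _ _)
  refine h1.mono ?_
  have h2 := length_sumEntries (V := V) (D := (encVec V).length)
    (fun x hx => by have := length_le_encVec hx; omega) es acc
  have h3 : rowTime es.length (encVec V).length =
    es.length * (80 * ((encVec V).length + es.length + 2)) +
      80 * ((encVec V).length + es.length + 2) := by rw [rowTime]; ring
  have h4 : es.length * (20 * (2 * ((encVec V).length + 1 + es.length) + 1)) ≤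
    es.length * (80 * ((encVec V).length + es.length + 2)) := Nat.mul_le_mul_left _ (by omega)
  omega

/-- The loop itself pops the first bit of the finality mark: `false` is the complete mark 0, while
`true` is followed by a `false` still to be popped. All bits are recorded on `tab'`, so that the
table can be read again. -/
theorem runs_readTable (flag : Bool) {k : ℕ} {V : List (List Bool)} {rows : List (Bool × List ℕ)}
    (hk : ∀ r ∈ rows, r.2.length = k) (he : ∀ r ∈ rows, ∀ e ∈ r.2, e < V.length) :
    RunsM (readTable flag k)
      ⟨rows.flatMap encRow, tab', encVec V, [], [], [], [], new, cnt, cnt', st, st', out⟩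
      ⟨[], (rows.flatMap encRow).reverse ++ tab', encVec V, [], [], [], [],
        (encVec (rows.map (rowVal flag V))).reverse ++ new, cnt, cnt', st, st', out⟩
      (rows.length * rowTime k (encVec V).length + 1) := by
  induction rows generalizing tab' new with
  | nil => exact RunsM.mono (t := 1) (RunsM.drain_nil (k := .tab) rfl) (by simp)
  | cons r rows ih =>
    obtain ⟨b, es⟩ := r
    obtain rfl : es.length = k := hk (b, es) (by simp)
    have ih' := ih ((encRow (b, es)).reverse ++ tab')
      ((item (rowVal flag V (b, es))).reverse ++ new) (fun r hr => hk r (by simp [hr]))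
      (fun r hr => he r (by simp [hr]))
    have hes := he (b, es) (by simp)
    have hT : 10 ≤ rowTime es.length (encVec V).length := by
      rw [rowTime]; nlinarith
    cases b
    · have h1 := RunsM.seq (RunsM.push (m := ⟨es.flatMap unary ++ rows.flatMap encRow, tab',
        encVec V, [], [], [], [], new, cnt, cnt', st, st', out⟩) .tab' false)
        (runs_rowRest (false :: tab') [] new cnt cnt' st st' out hes (rows.flatMap encRow)
          (by simp))
      have h2 := RunsM.drain_cons (k := .tab) (b := false) (m := ⟨false :: (es.flatMap unary ++
        rows.flatMap encRow), tab', encVec V, [], [], [], [], new, cnt, cnt', st, st', out⟩)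
        (pf := .seq (.push .tab' false) (rowRest es.length))
        (pt := .seq (.push .tab' true) (.seq (if flag then .push .acc true else .skip)
          (.seq (.popCase .tab .skip (.push .tab' false) .skip) (rowRest es.length)))) rfl h1
        (ih'.of_eq_left (by simp [encRow, unary_zero, rowVal]))
      refine (h2.of_eq_left ?_).of_eq ?_ ?_
      · simp [encRow, unary_zero]
      · simp
      · simp only [List.length_cons, add_mul, one_mul]
        omega
    · have h0 : RunsM (if flag then Prog.push .acc true else .skip)
          ⟨false :: (es.flatMap unary ++ rows.flatMap encRow), true :: tab', encVec V, [], [], [],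
            [], new, cnt, cnt', st, st', out⟩
          ⟨false :: (es.flatMap unary ++ rows.flatMap encRow), true :: tab', encVec V, [],
            if flag then [true] else [], [], [], new, cnt, cnt', st, st', out⟩ 1 := by
        cases flag
        · exact RunsM.skip
        · exact RunsM.push .acc true
      have h1 := RunsM.seq (RunsM.push (m := ⟨false :: (es.flatMap unary ++ rows.flatMap encRow),
        tab', encVec V, [], [], [], [], new, cnt, cnt', st, st', out⟩) .tab' true)
        (RunsM.seq h0 (RunsM.seq (RunsM.popCase_cons (k := .tab) (pe := .skip)
            (pf := .push .tab' false) (pt := .skip) (b := false) rfl (RunsM.push .tab' false))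
          (runs_rowRest (false :: true :: tab') (if flag then [true] else []) new cnt cnt' st st'
            out hes (rows.flatMap encRow) (by cases flag <;> simp))))
      have h2 := RunsM.drain_cons (k := .tab) (b := true) (m := ⟨true :: false :: (es.flatMap unary
        ++ rows.flatMap encRow), tab', encVec V, [], [], [], [], new, cnt, cnt', st, st', out⟩)
        (pf := .seq (.push .tab' false) (rowRest es.length))
        (pt := .seq (.push .tab' true) (.seq (if flag then .push .acc true else .skip)
          (.seq (.popCase .tab .skip (.push .tab' false) .skip) (rowRest es.length)))) rfl h1
        (ih'.of_eq_left (by simp [encRow, unary_succ, unary_zero, rowVal]))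
      refine (h2.of_eq_left ?_).of_eq ?_ ?_
      · simp [encRow, unary_succ, unary_zero]
      · simp
      · simp only [List.length_cons, add_mul, one_mul]
        omega

/-- The vector computed from `V` by one reading of the table. -/
def stepVec (flag : Bool) (rows : List (Bool × List ℕ)) (V : List (List Bool)) :
    List (List Bool) := [] :: rows.map (rowVal flag V)

/-- Replace the vector by the one computed by reading the table. -/
def pass (flag : Bool) (k : ℕ) : Prog Stk :=
  .seq (readTable flag k) (.seq (clear .vec) (.seq (move .new .vec)
    (.seq (.push .vec false) (move .tab' .tab))))

/-- The table of transitions `rows` is well formed. -/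
def WellFormed (k : ℕ) (rows : List (Bool × List ℕ)) : Prop :=
  ∀ r ∈ rows, r.2.length = k ∧ ∀ e ∈ r.2, e ≤ rows.length

theorem length_rowVal (flag : Bool) {V : List (List Bool)} {D : ℕ} (hV : ∀ x ∈ V, x.length ≤ D)
    (hD : 1 ≤ D) (r : Bool × List ℕ) : (rowVal flag V r).length ≤ D + r.2.length := by
  have h1 := length_sumEntries hV r.2 (if flag && r.1 then [true] else [])
  have h2 : (if flag && r.1 then [true] else []).length ≤ 1 := by split_ifs <;> simp
  rw [rowVal]
  omega

/-- A row needs `k` additions, each costing at most one bit. The lengths thus grow only linearly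
with the number of passes, even if the values grow exponentially. -/
theorem length_stepVec {k : ℕ} {rows : List (Bool × List ℕ)} (hr : WellFormed k rows)
    (flag : Bool) {V : List (List Bool)} {D : ℕ} (hV : ∀ x ∈ V, x.length ≤ D) (hD : 1 ≤ D) :
    ∀ x ∈ stepVec flag rows V, x.length ≤ D + k := by
  intro x hx
  simp only [stepVec, List.mem_cons, List.mem_map] at hx
  rcases hx with rfl | ⟨r, hr', rfl⟩
  · simp
  · have := length_rowVal flag hV hD r
    rwa [(hr r hr').1] at this

/-- A bound for the time needed by a pass. -/
def passTime (k n D t : ℕ) : ℕ :=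
  n * rowTime k ((n + 1) * (2 * D + 1)) + 2 * ((n + 1) * (2 * D + 1)) +
    2 * ((n + 1) * (2 * (D + k) + 1)) + 2 * t + 5

theorem rowTime_mono {k L L' : ℕ} (h : L ≤ L') : rowTime k L ≤ rowTime k L' := by
  unfold rowTime
  gcongr

/-- The results lie in reverse order on `new`, and pouring them onto the emptied `vec` corrects the
order. The `false` pushed on top is the number 0 at index 0, the value read for an undefined
transition. -/
theorem runs_pass {k : ℕ} {rows : List (Bool × List ℕ)} (hr : WellFormed k rows)
    (flag : Bool) {V : List (List Bool)} {D : ℕ} (hV : ∀ x ∈ V, x.length ≤ D) (hD : 1 ≤ D)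
    (hlen : V.length = rows.length + 1) :
    RunsM (pass flag k)
      ⟨rows.flatMap encRow, [], encVec V, [], [], [], [], [], cnt, cnt', st, st', out⟩
      ⟨rows.flatMap encRow, [], encVec (stepVec flag rows V), [], [], [], [], [], cnt, cnt', st,
        st', out⟩
      (passTime k rows.length D (rows.flatMap encRow).length) := by
  have h1 := RunsM.seq (runs_readTable [] [] cnt cnt' st st' out flag (fun r h => (hr r h).1)
    (V := V) fun r h e h' => by have := (hr r h).2 e h'; omega)
    (RunsM.seq (runs_clear .vec _) (RunsM.seq (runs_move (a := .new) (b := .vec) (by decide) _)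
      (RunsM.seq (RunsM.push .vec false) (runs_move (a := .tab') (b := .tab) (by decide) _))))
  refine h1.of_eq ?_ ?_
  · simp [Mem.get, Mem.set, stepVec]
  · have h2 := length_encVec_le hV
    rw [hlen] at h2
    have h3 : (encVec (rows.map (rowVal flag V))).length ≤
        (rows.length + 1) * (2 * (D + k) + 1) := by
      have := length_encVec_le (length_stepVec hr flag hV hD)
      simp only [stepVec, encVec_cons, List.length_append, List.length_cons, List.length_map]
        at this
      omega
    have h4 := Nat.mul_le_mul_left rows.length (rowTime_mono (k := k) h2)
    simp [Mem.get, Mem.set, passTime]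
    omega

end StackProgram

namespace StackProgram

/-! ### The counting program -/

variable (tab tab' vec vec' acc tmp car new cnt cnt' st st' out : List Bool)

theorem passTime_mono {k n D D' t : ℕ} (h : D ≤ D') : passTime k n D t ≤ passTime k n D' t := by
  unfold passTime
  have : (n + 1) * (2 * D + 1) ≤ (n + 1) * (2 * D' + 1) := by gcongr
  have := rowTime_mono (k := k) this
  gcongr

/-- Replace the vector as often as the counter says. -/
def passes (flag : Bool) (k : ℕ) : Prog Stk :=
  .seq (.drain .cnt .skip (.seq (.push .cnt' true) (pass flag k))) (move .cnt' .cnt)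

@[simp] theorem length_stepVec_eq (flag : Bool) (rows : List (Bool × List ℕ))
    (V : List (List Bool)) : (stepVec flag rows V).length = rows.length + 1 := by
  simp [stepVec]

theorem length_iterate_stepVec {k : ℕ} {rows : List (Bool × List ℕ)} (hr : WellFormed k rows)
    (flag : Bool) {V : List (List Bool)} {D : ℕ} (hV : ∀ x ∈ V, x.length ≤ D) (hD : 1 ≤ D)
    (hlen : V.length = rows.length + 1) (j : ℕ) :
    ((stepVec flag rows)^[j] V).length = rows.length + 1 ∧
      ∀ x ∈ (stepVec flag rows)^[j] V, x.length ≤ D + j * k := by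
  induction j with
  | zero => simpa using ⟨hlen, hV⟩
  | succ j ih =>
    rw [Function.iterate_succ_apply']
    refine ⟨length_stepVec_eq .., fun x hx => ?_⟩
    have := length_stepVec hr flag ih.2 (by omega) x hx
    linarith [add_mul j 1 k]

/-- `E` bounds the bit lengths during all `j` passes, so a single value of `passTime` majorizes each
of them. -/
theorem runs_passes_aux {k : ℕ} {rows : List (Bool × List ℕ)} (hr : WellFormed k rows)
    (flag : Bool) {V : List (List Bool)} {D E j : ℕ} (hV : ∀ x ∈ V, x.length ≤ D) (hD : 1 ≤ D)
    (hlen : V.length = rows.length + 1) (hE : D + j * k ≤ E) :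
    RunsM (.drain .cnt .skip (.seq (.push .cnt' true) (pass flag k)))
      ⟨rows.flatMap encRow, [], encVec V, [], [], [], [], [], List.replicate j true, cnt', st, st',
        out⟩
      ⟨rows.flatMap encRow, [], encVec ((stepVec flag rows)^[j] V), [], [], [], [], [], [],
        List.replicate j true ++ cnt', st, st', out⟩
      (j * (passTime k rows.length E (rows.flatMap encRow).length + 2) + 1) := by
  induction j generalizing V D cnt' with
  | zero => exact RunsM.mono (t := 1) (RunsM.drain_nil (k := .cnt) rfl) (by simp)
  | succ j ih =>
    have hE' : D + k + j * k ≤ E := by linarith [add_mul j 1 k]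
    have h1 := runs_pass (List.replicate j true) (true :: cnt') st st' out hr flag hV hD hlen
    have h2 := ih (true :: cnt') (length_stepVec hr flag hV hD) (by omega)
      (length_stepVec_eq ..) hE'
    have h3 := RunsM.drain_cons (k := .cnt) (b := true) (pf := .skip)
      (pt := .seq (.push .cnt' true) (pass flag k))
      (m := ⟨rows.flatMap encRow, [], encVec V, [], [], [], [], [],
        true :: List.replicate j true, cnt', st, st', out⟩) rfl
      (RunsM.seq (RunsM.push .cnt' true) h1) h2
    refine (h3.of_eq_left ?_).of_eq ?_ ?_
    · simp [List.replicate_succ]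
    · simp [List.replicate_succ']
    · have := passTime_mono (k := k) (n := rows.length) (t := (rows.flatMap encRow).length)
        (show D ≤ E by nlinarith)
      rw [add_mul, one_mul]
      omega

/-- A bound for the time needed by `n` passes, if the table has length `t`. -/
def passesTime (k n t : ℕ) : ℕ := n * (passTime k n (1 + n * k) t + 2) + 2 * n + 2

theorem runs_passes {k : ℕ} {rows : List (Bool × List ℕ)} (hr : WellFormed k rows)
    (flag : Bool) {V : List (List Bool)} (hV : ∀ x ∈ V, x.length ≤ 1)
    (hlen : V.length = rows.length + 1) :
    RunsM (passes flag k)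
      ⟨rows.flatMap encRow, [], encVec V, [], [], [], [], [], List.replicate rows.length true, [],
        st, st', out⟩
      ⟨rows.flatMap encRow, [], encVec ((stepVec flag rows)^[rows.length] V), [], [], [], [], [],
        List.replicate rows.length true, [], st, st', out⟩
      (passesTime k rows.length (rows.flatMap encRow).length) := by
  have h1 := RunsM.seq (runs_passes_aux [] st st' out (j := rows.length) hr flag hV le_rfl hlen le_rfl)
    (runs_move (a := .cnt') (b := .cnt) (by decide) _)
  refine h1.of_eq ?_ ?_
  · simp [Mem.get, Mem.set]
  · simp [Mem.get, passesTime]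
    omega

/-- `0` if the number is `0`, and `1` otherwise. -/
def sign (x : List Bool) : List Bool := if x = [] then [] else [true]

/-- Replace the numbers of the vector by their signs. -/
def signs : Prog Stk :=
  .seq (.drain .vec (.push .new false) (.seq (.popCase .vec .skip .skip .skip)
    (.seq dropItem (.seq (.push .new true) (.seq (.push .new true) (.push .new false))))))
    (move .new .vec)

/-- Zero is the empty item, so the first bit of an item decides its sign and the rest can be
discarded. -/
theorem runs_signs (V : List (List Bool)) : RunsM signs
    ⟨tab, tab', encVec V, vec', acc, tmp, car, [], cnt, cnt', st, st', out⟩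
    ⟨tab, tab', encVec (V.map sign), vec', acc, tmp, car, [], cnt, cnt', st, st', out⟩
    (8 * (encVec V).length + 2) := by
  have key : ∀ new, RunsM (.drain .vec (.push .new false) (.seq (.popCase .vec .skip .skip .skip)
      (.seq dropItem (.seq (.push .new true) (.seq (.push .new true) (.push .new false))))))
      ⟨tab, tab', encVec V, vec', acc, tmp, car, new, cnt, cnt', st, st', out⟩
      ⟨tab, tab', [], vec', acc, tmp, car, (encVec (V.map sign)).reverse ++ new, cnt, cnt', st, st',
        out⟩ (4 * (encVec V).length + 1) := by
    induction V with
    | nil => exact fun new => RunsM.mono (t := 1) (RunsM.drain_nil (k := .vec) rfl) (by simp)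
    | cons x V ih =>
      intro new
      rcases x with _ | ⟨b, x⟩
      · exact (RunsM.drain_cons (k := .vec) (b := false)
          (m := ⟨tab, tab', false :: encVec V, vec', acc, tmp, car, new, cnt, cnt', st, st', out⟩)
          rfl (RunsM.push .new false) (ih _)).of_eq (by simp [sign, Mem.get, Mem.set]) (by simp; omega)
      · have h1 : RunsM (.popCase .vec .skip .skip .skip)
            ⟨tab, tab', b :: (item x ++ encVec V), vec', acc, tmp, car, new, cnt, cnt', st, st', out⟩
            ⟨tab, tab', item x ++ encVec V, vec', acc, tmp, car, new, cnt, cnt', st, st', out⟩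
            2 := by
          refine RunsM.popCase_cons (k := .vec) (b := b) (l := item x ++ encVec V) rfl ?_
          cases b <;> exact RunsM.skip
        have h2 := RunsM.drain_cons (k := .vec) (b := true) (pf := .push .new false)
          (m := ⟨tab, tab', true :: b :: (item x ++ encVec V), vec', acc, tmp, car, new, cnt, cnt',
            st, st', out⟩) rfl
          (RunsM.seq h1 (RunsM.seq (runs_dropItem x rfl) (RunsM.seq (RunsM.push .new true)
            (RunsM.seq (RunsM.push .new true) (RunsM.push .new false))))) (ih _)
        refine (h2.of_eq_left ?_).of_eq ?_ ?_
        · simp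
        · simp [sign, Mem.get, Mem.set]
        · simp
          omega
  have hlen : (encVec (V.map sign)).length ≤ 2 * (encVec V).length := by
    clear key
    induction V with
    | nil => simp
    | cons x V ih =>
      have : (sign x).length ≤ x.length := by rcases x with _ | ⟨b, x⟩ <;> simp [sign]
      simp
      omega
  refine (RunsM.seq (key []) (runs_move (a := .new) (b := .vec) (by decide) _)).of_eq ?_ ?_
  · simp [Mem.get, Mem.set]
  · simp [Mem.get]
    omega

/-- Initialize the vector with zeros. -/
def zeros : Prog Stk :=
  .seq (.push .vec false) (.seq (.drain .cnt .skip (.seq (.push .cnt' true) (.push .vec false)))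
    (move .cnt' .cnt))

theorem runs_zeros (n : ℕ) : RunsM zeros
    ⟨tab, tab', [], vec', acc, tmp, car, new, List.replicate n true, [], st, st', out⟩
    ⟨tab, tab', encVec (List.replicate (n + 1) []), vec', acc, tmp, car, new,
      List.replicate n true, [], st, st', out⟩ (5 * n + 3) := by
  have key : ∀ vec cnt', RunsM (.drain .cnt .skip (.seq (.push .cnt' true) (.push .vec false)))
    ⟨tab, tab', vec, vec', acc, tmp, car, new, List.replicate n true, cnt', st, st', out⟩
    ⟨tab, tab', List.replicate n false ++ vec, vec', acc, tmp, car, new, [],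
      List.replicate n true ++ cnt', st, st', out⟩ (3 * n + 1) := by
    induction n with
    | zero => exact fun _ _ => RunsM.mono (t := 1) (RunsM.drain_nil (k := .cnt) rfl) (by simp)
    | succ n ih =>
      intro vec cnt'
      have h1 := RunsM.drain_cons (k := .cnt) (b := true) (pf := .skip)
        (m := ⟨tab, tab', vec, vec', acc, tmp, car, new, true :: List.replicate n true, cnt', st, st',
          out⟩) rfl (RunsM.seq (RunsM.push .cnt' true) (RunsM.push .vec false))
        (ih (false :: vec) (true :: cnt'))
      refine (h1.of_eq_left ?_).of_eq ?_ ?_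
      · simp [List.replicate_succ]
      · simp [List.replicate_succ']
      · omega
  have h0 : encVec (List.replicate (n + 1) []) = List.replicate n false ++ [false] := by
    rw [← List.replicate_succ']
    clear key
    induction n with
    | zero => rfl
    | succ n ih => rw [List.replicate_succ, encVec_cons, ih, List.replicate_succ (n := n + 1)]; rfl
  refine (RunsM.seq (RunsM.push .vec false) (RunsM.seq (key _ _)
    (runs_move (a := .cnt') (b := .cnt) (by decide) _))).of_eq ?_ ?_
  · simp [Mem.get, Mem.set, h0]
  · simp [Mem.get]
    omega

/-- The vector telling from which states a final state can be reached. -/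
def reachVec (rows : List (Bool × List ℕ)) : List (List Bool) :=
  ((stepVec true rows)^[rows.length] (List.replicate (rows.length + 1) [])).map sign

/-- Compute `reachVec`. -/
def reach (k : ℕ) : Prog Stk := .seq zeros (.seq (passes true k) signs)

/-- A bound for the time needed by `reach`. -/
def reachTime (k n t : ℕ) : ℕ :=
  5 * n + 5 + passesTime k n t + 8 * ((n + 1) * (2 * (1 + n * k) + 1))

theorem runs_reach {k : ℕ} {rows : List (Bool × List ℕ)} (hr : WellFormed k rows) :
    RunsM (reach k)
      ⟨rows.flatMap encRow, [], [], [], [], [], [], [], List.replicate rows.length true, [], st, st',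
        out⟩
      ⟨rows.flatMap encRow, [], encVec (reachVec rows), [], [], [], [], [],
        List.replicate rows.length true, [], st, st', out⟩
      (reachTime k rows.length (rows.flatMap encRow).length) := by
  have hV : ∀ x ∈ (List.replicate (rows.length + 1) [] : List (List Bool)), x.length ≤ 1 := by
    intro x hx
    simp [List.eq_of_mem_replicate hx]
  have hl := length_iterate_stepVec hr true hV le_rfl (by simp) rows.length
  have h2 := length_encVec_le hl.2
  rw [hl.1] at h2
  refine (RunsM.seq (runs_zeros _ _ _ _ _ _ _ _ _ _ _) (RunsM.seq (runs_passes st st' out hr true hV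
    (by simp)) (runs_signs _ _ _ _ _ _ _ _ _ _ _ _))).mono ?_
  rw [reachTime]
  omega

/-- Put the item of the vector whose number is given by the initial state on a stack, reversed,
and clear the vector. -/
def select : Prog Stk :=
  .seq dropItem (.seq (.drain .st .skip (.seq (.push .st' true) dropItem))
    (.seq (move .st' .st) (.seq itemBits (clear .vec))))

/-- Index 0 is reserved for undefined transitions, so the item of the state `s` is preceded by `s +
1` others. -/
theorem runs_select {V : List (List Bool)} {s : ℕ} (hs : s + 1 < V.length) : RunsM select
    ⟨tab, tab', encVec V, vec', acc, [], car, new, cnt, cnt', List.replicate s true, [], out⟩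
    ⟨tab, tab', [], vec', acc, (V.getD (s + 1) []).reverse, car, new, cnt, cnt',
      List.replicate s true, [], out⟩ (8 * (encVec V).length + 2 * s + 5) := by
  obtain ⟨x₀, U, x, W, rfl, rfl⟩ : ∃ x₀ U x W, V = x₀ :: (U ++ x :: W) ∧ s = U.length := by
    rcases V with _ | ⟨x₀, V⟩
    · simp at hs
    · simp only [List.length_cons] at hs
      refine ⟨x₀, V.take s, V[s], V.drop (s + 1), ?_, ?_⟩
      · simp
      · simp; omega
  have key : ∀ st', RunsM (.drain .st .skip (.seq (.push .st' true) dropItem))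
      ⟨tab, tab', encVec (U ++ x :: W), vec', acc, [], car, new, cnt, cnt',
        List.replicate U.length true, st', out⟩
      ⟨tab, tab', encVec (x :: W), vec', acc, [], car, new, cnt, cnt', [],
        List.replicate U.length true ++ st', out⟩ (3 * (encVec U).length + 1) := by
    clear hs
    induction U with
    | nil => exact fun _ => RunsM.mono (t := 1) (RunsM.drain_nil (k := .st) rfl) (by simp)
    | cons y U ih =>
      intro st'
      have h1 := RunsM.drain_cons (k := .st) (b := true) (pf := .skip)
        (m := ⟨tab, tab', item y ++ encVec (U ++ x :: W), vec', acc, [], car, new, cnt, cnt',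
          true :: List.replicate U.length true, st', out⟩) rfl
        (RunsM.seq (RunsM.push .st' true) (runs_dropItem y rfl)) (ih (true :: st'))
      refine (h1.of_eq_left ?_).of_eq ?_ ?_
      · simp [List.replicate_succ]
      · simp [List.replicate_succ']
      · simp
        omega
  have h1 := RunsM.seq (runs_dropItem x₀ (m := ⟨tab, tab', encVec (x₀ :: (U ++ x :: W)), vec', acc,
    [], car, new, cnt, cnt', List.replicate U.length true, [], out⟩) rfl) (RunsM.seq (key [])
    (RunsM.seq (runs_move (a := .st') (b := .st) (by decide) _)
      (RunsM.seq (runs_itemBits x (v := encVec W) rfl) (runs_clear .vec _))))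
  refine h1.of_eq ?_ ?_
  · simp [Mem.get, Mem.set]
  · simp [Mem.get]
    omega

/-- The vector of the numbers of words of length `n` leading to live states. -/
def countVec (rows : List (Bool × List ℕ)) : List (List Bool) :=
  (stepVec false rows)^[rows.length]
    (((stepVec false rows)^[rows.length] (reachVec rows)).map sign)

/-- The number computed by the counting program. -/
def countResult (s : ℕ) (rows : List (Bool × List ℕ)) : List Bool :=
  if (countVec rows).getD (s + 1) [] = [] then (reachVec rows).getD (s + 1) []
  else (countVec rows).getD (s + 1) []

/-- Replace the output by the accumulator, unless it is empty. -/
def override : Prog Stk :=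
  .popCase .acc .skip
    (.seq (.push .acc false) (.seq (clear .out) (.seq (move .acc .tmp) (move .tmp .out))))
    (.seq (.push .acc true) (.seq (clear .out) (.seq (move .acc .tmp) (move .tmp .out))))

theorem runs_override : RunsM override
    ⟨tab, tab', vec, vec', acc, [], car, new, cnt, cnt', st, st', out⟩
    ⟨tab, tab', vec, vec', [], [], car, new, cnt, cnt', st, st', if acc = [] then out else acc⟩
    (4 * acc.length + 2 * out.length + 5) := by
  rcases acc with _ | ⟨b, acc⟩
  · exact (RunsM.popCase_nil (k := .acc) rfl RunsM.skip).mono (by simp)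
  · have h1 : ∀ b, RunsM
        (.seq (.push .acc b) (.seq (clear .out) (.seq (move .acc .tmp) (move .tmp .out))))
        ⟨tab, tab', vec, vec', acc, [], car, new, cnt, cnt', st, st', out⟩
        ⟨tab, tab', vec, vec', [], [], car, new, cnt, cnt', st, st', b :: acc⟩
        (4 * (b :: acc).length + 2 * out.length + 4) := by
      intro b
      refine (RunsM.seq (RunsM.push .acc b) (RunsM.seq (runs_clear .out _)
        (RunsM.seq (runs_move (a := .acc) (b := .tmp) (by decide) _)
          (runs_move (a := .tmp) (b := .out) (by decide) _)))).of_eq ?_ ?_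
      · simp [Mem.get, Mem.set]
      · simp [Mem.get, Mem.set]
        omega
    refine (RunsM.popCase_cons (k := .acc) (b := b) (l := acc) rfl
      (t := 4 * (b :: acc).length + 2 * out.length + 4) ?_)
    cases b
    · exact (h1 false).of_eq (by simp) le_rfl
    · exact (h1 true).of_eq (by simp) le_rfl

/-- Move a number in unary to another stack. -/
def readUnary (k : Stk) : Prog Stk := .whileTrue .tab (.push k true)

theorem runs_readUnary_cnt (n : ℕ) : RunsM (readUnary .cnt)
    ⟨unary n ++ tab, tab', vec, vec', acc, tmp, car, new, cnt, cnt', st, st', out⟩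
    ⟨tab, tab', vec, vec', acc, tmp, car, new, List.replicate n true ++ cnt, cnt', st, st', out⟩
    (2 * n + 1) := by
  induction n generalizing cnt with
  | zero => exact RunsM.whileTrue_false (k := .tab) rfl
  | succ n ih =>
    refine (RunsM.whileTrue_true (k := .tab) (l := unary n ++ tab)
      (m := ⟨true :: (unary n ++ tab), tab', vec, vec', acc, tmp, car, new, cnt, cnt', st, st', out⟩)
      rfl (RunsM.push .cnt true) (ih (true :: cnt))).of_eq ?_ (by omega)
    simp [List.replicate_succ']

theorem runs_readUnary_st (n : ℕ) : RunsM (readUnary .st)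
    ⟨unary n ++ tab, tab', vec, vec', acc, tmp, car, new, cnt, cnt', st, st', out⟩
    ⟨tab, tab', vec, vec', acc, tmp, car, new, cnt, cnt', List.replicate n true ++ st, st', out⟩
    (2 * n + 1) := by
  induction n generalizing st with
  | zero => exact RunsM.whileTrue_false (k := .tab) rfl
  | succ n ih =>
    refine (RunsM.whileTrue_true (k := .tab) (l := unary n ++ tab)
      (m := ⟨true :: (unary n ++ tab), tab', vec, vec', acc, tmp, car, new, cnt, cnt', st, st', out⟩)
      rfl (RunsM.push .st true) (ih (true :: st))).of_eq ?_ (by omega)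
    simp [List.replicate_succ']

/-- The counting program. -/
def countProg (k : ℕ) : Prog Stk :=
  .seq (readUnary .cnt) (.seq (readUnary .st) (.seq (reach k) (.seq select (.seq (move .tmp .out)
    (.seq (reach k) (.seq (passes false k) (.seq signs (.seq (passes false k) (.seq select
      (.seq (move .tmp .acc) (.seq override
        (.seq (clear .tab) (.seq (clear .cnt) (clear .st))))))))))))))

/-- A bound for the time needed by the counting program. -/
def countTime (k n t : ℕ) : ℕ :=
  2 * reachTime k n t + 2 * passesTime k n t + 40 * ((n + 1) * (2 * (1 + n * k) + 1)) +
    20 * n + 2 * t + 60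

theorem length_reachVec (rows : List (Bool × List ℕ)) :
    (reachVec rows).length = rows.length + 1 := by
  rw [reachVec, List.length_map]
  rcases h : rows.length with _ | n
  · simp
  · rw [Function.iterate_succ_apply', length_stepVec_eq, h]

theorem length_le_of_mem_map_sign {V : List (List Bool)} {x : List Bool} (hx : x ∈ V.map sign) :
    x.length ≤ 1 := by
  obtain ⟨y, -, rfl⟩ := List.mem_map.1 hx
  unfold sign
  split_ifs <;> simp

theorem runs_countProg {k s : ℕ} {rows : List (Bool × List ℕ)} (hr : WellFormed k rows)
    (hs : s < rows.length) :
    RunsM (countProg k)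
      ⟨unary rows.length ++ (unary s ++ rows.flatMap encRow), [], [], [], [], [], [], [], [], [], [],
        [], []⟩
      ⟨[], [], [], [], [], [], [], [], [], [], [], [], countResult s rows⟩
      (countTime k rows.length (rows.flatMap encRow).length) := by
  have hR := length_reachVec rows
  have hR1 : ∀ x ∈ reachVec rows, x.length ≤ 1 := fun x hx => length_le_of_mem_map_sign hx
  have hl1 := length_iterate_stepVec hr false hR1 le_rfl hR rows.length
  have hl2 := length_iterate_stepVec hr false
    (V := ((stepVec false rows)^[rows.length] (reachVec rows)).map sign)
    (fun x hx => length_le_of_mem_map_sign hx) le_rfl (by simpa using hl1.1) rows.length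
  have b0 := length_encVec_le hR1
  have b1 := length_encVec_le hl1.2
  have b2 := length_encVec_le hl2.2
  rw [hR] at b0
  rw [hl1.1] at b1
  rw [hl2.1] at b2
  have c0 : (rows.length + 1) * (2 * 1 + 1) ≤ (rows.length + 1) * (2 * (1 + rows.length * k) + 1) :=
    Nat.mul_le_mul_left _ (by omega)
  have mem : ∀ {V : List (List Bool)} {i : ℕ}, i < V.length →
      2 * (V.getD i []).length + 1 ≤ (encVec V).length := by
    intro V i hi
    rw [List.getD_eq_getElem _ _ hi]
    exact length_le_encVec (List.getElem_mem hi)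
  have m0 := mem (V := reachVec rows) (i := s + 1) (by omega)
  have m2 := mem (V := countVec rows) (i := s + 1) (by rw [countVec, hl2.1]; omega)
  have A1 := runs_readUnary_cnt (unary s ++ rows.flatMap encRow) [] [] [] [] [] [] [] [] [] [] [] []
    rows.length
  have A2 := runs_readUnary_st (rows.flatMap encRow) [] [] [] [] [] [] []
    (List.replicate rows.length true) [] [] [] [] s
  have A3 := runs_reach (List.replicate s true) [] [] hr
  have A4 := runs_select (rows.flatMap encRow) [] [] [] [] [] (List.replicate rows.length true) [] []
    (V := reachVec rows) (s := s) (by omega)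
  have A5 := runs_move (a := .tmp) (b := .out) (by decide) ⟨rows.flatMap encRow, [], [], [], [],
    ((reachVec rows).getD (s + 1) []).reverse, [], [], List.replicate rows.length true, [],
    List.replicate s true, [], []⟩
  -- `select` has cleared the vector, so the reachability vector is computed a second time.
  have A6 := runs_reach (List.replicate s true) [] ((reachVec rows).getD (s + 1) []) hr
  have A7 := runs_passes (List.replicate s true) [] ((reachVec rows).getD (s + 1) []) hr false hR1 hR
  have A8 := runs_signs (rows.flatMap encRow) [] [] [] [] [] (List.replicate rows.length true) []
    (List.replicate s true) [] ((reachVec rows).getD (s + 1) [])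
    ((stepVec false rows)^[rows.length] (reachVec rows))
  have A9 := runs_passes (List.replicate s true) [] ((reachVec rows).getD (s + 1) []) hr false
    (V := ((stepVec false rows)^[rows.length] (reachVec rows)).map sign)
    (fun x hx => length_le_of_mem_map_sign hx) (by simpa using hl1.1)
  have A10 := runs_select (rows.flatMap encRow) [] [] [] [] [] (List.replicate rows.length true) []
    ((reachVec rows).getD (s + 1) []) (V := countVec rows) (s := s)
    (by rw [countVec, hl2.1]; omega)
  have A11 := runs_move (a := .tmp) (b := .acc) (by decide) ⟨rows.flatMap encRow, [], [], [], [],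
    ((countVec rows).getD (s + 1) []).reverse, [], [], List.replicate rows.length true, [],
    List.replicate s true, [], (reachVec rows).getD (s + 1) []⟩
  have A12 := runs_override (rows.flatMap encRow) [] [] [] ((countVec rows).getD (s + 1) []) [] []
    (List.replicate rows.length true) [] (List.replicate s true) [] ((reachVec rows).getD (s + 1) [])
  have A13 := RunsM.seq (runs_clear .tab ⟨rows.flatMap encRow, [], [], [], [], [], [], [],
    List.replicate rows.length true, [], List.replicate s true, [], countResult s rows⟩)
    (RunsM.seq (runs_clear .cnt _) (runs_clear .st _))
  simp only [Mem.get, Mem.set, List.reverse_reverse, List.append_nil] at A1 A2 A5 A11 A13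
  refine (RunsM.seq A1 (RunsM.seq A2 (RunsM.seq A3 (RunsM.seq A4 (RunsM.seq A5 (RunsM.seq A6
    (RunsM.seq A7 (RunsM.seq A8 (RunsM.seq A9 (RunsM.seq A10 (RunsM.seq A11 (RunsM.seq A12
      A13)))))))))))).mono ?_
  simp only [List.length_reverse, List.length_replicate]
  rw [countVec] at m2 ⊢
  rw [countTime]
  omega

end StackProgram

/-! ### Correctness and running time of the counting program -/

namespace StackProgram

open Computability (encodeNat)

/-! ### Binary numbers -/

theorem encodeNat_zero : encodeNat 0 = [] := rfl

/-- Together with the empty code of 0, this recursion on the lowest bit replaces the passage through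
`Num` in the inductions below. -/
theorem encodeNat_of_pos {a : ℕ} (ha : 0 < a) :
    encodeNat a = decide (a % 2 = 1) :: encodeNat (a / 2) := by
  obtain ⟨b, m, rfl⟩ : ∃ b m, a = Nat.bit b m := ⟨_, _, (Nat.bit_bodd_div2 a).symm⟩
  have e : ((Nat.bit b m : ℕ) : Num) = cond b Num.bit1 Num.bit0 (m : Num) := by
    rw [← Num.ofNat'_eq, ← Num.ofNat'_eq, Num.ofNat'_bit]
  have e2 : Nat.bit b m / 2 = m := by
    rw [← Nat.div2_val, Nat.div2_bit]
  have e3 : decide (Nat.bit b m % 2 = 1) = b := by cases b <;> simp [Nat.bit]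
  rw [e2, e3]
  unfold encodeNat
  rw [e]
  rcases hm : (m : Num) with _ | p
  · cases b
    · have : m = 0 := by
        have := congrArg (fun x : Num => (x : ℕ)) hm
        simpa using this
      subst this
      simp [Nat.bit] at ha
    · rfl
  · cases b <;> rfl

theorem encodeNat_eq_nil {a : ℕ} : encodeNat a = [] ↔ a = 0 := by
  constructor
  · intro h
    by_contra ha
    rw [encodeNat_of_pos (Nat.pos_of_ne_zero ha)] at h
    simp at h
  · rintro rfl
    rfl

theorem headD_encodeNat (a : ℕ) : (encodeNat a).headD false = decide (a % 2 = 1) := by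
  rcases Nat.eq_zero_or_pos a with rfl | ha
  · rfl
  · rw [encodeNat_of_pos ha]; rfl

theorem tail_encodeNat (a : ℕ) : (encodeNat a).tail = encodeNat (a / 2) := by
  rcases Nat.eq_zero_or_pos a with rfl | ha
  · rfl
  · rw [encodeNat_of_pos ha]; rfl

theorem addCarry_encodeNat (a : ℕ) (d : Bool) :
    addCarry (encodeNat a) d = encodeNat (a + d.toNat) := by
  induction a using Nat.strong_induction_on generalizing d with
  | _ a ih =>
    rcases Nat.eq_zero_or_pos a with rfl | ha
    · cases d <;> rfl
    · rw [encodeNat_of_pos ha, addCarry, ih (a / 2) (by omega),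
        encodeNat_of_pos (a := a + d.toNat) (by omega)]
      have : a % 2 = 0 ∨ a % 2 = 1 := by omega
      congr 2
      · rcases this with h | h <;> cases d <;> simp [h, Nat.add_mod]
      · rcases this with h | h <;> cases d <;> simp [h, carry] <;> omega

/-- Sums of canonical codes are canonical. Therefore emptiness of the code is a correct test for
zero, and the output is literally a value of `encodeNat`. -/
theorem addBits_encodeNat (a b : ℕ) (d : Bool) :
    addBits (encodeNat a) (encodeNat b) d = encodeNat (a + b + d.toNat) := by
  induction a using Nat.strong_induction_on generalizing b d with
  | _ a ih =>
    rcases Nat.eq_zero_or_pos a with rfl | ha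
    · rw [encodeNat_zero, addBits, addCarry_encodeNat, zero_add]
    · rw [encodeNat_of_pos ha, addBits, headD_encodeNat, tail_encodeNat, ih (a / 2) (by omega),
        encodeNat_of_pos (a := a + b + d.toNat) (by omega)]
      have h1 : a % 2 = 0 ∨ a % 2 = 1 := by omega
      have h2 : b % 2 = 0 ∨ b % 2 = 1 := by omega
      congr 2
      · rcases h1 with h | h <;> rcases h2 with h' | h' <;> cases d <;>
          simp [h, h', Nat.add_mod]
      · rcases h1 with h | h <;> rcases h2 with h' | h' <;> cases d <;>
          simp [h, h', carry] <;> omega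

theorem sign_encodeNat (a : ℕ) : sign (encodeNat a) = encodeNat (if a = 0 then 0 else 1) := by
  unfold sign
  simp only [encodeNat_eq_nil]
  split_ifs <;> rfl

theorem sumEntries_encodeNat (c : List ℕ) (es : List ℕ) (y : ℕ) :
    sumEntries (c.map encodeNat) es (encodeNat y) =
      encodeNat (y + (es.map fun e => c.getD e 0).sum) := by
  induction es generalizing y with
  | nil => simp [sumEntries]
  | cons e es ih =>
    have h1 : (c.map encodeNat).getD e [] = encodeNat (c.getD e 0) := by
      rw [← encodeNat_zero, List.getD_map]
    rw [sumEntries, List.foldl_cons, h1, addBits_encodeNat]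
    refine (ih _).trans ?_
    rw [List.map_cons, List.sum_cons, Bool.toNat_false]
    congr 1
    ring

/-! ### The counting program on an automaton -/

variable {k : ℕ}

/-- The successor as an index: `0` if it is undefined. -/
def succIdx {n : ℕ} : Option (Fin n) → ℕ
  | none => 0
  | some p => p + 1

/-- The table of transitions of an automaton. -/
def rowsOf (A : PDFA k) : List (Bool × List ℕ) :=
  (List.finRange A.numStates).map fun q =>
    (A.accept q, (List.finRange k).map fun a => succIdx (A.step q a))

@[simp] theorem length_rowsOf (A : PDFA k) : (rowsOf A).length = A.numStates := by
  simp [rowsOf]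

theorem code_eq (A : PDFA k) :
    A.code = unary (rowsOf A).length ++ (unary A.start ++ (rowsOf A).flatMap encRow) := by
  have : ∀ q, (A.row q).flatMap unary =
      encRow (A.accept q, (List.finRange k).map fun a => succIdx (A.step q a)) := by
    intro q
    rw [PDFA.row, List.flatMap_cons, encRow]
    congr 2
    refine List.map_congr_left fun a _ => ?_
    cases A.step q a <;> rfl
  rw [PDFA.code, List.flatMap_cons, List.flatMap_cons, List.flatMap_assoc, length_rowsOf, rowsOf,
    List.flatMap_map]
  simp only [this]

theorem wellFormed_rowsOf (A : PDFA k) : WellFormed k (rowsOf A) := by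
  intro r hr
  obtain ⟨q, -, rfl⟩ := List.mem_map.1 hr
  refine ⟨by simp, fun e he => ?_⟩
  obtain ⟨a, -, rfl⟩ := List.mem_map.1 he
  rw [length_rowsOf]
  cases A.step q a with
  | none => exact Nat.zero_le _
  | some p => exact p.2

/-- The value at the successor, `0` if it is undefined. -/
def atSucc {n : ℕ} (c : Fin n → ℕ) : Option (Fin n) → ℕ
  | none => 0
  | some p => c p

/-- One step of the count: the sum of the values at the successors, plus `1` at the final
states if `flag`. -/
def stepCount (A : PDFA k) (flag : Bool) (c : Fin A.numStates → ℕ) (q : Fin A.numStates) : ℕ :=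
  (if flag && A.accept q then 1 else 0) + ∑ a, atSucc c (A.step q a)

/-- The vector of the binary numbers `c q`, preceded by `0`. -/
def vecOf {n : ℕ} (c : Fin n → ℕ) : List (List Bool) :=
  (0 :: (List.finRange n).map c).map encodeNat

theorem vecOf_getD {n : ℕ} (c : Fin n → ℕ) (q : Fin n) :
    (vecOf c).getD (q + 1) [] = encodeNat (c q) := by
  rw [vecOf, ← encodeNat_zero, List.getD_map, List.getD_cons_succ,
    List.getD_eq_getElem _ _ (by simp)]
  simp

theorem atSucc_eq_getD {n : ℕ} (c : Fin n → ℕ) (o : Option (Fin n)) :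
    (0 :: (List.finRange n).map c).getD (succIdx o) 0 = atSucc c o := by
  cases o with
  | none => rfl
  | some q =>
    rw [succIdx, List.getD_cons_succ, List.getD_eq_getElem _ _ (by simp)]
    simp [atSucc]

/-- The link between the program on bit strings and the recursion on states: the leading 0 of
`vecOf` supplies the value at undefined transitions. -/
theorem stepVec_vecOf (A : PDFA k) (flag : Bool) (c : Fin A.numStates → ℕ) :
    stepVec flag (rowsOf A) (vecOf c) = vecOf (stepCount A flag c) := by
  rw [stepVec, vecOf, vecOf, rowsOf, List.map_cons, List.map_cons, encodeNat_zero, List.map_map,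
    List.map_map, List.map_map]
  congr 1
  refine List.map_congr_left fun q _ => ?_
  have h1 : (if (flag && A.accept q) = true then [true] else []) =
      encodeNat (if (flag && A.accept q) = true then 1 else 0) := by
    split_ifs <;> rfl
  simp only [Function.comp_apply, rowVal, h1]
  rw [← List.map_map, ← encodeNat_zero, ← List.map_cons, sumEntries_encodeNat, stepCount, List.map_map]
  congr 2
  rw [← List.sum_ofFn, List.ofFn_eq_map]
  congr 1
  exact List.map_congr_left fun a _ => atSucc_eq_getD c _

theorem iterate_stepVec_vecOf (A : PDFA k) (flag : Bool) (c : Fin A.numStates → ℕ) (j : ℕ) :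
    (stepVec flag (rowsOf A))^[j] (vecOf c) = vecOf ((stepCount A flag)^[j] c) := by
  induction j with
  | zero => rfl
  | succ j ih => rw [Function.iterate_succ_apply', ih, stepVec_vecOf, Function.iterate_succ_apply']

theorem map_sign_vecOf {n : ℕ} (c : Fin n → ℕ) :
    (vecOf c).map sign = vecOf fun q => if c q = 0 then 0 else 1 := by
  simp only [vecOf, List.map_map, List.map_cons]
  congr 1
  exact List.map_congr_left fun q _ => sign_encodeNat _

/-- `1` if a final state can be reached from `q`, and `0` otherwise. -/
def reachCount (A : PDFA k) (q : Fin A.numStates) : ℕ :=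
  if (stepCount A true)^[A.numStates] (fun _ => 0) q = 0 then 0 else 1

/-- `1` if the state `q` is live, and `0` otherwise. -/
def liveCount (A : PDFA k) (q : Fin A.numStates) : ℕ :=
  if (stepCount A false)^[A.numStates] (reachCount A) q = 0 then 0 else 1

/-- The number of words of length `numStates` leading from the initial state to a live state, or
`1` if there are none and the language is nonempty. -/
def partCount (A : PDFA k) : ℕ :=
  if (stepCount A false)^[A.numStates] (liveCount A) A.start = 0 then reachCount A A.start
  else (stepCount A false)^[A.numStates] (liveCount A) A.start

theorem reachVec_rowsOf (A : PDFA k) : reachVec (rowsOf A) = vecOf (reachCount A) := by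
  have h0 : List.replicate ((rowsOf A).length + 1) [] = vecOf fun _ : Fin A.numStates => 0 := by
    rw [vecOf, length_rowsOf, List.map_cons, List.map_map, List.replicate_succ, encodeNat_zero]
    congr 1
    symm
    rw [List.eq_replicate_iff]
    simp [encodeNat_zero]
  rw [reachVec, h0, iterate_stepVec_vecOf, map_sign_vecOf, length_rowsOf]
  rfl

theorem countResult_rowsOf (A : PDFA k) :
    countResult A.start (rowsOf A) = encodeNat (partCount A) := by
  have h1 : countVec (rowsOf A) = vecOf ((stepCount A false)^[A.numStates] (liveCount A)) := by
    rw [countVec, reachVec_rowsOf, iterate_stepVec_vecOf, map_sign_vecOf, iterate_stepVec_vecOf,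
      length_rowsOf]
    rfl
  rw [countResult, h1, reachVec_rowsOf, vecOf_getD, vecOf_getD, partCount]
  simp only [encodeNat_eq_nil]
  split_ifs <;> rfl

/-! ### The time bound -/

/-- Functions given by polynomials. -/
def IsPoly (f : ℕ → ℕ) : Prop := ∃ p : Polynomial ℕ, ∀ n, p.eval n = f n

theorem IsPoly.const (c : ℕ) : IsPoly fun _ => c := ⟨Polynomial.C c, fun n => by simp⟩

theorem IsPoly.id : IsPoly fun n => n := ⟨Polynomial.X, fun n => by simp⟩

theorem IsPoly.add {f g : ℕ → ℕ} (hf : IsPoly f) (hg : IsPoly g) : IsPoly fun n => f n + g n := by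
  obtain ⟨p, hp⟩ := hf
  obtain ⟨q, hq⟩ := hg
  exact ⟨p + q, fun n => by simp [hp, hq]⟩

theorem IsPoly.mul {f g : ℕ → ℕ} (hf : IsPoly f) (hg : IsPoly g) : IsPoly fun n => f n * g n := by
  obtain ⟨p, hp⟩ := hf
  obtain ⟨q, hq⟩ := hg
  exact ⟨p * q, fun n => by simp [hp, hq]⟩

/-- It suffices to set both arguments equal: since numbers are coded in unary, the number of states
and the length of the table are both at most the length of the code. -/
theorem isPoly_countTime (k : ℕ) : IsPoly fun n => countTime k n n := by
  simp only [countTime, reachTime, passesTime, passTime, rowTime]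
  repeat' first
    | exact IsPoly.const _
    | exact IsPoly.id
    | apply IsPoly.add
    | apply IsPoly.mul

theorem countTime_mono {k n n' t t' : ℕ} (hn : n ≤ n') (ht : t ≤ t') :
    countTime k n t ≤ countTime k n' t' := by
  simp only [countTime, reachTime, passesTime, passTime, rowTime]
  gcongr

/-- The number `partCount A` can be computed in polynomial time. -/
theorem polyTime_partCount (k : ℕ) : PolyTime (partCount (k := k)) := by
  obtain ⟨p, hp⟩ := isPoly_countTime k
  refine computableInPolyTime (countProg k) .tab .out p fun A => ?_
  have h := runs_countProg (wellFormed_rowsOf A) (s := A.start) (by simp)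
  rw [← code_eq, countResult_rowsOf] at h
  have e1 : (⟨A.code, [], [], [], [], [], [], [], [], [], [], [], []⟩ : Mem).get =
      Function.update (fun _ => []) .tab A.code := by
    funext x
    cases x <;> rfl
  have e2 : (⟨[], [], [], [], [], [], [], [], [], [], [], [], encodeNat (partCount A)⟩ : Mem).get =
      Function.update (fun _ => []) .out (encodeNat (partCount A)) := by
    funext x
    cases x <;> rfl
  rw [← e1, ← e2]
  refine Runs.mono h ?_
  rw [hp]
  have hlen : (rowsOf A).length ≤ A.code.length ∧
      ((rowsOf A).flatMap encRow).length ≤ A.code.length := by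
    rw [code_eq]
    simp only [List.length_append, unary, List.length_replicate]
    omega
  exact countTime_mono hlen.1 hlen.2

end StackProgram

/-! ### Live words and slender languages -/

namespace PushPopRight

variable {k : ℕ} (A : PDFA k)

/-! ### Runs of automata and pumping -/

/-- The word `w` is accepted from the state `q`. -/
def PDFA.Accepts (q : Fin A.numStates) (w : Word k) : Prop :=
  ∃ p, A.run q w = some p ∧ A.accept p = true

/-- A state from which a word of length at least the number of states is accepted. -/
def PDFA.Live (q : Fin A.numStates) : Prop :=
  ∃ w, A.numStates ≤ w.length ∧ A.Accepts q w

variable {A} {p q r : Fin A.numStates} {u v w x : Word k}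

theorem PDFA.run_append (q : Fin A.numStates) (u v : Word k) :
    A.run q (u ++ v) = (A.run q u).bind fun p => A.run p v := by
  induction u generalizing q with
  | nil => rfl
  | cons a u ih =>
    simp only [List.cons_append, PDFA.run, ih]
    cases A.step q a <;> rfl

theorem PDFA.run_append_of_eq (h : A.run q u = some p) (v : Word k) :
    A.run q (u ++ v) = A.run p v := by
  rw [PDFA.run_append, h, Option.bind_some]

theorem PDFA.exists_run_of_append {v : Word k} (h : A.run q (u ++ v) = some p) :
    ∃ r, A.run q u = some r ∧ A.run r v = some p := by
  rwa [PDFA.run_append, Option.bind_eq_some_iff] at h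

theorem PDFA.accepts_append (h : A.run q u = some p) (v : Word k) :
    A.Accepts q (u ++ v) ↔ A.Accepts p v := by
  rw [PDFA.Accepts, PDFA.run_append_of_eq h, PDFA.Accepts]

theorem PDFA.Accepts.exists_run (h : A.Accepts q (u ++ v)) :
    ∃ r, A.run q u = some r ∧ A.Accepts r v := by
  obtain ⟨p, hp, ha⟩ := h
  obtain ⟨r, hr, hv⟩ := PDFA.exists_run_of_append hp
  exact ⟨r, hr, p, hv, ha⟩

theorem PDFA.mem_language : w ∈ A.language ↔ A.Accepts A.start w := Iff.rfl

/-- A run visiting more positions than there are states repeats a state. -/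
theorem PDFA.exists_repeat (h : A.run q w = some p) (i : ℕ) :
    ∃ j l r, i ≤ j ∧ j < l ∧ l ≤ i + A.numStates ∧ A.run q (w.take j) = some r ∧
      A.run q (w.take l) = some r := by
  have key : ∀ j, ∃ r, A.run q (w.take j) = some r := fun j => by
    rw [← List.take_append_drop j w] at h
    obtain ⟨r, hr, -⟩ := PDFA.exists_run_of_append h
    exact ⟨r, hr⟩
  choose f hf using key
  -- Positions beyond the end of `w` are allowed; there `take` returns all of `w`.
  obtain ⟨j, l, hne, hjl⟩ := Fintype.exists_ne_map_eq_of_card_lt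
    (fun j : Fin (A.numStates + 1) => f (i + j)) (by simp)
  rcases lt_or_gt_of_ne hne with hlt | hlt
  · exact ⟨i + j, i + l, f (i + j), by omega, by omega, by omega, hf _, by rw [hf, ← hjl]⟩
  · exact ⟨i + l, i + j, f (i + j), by omega, by omega, by omega, by rw [hf, ← hjl], hf _⟩

theorem PDFA.exists_loop (h : A.run q w = some p) (hw : A.numStates ≤ w.length) :
    ∃ a b c r, w = a ++ (b ++ c) ∧ b ≠ [] ∧ b.length ≤ A.numStates ∧ A.run q a = some r ∧
      A.run r b = some r ∧ A.run r c = some p := by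
  obtain ⟨j, l, r, -, hjl, hl, hj1, hl1⟩ := PDFA.exists_repeat h 0
  have e1 : w.take j ++ (w.take l).drop j = w.take l := by
    conv_rhs => rw [← List.take_append_drop j (w.take l), List.take_take, min_eq_left hjl.le]
  refine ⟨w.take j, (w.take l).drop j, w.drop l, r, ?_, ?_, ?_, hj1, ?_, ?_⟩
  · rw [← List.append_assoc, e1, List.take_append_drop]
  · intro h0
    have := congrArg List.length h0
    simp at this
    omega
  · simp
    omega
  · rw [← PDFA.run_append_of_eq hj1, e1, hl1]
  · rw [← PDFA.run_append_of_eq hl1, List.take_append_drop, h]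

theorem PDFA.run_pow (h : A.run r u = some r) (j : ℕ) :
    A.run r (List.replicate j u).flatten = some r := by
  induction j with
  | zero => rfl
  | succ j ih => rw [List.replicate_succ, List.flatten_cons, PDFA.run_append_of_eq h, ih]

/-- Loops are cut out as long as the word has at least as many letters as there are states. -/
theorem PDFA.Accepts.exists_short (h : A.Accepts q w) :
    ∃ v, v.length < A.numStates ∧ A.Accepts q v := by
  induction hn : w.length using Nat.strong_induction_on generalizing w with
  | _ n ih =>
    by_cases hw : w.length < A.numStates
    · exact ⟨w, hw, h⟩
    · obtain ⟨p, hp, ha⟩ := h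
      obtain ⟨a, b, c, r, rfl, hb, -, h1, h2, h3⟩ := PDFA.exists_loop hp (by omega)
      have hb' := List.length_pos_iff.2 hb
      refine ih (a ++ c).length ?_ (w := a ++ c) ⟨p, ?_, ha⟩ rfl
      · rw [← hn]; simp; omega
      · rw [PDFA.run_append_of_eq h1, h3]

theorem PDFA.Live.exists_long (h : A.Live q) (N : ℕ) : ∃ w, N ≤ w.length ∧ A.Accepts q w := by
  obtain ⟨w, hw, p, hp, ha⟩ := h
  obtain ⟨a, b, c, r, rfl, hb, -, h1, h2, h3⟩ := PDFA.exists_loop hp hw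
  have hb' := List.length_pos_iff.2 hb
  refine ⟨a ++ ((List.replicate N b).flatten ++ c), ?_, p, ?_, ha⟩
  · simp
    nlinarith
  · rw [PDFA.run_append_of_eq h1, PDFA.run_append_of_eq (PDFA.run_pow h2 N), h3]

/-- A long accepted word can be pumped; conversely, over a finite alphabet only finitely many words
are short. -/
theorem PDFA.live_iff_infinite : A.Live q ↔ {w | A.Accepts q w}.Infinite := by
  constructor
  · intro h hf
    obtain ⟨N, hN⟩ := (hf.image List.length).bddAbove
    obtain ⟨w, hw, ha⟩ := h.exists_long (N + 1)
    have := hN (Set.mem_image_of_mem _ ha)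
    omega
  · intro h
    by_contra hl
    refine h ((List.finite_length_lt (Fin k) A.numStates).subset fun w hw => ?_)
    by_contra hlen
    exact hl ⟨w, not_lt.1 hlen, hw⟩

theorem PDFA.Live.of_run (h : A.run q u = some p) (hp : A.Live p) : A.Live q := by
  obtain ⟨w, hw, ha⟩ := hp
  exact ⟨u ++ w, by simp; omega, (PDFA.accepts_append h w).2 ha⟩

theorem PDFA.Live.exists_step (h : A.Live q) (m : ℕ) :
    ∃ u p, u.length = m ∧ A.run q u = some p ∧ A.Live p := by
  obtain ⟨w, hw, ha⟩ := h.exists_long (m + A.numStates)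
  rw [← List.take_append_drop m w] at ha
  obtain ⟨p, hp, ha⟩ := ha.exists_run
  exact ⟨w.take m, p, by simp; omega, hp, w.drop m, by simp; omega, ha⟩

/-! ### Counting the words that lead to live states -/

open StackProgram

/-- After `j` rounds the value at `q` counts the accepted words of length less than `j`; only
whether it vanishes matters. -/
theorem iterate_stepCount_true_ne_zero (j : ℕ) :
    (stepCount A true)^[j] (fun _ => 0) q ≠ 0 ↔ ∃ w, w.length < j ∧ A.Accepts q w := by
  induction j generalizing q with
  | zero => simp
  | succ j ih =>
    rw [Function.iterate_succ_apply', stepCount]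
    have h1 : ∀ a, atSucc ((stepCount A true)^[j] fun _ => 0) (A.step q a) ≠ 0 ↔
        ∃ w, w.length < j ∧ A.Accepts q (a :: w) := by
      intro a
      cases h : A.step q a with
      | none => simp [atSucc, PDFA.Accepts, PDFA.run, h]
      | some p =>
        rw [atSucc, ih]
        simp [PDFA.Accepts, PDFA.run, h]
    constructor
    · intro h
      by_cases hq : A.accept q = true
      · exact ⟨[], by simp, q, rfl, hq⟩
      · have : ∑ a, atSucc ((stepCount A true)^[j] fun _ => 0) (A.step q a) ≠ 0 := by
          simpa [hq] using h
        obtain ⟨a, -, ha⟩ := Finset.exists_ne_zero_of_sum_ne_zero this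
        obtain ⟨w, hw, ha⟩ := (h1 a).1 ha
        exact ⟨a :: w, by simpa using hw, ha⟩
    · rintro ⟨w, hw, ha⟩
      rcases w with _ | ⟨a, w⟩
      · obtain ⟨p, hp, ha⟩ := ha
        obtain rfl : q = p := by simpa [PDFA.run] using hp
        simp [ha]
      · have := (h1 a).2 ⟨w, by simpa using hw, ha⟩
        have h2 := Finset.single_le_sum (s := Finset.univ)
          (f := fun a => atSucc ((stepCount A true)^[j] fun _ => 0) (A.step q a))
          (fun _ _ => Nat.zero_le _) (Finset.mem_univ a)
        omega

/-- `numStates` rounds suffice, because a state that accepts some word accepts one of length less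
than `numStates`. -/
theorem reachCount_ne_zero : reachCount A q ≠ 0 ↔ ∃ w, A.Accepts q w := by
  rw [reachCount]
  have := iterate_stepCount_true_ne_zero (A := A) (q := q) A.numStates
  constructor
  · intro h
    obtain ⟨w, -, hw⟩ := this.1 (by rintro h0; simp [h0] at h)
    exact ⟨w, hw⟩
  · rintro ⟨w, hw⟩
    obtain ⟨v, hv, hv'⟩ := hw.exists_short
    rw [if_neg (this.2 ⟨v, hv, hv'⟩)]
    simp

variable (A) in
/-- The words of length `m` that lead from `q` to a state at which `c` does not vanish, with
multiplicity. -/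
def wordsTo (c : Fin A.numStates → ℕ) : ℕ → Fin A.numStates → List (Word k)
  | 0, q => List.replicate (c q) []
  | m + 1, q => (List.finRange k).flatMap fun a =>
    match A.step q a with
    | none => []
    | some p => (wordsTo c m p).map (a :: ·)

theorem length_wordsTo (c : Fin A.numStates → ℕ) (m : ℕ) (q : Fin A.numStates) :
    (wordsTo A c m q).length = (stepCount A false)^[m] c q := by
  induction m generalizing q with
  | zero => simp [wordsTo]
  | succ m ih =>
    rw [Function.iterate_succ_apply', stepCount, wordsTo, List.length_flatMap, ← List.sum_ofFn,
      List.ofFn_eq_map]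
    simp only [Bool.false_and, Bool.false_eq_true, if_false, zero_add]
    congr 1
    refine List.map_congr_left fun a _ => ?_
    cases A.step q a with
    | none => rfl
    | some p => simp [ih, atSucc]

theorem mem_wordsTo {c : Fin A.numStates → ℕ} {m : ℕ} :
    w ∈ wordsTo A c m q ↔ w.length = m ∧ ∃ p, A.run q w = some p ∧ c p ≠ 0 := by
  induction m generalizing q w with
  | zero =>
    rcases w with _ | ⟨a, w⟩
    · simp [wordsTo, PDFA.run]
    · simp [wordsTo]
  | succ m ih =>
    rw [wordsTo, List.mem_flatMap]
    constructor
    · rintro ⟨a, -, ha⟩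
      cases h : A.step q a with
      | none => simp [h] at ha
      | some p =>
        rw [h] at ha
        obtain ⟨v, hv, rfl⟩ := List.mem_map.1 ha
        obtain ⟨h1, h2⟩ := ih.1 hv
        exact ⟨by simp [h1], by simpa [PDFA.run, h] using h2⟩
    · rintro ⟨hm, p, hp, hc⟩
      rcases w with _ | ⟨a, w⟩
      · simp at hm
      · refine ⟨a, List.mem_finRange a, ?_⟩
        rw [PDFA.run, Option.bind_eq_some_iff] at hp
        obtain ⟨r, hr, hp⟩ := hp
        rw [hr]
        exact List.mem_map.2 ⟨w, ih.2 ⟨by simpa using hm, p, hp, hc⟩, rfl⟩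

/-- Words with different first letters differ, and determinism leaves one continuation per letter.
This turns the numbers of the program into cardinalities of sets of words. -/
theorem nodup_wordsTo {c : Fin A.numStates → ℕ} (hc : ∀ q, c q ≤ 1) (m : ℕ)
    (q : Fin A.numStates) : (wordsTo A c m q).Nodup := by
  induction m generalizing q with
  | zero => exact List.nodup_replicate.2 (hc q)
  | succ m ih =>
    rw [wordsTo, List.nodup_flatMap]
    refine ⟨fun a _ => ?_, (List.nodup_finRange k).imp fun {a b} hab => ?_⟩
    · cases A.step q a with
      | none => exact List.nodup_nil
      | some p => exact (ih p).map (List.cons_injective)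
    · intro w h1 h2
      refine hab ?_
      cases ha : A.step q a <;> cases hb : A.step q b <;> simp only [ha, hb] at h1 h2
      · simp at h1
      · simp at h1
      · simp at h2
      · obtain ⟨x, -, rfl⟩ := List.mem_map.1 h1
        obtain ⟨y, -, e⟩ := List.mem_map.1 h2
        exact (List.cons_eq_cons.1 e).1.symm

/-- Cutting a long accepted word after `numStates` letters shows what the second group of rounds
detects: words of exactly this length that lead to a state accepting something. -/
theorem liveCount_ne_zero : liveCount A q ≠ 0 ↔ A.Live q := by
  have h1 : liveCount A q ≠ 0 ↔
      (stepCount A false)^[A.numStates] (reachCount A) q ≠ 0 := by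
    rw [liveCount]
    split_ifs with h <;> simp [h]
  rw [h1, ← length_wordsTo, ← Nat.pos_iff_ne_zero, List.length_pos_iff_exists_mem]
  constructor
  · rintro ⟨w, hw⟩
    obtain ⟨hl, p, hp, hc⟩ := mem_wordsTo.1 hw
    obtain ⟨v, hv⟩ := reachCount_ne_zero.1 hc
    exact ⟨w ++ v, by simp; omega, (PDFA.accepts_append hp v).2 hv⟩
  · rintro ⟨w, hw, ha⟩
    rw [← List.take_append_drop A.numStates w] at ha
    obtain ⟨p, hp, ha⟩ := ha.exists_run
    exact ⟨w.take A.numStates, mem_wordsTo.2 ⟨by simpa using hw, p, hp,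
      reachCount_ne_zero.2 ⟨_, ha⟩⟩⟩

variable (A) in
/-- The set of words of length `m` that lead from `q` to a live state. -/
def liveWords (q : Fin A.numStates) (m : ℕ) : Finset (Word k) :=
  (wordsTo A (liveCount A) m q).toFinset

theorem mem_liveWords {m : ℕ} :
    w ∈ liveWords A q m ↔ w.length = m ∧ ∃ p, A.run q w = some p ∧ A.Live p := by
  simp only [liveWords, List.mem_toFinset, mem_wordsTo, liveCount_ne_zero]

theorem card_liveWords (q : Fin A.numStates) (m : ℕ) :
    (liveWords A q m).card = (stepCount A false)^[m] (liveCount A) q := by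
  rw [liveWords, List.toFinset_card_of_nodup (nodup_wordsTo (fun q => ?_) m q), length_wordsTo]
  rw [liveCount]
  split_ifs <;> simp

theorem PDFA.Live.card_liveWords_pos (h : A.Live q) (m : ℕ) : 0 < (liveWords A q m).card := by
  obtain ⟨u, p, hu, hp, hl⟩ := h.exists_step m
  exact Finset.card_pos.2 ⟨u, mem_liveWords.2 ⟨hu, p, hp, hl⟩⟩

theorem card_liveWords_append (h : A.run q u = some p) (m : ℕ) :
    (liveWords A p m).card ≤ (liveWords A q (u.length + m)).card := by
  refine Finset.card_le_card_of_injOn (u ++ ·) (fun w hw => ?_)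
    fun _ _ _ _ e => List.append_cancel_left e
  obtain ⟨hl, r, hr, hlive⟩ := mem_liveWords.1 hw
  exact mem_liveWords.2 ⟨by simp [hl], r, by rw [PDFA.run_append_of_eq h, hr], hlive⟩

theorem take_mem_liveWords {m j : ℕ} (h : w ∈ liveWords A q m) (hj : j ≤ m) :
    w.take j ∈ liveWords A q j := by
  obtain ⟨hl, p, hp, hlive⟩ := mem_liveWords.1 h
  rw [← List.take_append_drop j w] at hp
  obtain ⟨r, hr, hd⟩ := PDFA.exists_run_of_append hp
  exact mem_liveWords.2 ⟨by simp; omega, r, hr, hlive.of_run hd⟩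

/-- Live words have live extensions of every greater length, so truncation is surjective. -/
theorem card_liveWords_mono (q : Fin A.numStates) {m m' : ℕ} (h : m ≤ m') :
    (liveWords A q m).card ≤ (liveWords A q m').card := by
  refine Finset.card_le_card_of_surjOn (List.take m) fun w hw => ?_
  obtain ⟨hl, p, hp, hlive⟩ := mem_liveWords.1 hw
  obtain ⟨u, r, hu, hr, hlive⟩ := hlive.exists_step (m' - m)
  exact ⟨w ++ u, mem_liveWords.2 ⟨by simp; omega, r, by rw [PDFA.run_append_of_eq hp, hr], hlive⟩,
    by rw [← hl]; simp⟩

/-- A live word becomes an accepted word after fewer than `numStates` further letters, and its own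
`m` letters can be read off the result. So the live words of length `m` inject into the accepted
words of `numStates` consecutive lengths. -/
theorem Slender.card_liveWords_le (h : Slender A.language) :
    ∃ C, ∀ m, (liveWords A A.start m).card ≤ C := by
  classical
  obtain ⟨C, hC⟩ := h
  refine ⟨A.numStates * C, fun m => ?_⟩
  have hfin : ∀ j, {w ∈ A.language | w.length = j}.Finite := fun j =>
    (List.finite_length_eq (Fin k) j).subset fun w hw => hw.2
  have hcard : ∀ j, (hfin j).toFinset.card ≤ C := fun j => by
    have := hC j
    rw [(hfin j).encard_eq_coe_toFinset_card] at this
    exact_mod_cast this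
  have hext : ∀ w ∈ liveWords A A.start m, ∃ v : Word k, v.length < A.numStates ∧
      A.Accepts A.start (w ++ v) := by
    intro w hw
    obtain ⟨-, p, hp, u, -, hu⟩ := mem_liveWords.1 hw
    obtain ⟨v, hv, hv'⟩ := hu.exists_short
    exact ⟨v, hv, (PDFA.accepts_append hp v).2 hv'⟩
  choose! f hf using hext
  have h1 : (liveWords A A.start m).card ≤
      ((Finset.range A.numStates).biUnion fun j => (hfin (m + j)).toFinset).card := by
    refine Finset.card_le_card_of_injOn (fun w => w ++ f w) (fun w hw => ?_)
      fun w hw w' hw' e => ?_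
    · have hl := (mem_liveWords.1 hw).1
      refine Finset.mem_coe.2 (Finset.mem_biUnion.2 ⟨(f w).length,
        Finset.mem_range.2 (hf w hw).1, ?_⟩)
      simpa [hl] using PDFA.mem_language.2 (hf w hw).2
    · exact (List.append_inj e ((mem_liveWords.1 hw).1.trans (mem_liveWords.1 hw').1.symm)).1
  refine h1.trans ((Finset.card_biUnion_le_card_mul _ _ C fun j _ => hcard _).trans ?_)
  simp

/-- If the number of live words is bounded, then a live state on a loop has exactly one live word
of each length. -/
theorem card_liveWords_of_loop {C : ℕ} (hC : ∀ m, (liveWords A q m).card ≤ C) (hq : A.Live q)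
    (hu : u ≠ []) (hr : A.run q u = some q) (m : ℕ) : (liveWords A q m).card = 1 := by
  have hlen := List.length_pos_iff.2 hu
  -- A second live word `v` as long as the loop would yield, besides all live words starting with
  -- `u`, one starting with `v`; the count would then grow with every turn of the loop.
  have huniq : ∀ v ∈ liveWords A q u.length, v = u := by
    intro v hv
    by_contra hne
    obtain ⟨hvl, p, hp, hlive⟩ := mem_liveWords.1 hv
    have hgrow : ∀ m, (liveWords A q m).card + 1 ≤ (liveWords A q (u.length + m)).card := by
      intro m
      obtain ⟨x, hx⟩ := Finset.card_pos.1 (hlive.card_liveWords_pos m)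
      obtain ⟨hxl, r, hr', hlive'⟩ := mem_liveWords.1 hx
      rw [← Finset.card_image_of_injective _ (List.append_right_injective u),
        ← Finset.card_insert_of_notMem (a := v ++ x)]
      · refine Finset.card_le_card fun y hy => ?_
        rcases Finset.mem_insert.1 hy with rfl | hy
        · exact mem_liveWords.2 ⟨by simp [hvl, hxl], r, by rw [PDFA.run_append_of_eq hp, hr'],
            hlive'⟩
        · obtain ⟨z, hz, rfl⟩ := Finset.mem_image.1 hy
          obtain ⟨hzl, s, hs, hlive''⟩ := mem_liveWords.1 hz
          exact mem_liveWords.2 ⟨by simp [hzl], s, by rw [PDFA.run_append_of_eq hr, hs], hlive''⟩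
      · intro hmem
        obtain ⟨z, -, e⟩ := Finset.mem_image.1 hmem
        exact hne (List.append_inj e hvl.symm).1.symm
    have : ∀ j, j ≤ (liveWords A q (j * u.length)).card := by
      intro j
      induction j with
      | zero => exact Nat.zero_le _
      | succ j ih =>
        have := hgrow (j * u.length)
        rw [add_mul, one_mul, add_comm (j * u.length)]
        omega
    have h1 := this (C + 1)
    have h2 := hC ((C + 1) * u.length)
    omega
  -- Consequently a live word of length `j * u.length` consists of `j` turns of the loop.
  have hle : ∀ j, (liveWords A q (j * u.length)).card ≤ 1 := by
    intro j
    rw [Finset.card_le_one]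
    induction j with
    | zero =>
      intro a ha b hb
      have h1 := (mem_liveWords.1 ha).1
      have h2 := (mem_liveWords.1 hb).1
      rw [zero_mul, List.length_eq_zero_iff] at h1 h2
      rw [h1, h2]
    | succ j ih =>
      have hd : ∀ a ∈ liveWords A q ((j + 1) * u.length),
          ∃ y ∈ liveWords A q (j * u.length), a = u ++ y := by
        intro a ha
        obtain ⟨hal, p, hp, hlive⟩ := mem_liveWords.1 ha
        have ht := huniq _ (take_mem_liveWords ha (j := u.length) (by nlinarith))
        rw [← List.take_append_drop u.length a, ht, PDFA.run_append_of_eq hr] at hp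
        refine ⟨a.drop u.length, mem_liveWords.2 ⟨?_, p, hp, hlive⟩, ?_⟩
        · rw [List.length_drop, hal, add_mul, one_mul, Nat.add_sub_cancel]
        · conv_lhs => rw [← List.take_append_drop u.length a, ht]
      intro a ha b hb
      obtain ⟨y, hy, rfl⟩ := hd a ha
      obtain ⟨z, hz, rfl⟩ := hd b hb
      rw [ih y hy z hz]
  have h1 := hq.card_liveWords_pos m
  -- The remaining lengths follow by monotonicity, since `u` is nonempty.
  have h2 := (card_liveWords_mono q (show m ≤ m * u.length by nlinarith)).trans (hle m)
  omega

/-- In a slender language, a live word of length at least the number of states has exactly one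
live extension of each length. -/
theorem Slender.card_liveWords_eq_one (h : Slender A.language) (hx : A.run A.start x = some p)
    (hxl : A.numStates ≤ x.length) (hp : A.Live p) (m : ℕ) : (liveWords A p m).card = 1 := by
  obtain ⟨C, hC⟩ := h.card_liveWords_le
  obtain ⟨a, b, c, r, rfl, hb, -, h1, h2, h3⟩ := PDFA.exists_loop hx hxl
  -- The state `r` lies on a loop, hence has one live word of each length; prefixing `c` embeds the
  -- live words of `p` into those of `r`.
  have h4 := card_liveWords_of_loop (fun m => (card_liveWords_append h1 m).trans (hC _))
    (hp.of_run h3) hb h2 (c.length + m)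
  have h5 := card_liveWords_append h3 m
  have h6 := hp.card_liveWords_pos m
  omega

end PushPopRight

/-! ### The least number of parts -/

namespace PushPopRight

variable {k : ℕ}

/-! ### The push-pop-right distance -/

/-- The script that removes `i` letters and then appends the letters of `v`. -/
def replaceEnd (i : ℕ) (v : Word k) : Script k :=
  List.replicate i .popR ++ v.map .pushR

@[simp] theorem length_replaceEnd (i : ℕ) (v : Word k) :
    (replaceEnd i v).length = i + v.length := by simp [replaceEnd]

theorem apply_replicate_popR (u v : Word k) :
    Script.apply (List.replicate v.length .popR) (u ++ v) = some u := by
  induction v using List.reverseRecOn with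
  | nil => simp [Script.apply]
  | append_singleton v a ih =>
    rw [List.length_append, List.length_singleton, List.replicate_succ, Script.apply]
    simp only [Edit.apply]
    rw [if_neg (by simp), Option.bind_some, ← List.append_assoc, List.dropLast_concat, ih]

theorem apply_map_pushR (u v : Word k) : Script.apply (v.map .pushR) u = some (u ++ v) := by
  induction v generalizing u with
  | nil => simp [Script.apply]
  | cons a v ih => simp [Script.apply, Edit.apply, ih]

theorem apply_replaceEnd (u v w : Word k) :
    (replaceEnd v.length w).apply (u ++ v) = some (u ++ w) := by
  rw [replaceEnd, Script.apply_append, apply_replicate_popR, Option.bind_some, apply_map_pushR]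

theorem pprDist_le {u v : Word k} {s : Script k} (h : s.apply u = some v) :
    pprDist u v ≤ s.length := Nat.sInf_le ⟨s, rfl, h⟩

theorem pprDist_append_le (u v w : Word k) :
    pprDist (u ++ v) (u ++ w) ≤ v.length + w.length := by
  simpa using pprDist_le (apply_replaceEnd u v w)

theorem exists_script_of_pprDist_le {u v : Word k} {d : ℕ} (h : pprDist u v ≤ d) :
    ∃ s : Script k, s.length ≤ d ∧ s.apply u = some v := by
  obtain ⟨s, hs⟩ := exists_script u v
  obtain ⟨t, ht, ht'⟩ := Nat.sInf_mem (s := {n : ℕ | ∃ s : Script k, s.length = n ∧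
    s.apply u = some v}) ⟨_, s, rfl, hs⟩
  exact ⟨t, ht.trans_le h, ht'⟩

/-- An operation affects only the last letter and shortens the word by at most one, so `s.length`
operations cannot reach the first `m` letters. -/
theorem take_eq_of_apply {s : Script k} {u v : Word k} {m : ℕ} (h : s.apply u = some v)
    (hm : m + s.length ≤ u.length) : v.take m = u.take m := by
  induction s generalizing u with
  | nil =>
    obtain rfl : u = v := by simpa [Script.apply] using h
    rfl
  | cons e s ih =>
    rw [Script.apply, Option.bind_eq_some_iff] at h
    obtain ⟨w, hw, h⟩ := h
    simp only [List.length_cons] at hm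
    cases e with
    | pushR a =>
      obtain rfl : u ++ [a] = w := by simpa [Edit.apply] using hw
      rw [ih h (by simp; omega), List.take_append_of_le_length (by omega)]
    | popR =>
      have hu : u ≠ [] := by rintro rfl; simp at hm
      obtain rfl : u.dropLast = w := by simpa [Edit.apply, hu] using hw
      rw [ih h (by simp; omega), List.dropLast_eq_take, List.take_take, min_eq_left (by omega)]

theorem take_eq_of_pprDist_le {u v : Word k} {m d : ℕ} (h : pprDist u v ≤ d)
    (hm : m + d ≤ u.length) : v.take m = u.take m := by
  obtain ⟨s, hs, hs'⟩ := exists_script_of_pprDist_le h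
  exact take_eq_of_apply hs' (by omega)

/-! ### Lower bound for the number of parts -/

/-- In an orderable language, at most one word of each length has infinitely many extensions. -/
theorem Orderable.eq_of_infinite {d : ℕ} {L : Set (Word k)} (h : Orderable pprDist d L)
    {u v : Word k} (huv : u.length = v.length) (hu : {x ∈ L | u <+: x}.Infinite)
    (hv : {x ∈ L | v <+: x}.Infinite) : u = v := by
  obtain ⟨N, s, hinj, rfl, hd⟩ := h
  have hlate : ∀ {u : Word k},
      {x ∈ {w | ∃ i : ℕ, (i : ℕ∞) < N ∧ s i = w} | u <+: x}.Infinite →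
      ∀ M : ℕ, ∃ j : ℕ, M ≤ j ∧ (j : ℕ∞) < N ∧ u <+: s j := by
    intro u hu M
    by_contra! hcon
    refine hu (((Set.finite_lt_nat M).image s).subset ?_)
    rintro x ⟨⟨j, hj, rfl⟩, hux⟩
    refine ⟨j, ?_, rfl⟩
    by_contra hM
    exact hcon j (not_lt.1 hM) hj hux
  have hN : ∀ j : ℕ, (j : ℕ∞) < N := by
    intro j
    obtain ⟨i, hi, hiN, -⟩ := hlate hu j
    exact lt_of_le_of_lt (by exact_mod_cast hi) hiN
  have hsinj : Function.Injective s := fun i j hij => hinj i j (hN i) (hN j) hij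
  -- As no word is repeated, only finitely many terms are short. After them, a step of at most `d`
  -- operations leaves the first `u.length` letters alone.
  have hfin : {j | (s j).length < u.length + d}.Finite :=
    (List.finite_length_lt (Fin k) (u.length + d)).preimage hsinj.injOn
  obtain ⟨M, hM⟩ := hfin.bddAbove
  have hlong : ∀ j, M < j → u.length + d ≤ (s j).length := by
    intro j hj
    by_contra hcon
    have := hM (not_le.1 hcon : (s j).length < u.length + d)
    omega
  have hconst : ∀ j, (s (M + 1 + j)).take u.length = (s (M + 1)).take u.length := by
    intro j
    induction j with
    | zero => rfl
    | succ j ih =>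
      rw [← ih, ← add_assoc]
      exact take_eq_of_pprDist_le (hd _ (hN _)) (hlong _ (by omega))
  have htake : ∀ {w : Word k}, w.length = u.length →
      {x ∈ {w | ∃ i : ℕ, (i : ℕ∞) < N ∧ s i = w} | w <+: x}.Infinite →
      w = (s (M + 1)).take u.length := by
    intro w hw hinf
    obtain ⟨j, hj, -, hpre⟩ := hlate hinf (M + 1)
    obtain ⟨i, rfl⟩ := Nat.exists_eq_add_of_le hj
    rw [← hconst i, ← hw]
    exact List.prefix_iff_eq_take.1 hpre
  rw [htake rfl hu, htake huv.symm hv]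

/-- The number of words of a given length with infinitely many extensions bounds the number of
parts from below. -/
theorem PartitionOrderable.card_le {t d : ℕ} {L : Set (Word k)}
    (h : PartitionOrderable pprDist t d L) {S : Finset (Word k)} {m : ℕ}
    (hS : ∀ w ∈ S, w.length = m ∧ {x ∈ L | w <+: x}.Infinite) : S.card ≤ t := by
  obtain ⟨P, rfl, -, hP⟩ := h
  have key : ∀ w ∈ S, ∃ i, {x ∈ P i | w <+: x}.Infinite := by
    intro w hw
    by_contra! hcon
    refine (hS w hw).2 ((Set.finite_iUnion fun i => hcon i).subset ?_)
    rintro x ⟨hx, hwx⟩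
    obtain ⟨i, hi⟩ := Set.mem_iUnion.1 hx
    exact Set.mem_iUnion.2 ⟨i, hi, hwx⟩
  rcases t with _ | t
  · rcases S.eq_empty_or_nonempty with rfl | ⟨w, hw⟩
    · simp
    · obtain ⟨i, -⟩ := key w hw
      exact i.elim0
  -- Two words of `S` assigned to the same part coincide by `Orderable.eq_of_infinite`, so the
  -- assignment of parts is injective.
  choose! f hf using key
  have := Finset.card_le_card_of_injOn f (fun w _ => Finset.mem_coe.2 (Finset.mem_univ (f w)))
    fun w hw w' hw' e => (hP (f w)).eq_of_infinite ((hS w hw).1.trans (hS w' hw').1.symm) (hf w hw)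
      (e ▸ hf w' hw')
  simpa using this

variable {A : PDFA k} {p q : Fin A.numStates} {u v w x : Word k}

theorem infinite_of_mem_liveWords {m : ℕ} (hw : w ∈ liveWords A A.start m) :
    {x ∈ A.language | w <+: x}.Infinite := by
  obtain ⟨-, p, hp, hl⟩ := mem_liveWords.1 hw
  refine ((PDFA.live_iff_infinite.1 hl).image (f := (w ++ ·))
    (List.append_right_injective w).injOn).mono ?_
  rintro _ ⟨y, hy, rfl⟩
  exact ⟨(PDFA.accepts_append hp y).2 hy, List.prefix_append w y⟩

theorem PartitionOrderable.card_liveWords_le {t d : ℕ}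
    (h : PartitionOrderable pprDist t d A.language) (m : ℕ) :
    (liveWords A A.start m).card ≤ t :=
  h.card_le fun _ hw => ⟨(mem_liveWords.1 hw).1, infinite_of_mem_liveWords hw⟩

theorem take_mem_liveWords_of_accepts {m : ℕ} (hw : A.Accepts q w)
    (hm : m + A.numStates ≤ w.length) : w.take m ∈ liveWords A q m := by
  rw [← List.take_append_drop m w] at hw
  obtain ⟨r, hr, ha⟩ := hw.exists_run
  exact mem_liveWords.2 ⟨by simp; omega, r, hr, w.drop m, by simp; omega, ha⟩

/-- An accepted word with at least `numStates` letters is a live word followed by `numStates`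
letters, and at most `t` live words are available for each length. The extra empty prefix in the
bound covers the shorter words. -/
theorem PartitionOrderable.slender {t d : ℕ}
    (h : PartitionOrderable pprDist t d A.language) : Slender A.language := by
  classical
  have hF := List.finite_length_le (Fin k) A.numStates
  refine ⟨(t + 1) * hF.toFinset.card, fun m => ?_⟩
  have hsub : {w ∈ A.language | w.length = m} ⊆ ((Finset.image₂ (· ++ ·)
      (insert [] (liveWords A A.start (m - A.numStates))) hF.toFinset : Finset (Word k)) :
        Set (Word k)) := by
    rintro w ⟨hw, rfl⟩
    rw [Finset.mem_coe, Finset.mem_image₂]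
    by_cases hlen : w.length < A.numStates
    · exact ⟨[], by simp, w, by simpa using hlen.le, by simp⟩
    · exact ⟨_, Finset.mem_insert_of_mem (take_mem_liveWords_of_accepts hw (by omega)),
        w.drop (w.length - A.numStates), by simp; omega, List.take_append_drop _ _⟩
  refine (Set.encard_le_encard hsub).trans ?_
  rw [Set.encard_coe_eq_coe_finsetCard]
  norm_cast
  refine (Finset.card_image₂_le _ _ _).trans ?_
  gcongr
  exact (Finset.card_insert_le _ _).trans (by have := h.card_liveWords_le (m - A.numStates); omega)

-- If no word of length `numStates` is live, all that remains to be seen is that a nonempty language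
-- needs a part.
open StackProgram in
theorem PartitionOrderable.partCount_le {t d : ℕ}
    (h : PartitionOrderable pprDist t d A.language) : partCount A ≤ t := by
  rw [partCount]
  split_ifs
  · rcases Nat.eq_zero_or_pos t with rfl | ht
    · by_contra hcon
      obtain ⟨w, hw⟩ := (reachCount_ne_zero (A := A) (q := A.start)).1 (by omega)
      obtain ⟨P, hP, -⟩ := h
      have : w ∈ A.language := hw
      rw [hP] at this
      obtain ⟨i, -⟩ := Set.mem_iUnion.1 this
      exact i.elim0
    · rw [reachCount]
      split_ifs <;> omega
  · rw [← card_liveWords]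
    exact h.card_liveWords_le _

/-! ### Enumerating by grades -/

section grades
variable {β : Type} (Z : ℕ → List β)

/-- The elements of the lists `Z p` for `p < m`, paired with `p`. -/
def gradeList (m : ℕ) : List (ℕ × β) := (List.range m).flatMap fun p => (Z p).map fun z => (p, z)

theorem mem_gradeList {m : ℕ} {x : ℕ × β} : x ∈ gradeList Z m ↔ x.1 < m ∧ x.2 ∈ Z x.1 := by
  obtain ⟨p, z⟩ := x
  simp [gradeList]

theorem gradeList_succ (m : ℕ) :
    gradeList Z (m + 1) = gradeList Z m ++ (Z m).map fun z => (m, z) := by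
  simp [gradeList, List.range_succ]

theorem gradeList_add (m j : ℕ) : gradeList Z (m + j) = gradeList Z m ++
    (List.range j).flatMap fun p => (Z (m + p)).map fun z => (m + p, z) := by
  simp [gradeList, List.range_add, List.flatMap_map]

theorem gradeList_prefix {m m' : ℕ} (h : m ≤ m') : gradeList Z m <+: gradeList Z m' := by
  obtain ⟨j, rfl⟩ := Nat.exists_eq_add_of_le h
  rw [gradeList_add]
  exact List.prefix_append _ _

theorem nodup_gradeList (hZ : ∀ p, (Z p).Nodup) (m : ℕ) : (gradeList Z m).Nodup := by
  rw [gradeList, List.nodup_flatMap]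
  refine ⟨fun p _ => (hZ p).map fun a b h => (Prod.ext_iff.1 h).2,
    List.nodup_range.imp fun {a b} hab => ?_⟩
  intro x h1 h2
  obtain ⟨y, -, rfl⟩ := List.mem_map.1 h1
  obtain ⟨z, -, e⟩ := List.mem_map.1 h2
  exact hab (Prod.ext_iff.1 e).1.symm

theorem pairwise_gradeList (m : ℕ) : (gradeList Z m).Pairwise fun x y => x.1 ≤ y.1 := by
  induction m with
  | zero => exact List.Pairwise.nil
  | succ m ih =>
    rw [gradeList_succ, List.pairwise_append]
    refine ⟨ih, ?_, ?_⟩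
    · rw [List.pairwise_map]
      exact List.pairwise_of_forall fun _ _ => le_rfl
    · intro x hx y hy
      obtain ⟨z, -, rfl⟩ := List.mem_map.1 hy
      exact ((mem_gradeList Z).1 hx).1.le

theorem exists_lt_length_gradeList (h : ∀ m, ∃ p, m ≤ p ∧ Z p ≠ []) (i : ℕ) :
    ∃ m, i < (gradeList Z m).length := by
  induction i with
  | zero =>
    obtain ⟨p, -, hp⟩ := h 0
    refine ⟨p + 1, ?_⟩
    have := List.length_pos_iff.2 hp
    simp [gradeList_succ]
    omega
  | succ i ih =>
    obtain ⟨m, hm⟩ := ih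
    obtain ⟨p, hp, hne⟩ := h m
    refine ⟨p + 1, ?_⟩
    have := List.length_pos_iff.2 hne
    have := (gradeList_prefix Z hp).length_le
    simp [gradeList_succ]
    omega

/-- If infinitely many lists are nonempty, then all the elements can be enumerated by
nondecreasing grades. -/
theorem exists_gradeSeq (h : ∀ m, ∃ p, m ≤ p ∧ Z p ≠ []) :
    ∃ s : ℕ → ℕ × β, ∀ m i, ∀ hi : i < (gradeList Z m).length, s i = (gradeList Z m)[i] := by
  choose f hf using exists_lt_length_gradeList Z h
  -- The choice of `f i` is immaterial, as these lists are prefixes of one another.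
  refine ⟨fun i => (gradeList Z (f i))[i]'(hf i), fun m i hi => ?_⟩
  rcases le_total m (f i) with hle | hle
  · exact ((gradeList_prefix Z hle).getElem hi).symm
  · exact (gradeList_prefix Z hle).getElem (hf i)

variable {Z} {s : ℕ → ℕ × β} (h : ∀ m, ∃ p, m ≤ p ∧ Z p ≠ [])
  (hs : ∀ m i, ∀ hi : i < (gradeList Z m).length, s i = (gradeList Z m)[i])
include h hs

theorem gradeSeq_mem (i : ℕ) : (s i).2 ∈ Z (s i).1 := by
  obtain ⟨m, hm⟩ := exists_lt_length_gradeList Z h i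
  have := List.getElem_mem hm
  rw [← hs m i hm] at this
  exact ((mem_gradeList Z).1 this).2

omit h in
theorem exists_gradeSeq_eq {x : ℕ × β} (hx : x.2 ∈ Z x.1) : ∃ i, s i = x := by
  have : x ∈ gradeList Z (x.1 + 1) := (mem_gradeList Z).2 ⟨Nat.lt_succ_self _, hx⟩
  obtain ⟨i, hi, e⟩ := List.mem_iff_getElem.1 this
  exact ⟨i, (hs _ i hi).trans e⟩

theorem gradeSeq_injective (hZ : ∀ p, (Z p).Nodup) : Function.Injective s := by
  intro i j hij
  obtain ⟨m, hm⟩ := exists_lt_length_gradeList Z h (max i j)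
  rw [hs m i (by omega), hs m j (by omega)] at hij
  exact (nodup_gradeList Z hZ m).getElem_inj_iff.1 hij

theorem gradeSeq_mono {i j : ℕ} (hij : i ≤ j) : (s i).1 ≤ (s j).1 := by
  rcases hij.eq_or_lt with rfl | hij
  · exact le_rfl
  obtain ⟨m, hm⟩ := exists_lt_length_gradeList Z h j
  rw [hs m i (by omega), hs m j hm]
  exact List.pairwise_iff_getElem.1 (pairwise_gradeList Z m) _ _ _ _ hij

/-- No grade is skipped. -/
theorem gradeSeq_succ_le {i p : ℕ} (hp : (s i).1 < p) (hne : Z p ≠ []) : (s (i + 1)).1 ≤ p := by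
  obtain ⟨z, hz⟩ := List.exists_mem_of_ne_nil _ hne
  obtain ⟨j, hj⟩ := exists_gradeSeq_eq hs (x := (p, z)) hz
  by_contra hcon
  rcases Nat.lt_or_ge j (i + 1) with hlt | hge
  · have := gradeSeq_mono h hs (show j ≤ i by omega)
    rw [hj] at this
    omega
  · have := gradeSeq_mono h hs hge
    rw [hj] at this
    omega

end grades

/-! ### Orderable languages -/

theorem Orderable.mono {δ : Word k → Word k → ℕ} {d d' : ℕ} {L : Set (Word k)}
    (h : Orderable δ d L) (hd : d ≤ d') : Orderable δ d' L := by
  obtain ⟨N, s, h1, h2, h3⟩ := h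
  exact ⟨N, s, h1, h2, fun i hi => (h3 i hi).trans hd⟩

/-- Any listing will do: rewriting a word completely costs at most twice the greatest length. -/
theorem Set.Finite.orderable {L : Set (Word k)} (h : L.Finite) :
    ∃ d, Orderable pprDist d L := by
  obtain ⟨B, hB⟩ := (h.image List.length).bddAbove
  have hB' : ∀ w ∈ L, w.length ≤ B := fun w hw => hB (Set.mem_image_of_mem _ hw)
  have hmem : ∀ i, ∀ hi : i < h.toFinset.toList.length, h.toFinset.toList[i] ∈ L := fun i hi => by
    exact h.mem_toFinset.1 (Finset.mem_toList.1 (List.getElem_mem hi))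
  have hnd := h.toFinset.nodup_toList
  set l := h.toFinset.toList with hl
  refine ⟨B + B, l.length, fun i => l.getD i [], ?_, ?_, ?_⟩
  · intro i j hi hj e
    have hi' : i < l.length := by exact_mod_cast hi
    have hj' : j < l.length := by exact_mod_cast hj
    simp only [List.getD_eq_getElem _ _ hi', List.getD_eq_getElem _ _ hj'] at e
    exact hnd.getElem_inj_iff.1 e
  · ext w
    constructor
    · intro hw
      have : w ∈ l := by simpa [hl] using hw
      obtain ⟨i, hi, e⟩ := List.mem_iff_getElem.1 this
      exact ⟨i, by exact_mod_cast hi, by simp only [List.getD_eq_getElem _ _ hi, e]⟩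
    · rintro ⟨i, hi, rfl⟩
      have hi' : i < l.length := by exact_mod_cast hi
      simp only [List.getD_eq_getElem _ _ hi']
      exact hmem i hi'
  · intro i hi
    have hi' : i + 1 < l.length := by exact_mod_cast hi
    simp only [List.getD_eq_getElem _ _ hi', List.getD_eq_getElem _ _ (show i < l.length by omega)]
    have h1 := hB' _ (hmem _ hi')
    have h2 := hB' _ (hmem i (by omega))
    have h3 := pprDist_append_le [] l[i] l[i + 1]
    simp only [List.nil_append] at h3
    omega

/-- A language whose words are close to a chain of words is orderable, if there are no large
gaps. -/
theorem orderable_of_chain {M : Set (Word k)} {g : Word k → ℕ} {c : ℕ → Word k} {D : ℕ}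
    (hc : ∀ {p p'}, p ≤ p' → c p <+: c p' ∧ (c p').length ≤ (c p).length + (p' - p) + D)
    (hM : ∀ w ∈ M, c (g w) <+: w ∧ w.length ≤ (c (g w)).length + D)
    (hgap : ∀ p, ∃ w ∈ M, p < g w ∧ g w ≤ p + D) : Orderable pprDist (4 * D) M := by
  have hfin : ∀ p, {w ∈ M | g w = p}.Finite := fun p =>
    (List.finite_length_le (Fin k) ((c p).length + D)).subset fun w hw => by
      have := (hM w hw.1).2
      rwa [hw.2] at this
  set Z : ℕ → List (Word k) := fun p => (hfin p).toFinset.toList with hZ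
  have hmem : ∀ {w p}, w ∈ Z p ↔ w ∈ M ∧ g w = p := by simp [hZ]
  have hne : ∀ p, ∃ p', p < p' ∧ p' ≤ p + D ∧ Z p' ≠ [] := fun p => by
    obtain ⟨w, hw, h1, h2⟩ := hgap p
    exact ⟨g w, h1, h2, List.ne_nil_of_mem (hmem.2 ⟨hw, rfl⟩)⟩
  have h : ∀ m, ∃ p, m ≤ p ∧ Z p ≠ [] := fun m => by
    obtain ⟨p, h1, -, h2⟩ := hne m
    exact ⟨p, h1.le, h2⟩
  obtain ⟨s, hs⟩ := exists_gradeSeq Z h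
  have hsM : ∀ i, (s i).2 ∈ M ∧ g (s i).2 = (s i).1 := fun i => hmem.1 (gradeSeq_mem h hs i)
  refine ⟨⊤, fun i => (s i).2, ?_, ?_, ?_⟩
  · intro i j _ _ e
    refine gradeSeq_injective h hs (fun p => (hfin p).toFinset.nodup_toList) (Prod.ext ?_ e)
    rw [← (hsM i).2, ← (hsM j).2]
    exact congrArg g e
  · ext w
    constructor
    · intro hw
      obtain ⟨i, hi⟩ := exists_gradeSeq_eq hs (x := (g w, w)) (hmem.2 ⟨hw, rfl⟩)
      exact ⟨i, ENat.natCast_lt_top i, by simp only [hi]⟩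
    · rintro ⟨i, -, rfl⟩
      exact (hsM i).1
  -- Let the grades be `p` and `p' ≤ p + D`. At most `D` letters are removed to get back to the
  -- chain; then at most `(p' - p) + D` are appended along the chain and `D` beyond it. This makes
  -- `4 * D`.
  · intro i _
    obtain ⟨h1, h2⟩ := hM _ (hsM i).1
    obtain ⟨h3, h4⟩ := hM _ (hsM (i + 1)).1
    rw [(hsM _).2] at h1 h2 h3 h4
    obtain ⟨h5, h6⟩ := hc (gradeSeq_mono h hs (show i ≤ i + 1 by omega))
    obtain ⟨p, hp, hp', hpne⟩ := hne (s i).1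
    have h7 := gradeSeq_succ_le h hs hp hpne
    obtain ⟨x, hx⟩ := h1
    obtain ⟨y, hy⟩ := h5.trans h3
    have h8 := pprDist_append_le (c (s i).1) x y
    rw [hx, hy] at h8
    have h9 := congrArg List.length hx
    have h10 := congrArg List.length hy
    simp only [List.length_append] at h9 h10
    simp only
    omega

/-! ### The spine of a state with one live word of each length -/

open Classical in
/-- A live word of length `m`, if there is one. -/
noncomputable def spine (A : PDFA k) (q : Fin A.numStates) (m : ℕ) : Word k :=
  if h : (liveWords A q m).Nonempty then h.choose else []

/-- The length of the longest prefix that lies on the spine. -/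
noncomputable def depth (A : PDFA k) (q : Fin A.numStates) (w : Word k) : ℕ :=
  open Classical in Nat.findGreatest (fun m => spine A q m <+: w) w.length

section spine
variable (hq : ∀ m, (liveWords A q m).card = 1)
include hq

theorem mem_liveWords_iff_eq_spine {m : ℕ} : w ∈ liveWords A q m ↔ w = spine A q m := by
  have hne : (liveWords A q m).Nonempty := Finset.card_pos.1 (by rw [hq m]; exact one_pos)
  have hs : spine A q m ∈ liveWords A q m := by
    rw [spine, dif_pos hne]
    exact hne.choose_spec
  exact ⟨fun hw => Finset.card_le_one.1 (hq m).le _ hw _ hs, fun hw => hw ▸ hs⟩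

theorem spine_mem (m : ℕ) : spine A q m ∈ liveWords A q m :=
  (mem_liveWords_iff_eq_spine hq).2 rfl

theorem length_spine (m : ℕ) : (spine A q m).length = m := (mem_liveWords.1 (spine_mem hq m)).1

theorem exists_run_spine (m : ℕ) : ∃ p, A.run q (spine A q m) = some p ∧ A.Live p :=
  (mem_liveWords.1 (spine_mem hq m)).2

theorem spine_zero : spine A q 0 = [] := List.length_eq_zero_iff.1 (length_spine hq 0)

theorem take_spine {m j : ℕ} (h : j ≤ m) : (spine A q m).take j = spine A q j :=
  (mem_liveWords_iff_eq_spine hq).1 (take_mem_liveWords (spine_mem hq m) h)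

theorem spine_prefix {m j : ℕ} (h : j ≤ m) : spine A q j <+: spine A q m := by
  rw [← take_spine hq h]
  exact List.take_prefix _ _

theorem spine_depth_prefix (w : Word k) : spine A q (depth A q w) <+: w := by
  classical
  unfold depth
  exact Nat.findGreatest_spec (P := fun m => spine A q m <+: w) (Nat.zero_le _)
    (by rw [spine_zero hq]; exact List.nil_prefix)

theorem le_depth {m : ℕ} (h : spine A q m <+: w) : m ≤ depth A q w := by
  classical
  unfold depth
  exact Nat.le_findGreatest (by have := h.length_le; rwa [length_spine hq] at this) h

theorem depth_le_length (w : Word k) : depth A q w ≤ w.length := by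
  have := (spine_depth_prefix hq w).length_le
  rwa [length_spine hq] at this

/-- A prefix of an accepted word is live if at least `numStates` letters follow it, and then it lies
on the spine. For a longer word this would apply to the prefix of length `depth + 1`, against
maximality. -/
theorem length_le_depth_add (hw : A.Accepts q w) : w.length ≤ depth A q w + A.numStates := by
  by_contra hcon
  have h1 := take_mem_liveWords_of_accepts (m := depth A q w + 1) hw (by omega)
  rw [mem_liveWords_iff_eq_spine hq] at h1
  have := le_depth hq (h1 ▸ List.take_prefix (depth A q w + 1) w)
  omega

theorem exists_accepts_spine (m : ℕ) :
    ∃ v, v.length < A.numStates ∧ A.Accepts q (spine A q m ++ v) := by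
  obtain ⟨p, hp, u, -, hu⟩ := exists_run_spine hq m
  obtain ⟨v, hv, hv'⟩ := hu.exists_short
  exact ⟨v, hv, (PDFA.accepts_append hp v).2 hv'⟩

end spine

/-! ### Upper bound for the number of parts -/

/-- The words of a slender language that extend a live word, and finitely many other words, form
an orderable language. -/
theorem orderable_of_prefix {M : Set (Word k)} (hx : A.run A.start x = some p)
    (hp : ∀ m, (liveWords A p m).card = 1) (hxl : x.length = A.numStates)
    (hM : ∀ w ∈ M, A.Accepts A.start w ∧ (x <+: w ∨ w.length ≤ 2 * A.numStates))
    (hM' : ∀ w, A.Accepts A.start w → x <+: w → w ∈ M) :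
    ∃ d, Orderable pprDist d M := by
  classical
  -- Grade 0 is reserved for the words that do not extend `x`; they hang off the empty word and have
  -- length at most `2 * numStates`. The depths on the spine of `p` are therefore shifted by one.
  set c : ℕ → Word k := fun m => Nat.casesOn m [] fun j => x ++ spine A p j with hc
  set g : Word k → ℕ := fun w =>
    if x <+: w then depth A p (w.drop x.length) + 1 else 0 with hg
  refine ⟨_, orderable_of_chain (g := g) (c := c) (D := 2 * A.numStates) ?_ ?_ ?_⟩
  · intro m m' hm
    rcases m with _ | m
    · refine ⟨List.nil_prefix, ?_⟩
      rcases m' with _ | m'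
      · simp [hc]
      · simp [hc, length_spine hp]
        omega
    · rcases m' with _ | m'
      · omega
      · refine ⟨List.prefix_append_right_inj x |>.2 (spine_prefix hp (by omega)), ?_⟩
        simp [hc, length_spine hp]
        omega
  · intro w hw
    obtain ⟨ha, hor⟩ := hM w hw
    by_cases hxw : x <+: w
    · obtain ⟨y, rfl⟩ := hxw
      have h1 := spine_depth_prefix hp y
      have h2 := length_le_depth_add hp ((PDFA.accepts_append hx y).1 ha)
      have e : g (x ++ y) = depth A p y + 1 := by simp [hg]
      rw [e]
      refine ⟨(List.prefix_append_right_inj x).2 h1, ?_⟩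
      simp [hc, length_spine hp]
      omega
    · have e : g w = 0 := by simp [hg, hxw]
      rw [e]
      exact ⟨List.nil_prefix, by simpa [hc] using hor.resolve_left hxw⟩
  · intro m
    obtain ⟨v, hv, ha⟩ := exists_accepts_spine hp m
    have e : g (x ++ (spine A p m ++ v)) = depth A p (spine A p m ++ v) + 1 := by simp [hg]
    refine ⟨x ++ (spine A p m ++ v), hM' _ ((PDFA.accepts_append hx _).2 ha)
      (List.prefix_append _ _), ?_⟩
    rw [e]
    have h1 := le_depth hp (List.prefix_append (spine A p m) v)
    have h2 := depth_le_length hp (spine A p m ++ v)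
    rw [List.length_append, length_spine hp] at h2
    omega

-- Each live word of length `numStates` gets the part of its accepted extensions. The other accepted
-- words are shorter than `2 * numStates` and may join any part, here that of index 0. Without such
-- live words the language is finite, and one part suffices, or none if it is empty.
open StackProgram in
theorem Slender.partitionOrderable (h : Slender A.language) :
    ∃ d, PartitionOrderable pprDist (partCount A) d A.language := by
  classical
  rw [partCount]
  split_ifs with h0
  · rw [← card_liveWords] at h0
    have hfin : A.language.Finite := by
      by_contra hinf
      have := (PDFA.live_iff_infinite (q := A.start)).2 hinf
      have := this.card_liveWords_pos A.numStates
      omega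
    obtain ⟨d, hd⟩ := Set.Finite.orderable hfin
    refine ⟨d, ?_⟩
    rcases Nat.eq_zero_or_pos (reachCount A A.start) with hr | hr
    · rw [hr]
      have : A.language = ∅ := by
        by_contra hne
        obtain ⟨w, hw⟩ := Set.nonempty_iff_ne_empty.2 hne
        exact reachCount_ne_zero.2 ⟨w, hw⟩ hr
      exact ⟨fun _ => ∅, by simp [this], fun i => i.elim0, fun i => i.elim0⟩
    · have : reachCount A A.start = 1 := by
        rw [reachCount] at hr ⊢
        split_ifs at hr ⊢ <;> omega
      rw [this]
      exact ⟨fun _ => A.language, (Set.iUnion_const _).symm,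
        fun i j hij => absurd (Subsingleton.elim i j) hij, fun _ => hd⟩
  · rw [← card_liveWords] at h0 ⊢
    set S := liveWords A A.start A.numStates with hS
    have : NeZero S.card := ⟨h0⟩
    set e := S.equivFin with he
    set idx : Word k → Fin S.card := fun w =>
      if hw : w.take A.numStates ∈ S then e ⟨_, hw⟩ else 0 with hidx
    have key : ∀ i, ∃ d, Orderable pprDist d {w ∈ A.language | idx w = i} := by
      intro i
      rcases hx : e.symm i with ⟨x, hxS⟩
      obtain ⟨hxl, p, hp, hlive⟩ := mem_liveWords.1 hxS
      refine orderable_of_prefix hp (h.card_liveWords_eq_one hp hxl.ge hlive) hxl ?_ ?_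
      · rintro w ⟨hw, hwi⟩
        refine ⟨hw, ?_⟩
        by_cases hwS : w.take A.numStates ∈ S
        · left
          rw [hidx] at hwi
          simp only [dif_pos hwS] at hwi
          rw [← hwi, Equiv.symm_apply_apply] at hx
          have hx' : w.take A.numStates = x := congrArg Subtype.val hx
          rw [← hx']
          exact List.take_prefix _ _
        · right
          by_contra hlen
          exact hwS (take_mem_liveWords_of_accepts hw (by omega))
      · intro w hw hxw
        refine ⟨hw, ?_⟩
        have ht : w.take A.numStates = x := by
          rw [← hxl]
          exact (List.prefix_iff_eq_take.1 hxw).symm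
        rw [hidx]
        simp only [ht, dif_pos hxS]
        rw [← hx, Equiv.apply_symm_apply]
    choose d hd using key
    refine ⟨Finset.univ.sup d, fun i => {w ∈ A.language | idx w = i}, ?_, ?_, fun i =>
      (hd i).mono (Finset.le_sup (Finset.mem_univ i))⟩
    · ext w
      simp
    · intro i j hij
      refine Set.disjoint_left.2 ?_
      rintro w ⟨-, rfl⟩ ⟨-, h2⟩
      exact hij h2

open StackProgram in
theorem Slender.isLeast_partCount (h : Slender A.language) :
    IsLeast {t : ℕ | ∃ d : ℕ, PartitionOrderable pprDist t d A.language} (partCount A) :=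
  ⟨h.partitionOrderable, fun _ ⟨_, ht⟩ => ht.partCount_le⟩

end PushPopRight

/-! ### The enumeration algorithm and the case of a finite language -/

namespace PushPopRight

variable {k : ℕ}

/-! ### The enumeration algorithm, relative to a membership test -/

/-- All words of length `m`. -/
def wordsOfLength (k : ℕ) : ℕ → List (Word k)
  | 0 => [[]]
  | m + 1 => (wordsOfLength k m).flatMap fun w => (List.finRange k).map fun a => a :: w

theorem mem_wordsOfLength {m : ℕ} {w : Word k} : w ∈ wordsOfLength k m ↔ w.length = m := by
  induction m generalizing w with
  | zero => simp [wordsOfLength]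
  | succ m ih =>
    rcases w with _ | ⟨a, w⟩
    · simp [wordsOfLength]
    · simp [wordsOfLength, ih]

theorem nodup_wordsOfLength (m : ℕ) : (wordsOfLength k m).Nodup := by
  induction m with
  | zero => simp [wordsOfLength]
  | succ m ih =>
    rw [wordsOfLength, List.nodup_flatMap]
    refine ⟨fun w _ => (List.nodup_finRange k).map fun a b h => (List.cons.inj h).1,
      ih.imp fun {w w'} hne => ?_⟩
    intro x h1 h2
    obtain ⟨a, -, rfl⟩ := List.mem_map.1 h1
    obtain ⟨b, -, e⟩ := List.mem_map.1 h2
    exact hne (List.cons.inj e).2.symm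

section algorithm
variable (f : Word k → Bool) (n : ℕ)

/-- Does `w` have an extension by a word of length in `[n, 2 n)` that satisfies `f`? -/
def extendable (w : Word k) : Bool :=
  ((List.range n).flatMap fun j => wordsOfLength k (n + j)).any fun v => f (w ++ v)

/-- The first extendable word of length `m`. -/
def branch (m : ℕ) : Word k := (((wordsOfLength k m).filter (extendable f n)).head?).getD []

/-- The words `z` of length at most `n` such that `branch p ++ z` satisfies `f` and leaves the
branch after the prefix `branch p`. -/
def branchEnds (p : ℕ) : List (Word k) :=
  ((List.range (n + 1)).flatMap (wordsOfLength k)).filter fun z =>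
    f (branch f n p ++ z) && (z.isEmpty || !extendable f n (branch f n p ++ z.take 1))

/-- The script from `branch x.1 ++ x.2` to `branch y.1 ++ y.2`. -/
def itemScript (x y : ℕ × Word k) : Script k :=
  replaceEnd x.2.length ((branch f n y.1).drop x.1 ++ y.2)

/-- The scripts between consecutive elements of a list. -/
def itemScripts (l : List (ℕ × Word k)) : List (Script k) :=
  (List.range l.length).map fun i =>
    itemScript f n (((0, []) :: l).getD i (0, [])) (l.getD i (0, []))

/-- The numbers of grades covered by the preperiod and by the preperiod with one period. -/
def gradeBounds : ℕ × ℕ :=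
  if extendable f n [] then (n + n.factorial, n + n.factorial + n.factorial) else (1, 1)

/-- The preperiod and the period of the sequence of scripts. -/
def enumerationScripts : List (Script k) × List (Script k) :=
  ((itemScripts f n (gradeList (branchEnds f n) (gradeBounds f n).2)).take
      (gradeList (branchEnds f n) (gradeBounds f n).1).length,
    (itemScripts f n (gradeList (branchEnds f n) (gradeBounds f n).2)).drop
      (gradeList (branchEnds f n) (gradeBounds f n).1).length)

variable {f n}

theorem extendable_iff {w : Word k} :
    extendable f n w = true ↔ ∃ v : Word k, n ≤ v.length ∧ v.length < n + n ∧ f (w ++ v) = true := by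
  simp only [extendable, List.any_eq_true, List.mem_flatMap, List.mem_range, mem_wordsOfLength]
  constructor
  · rintro ⟨v, ⟨j, hj, hv⟩, h⟩
    exact ⟨v, by omega, by omega, h⟩
  · rintro ⟨v, h1, h2, h⟩
    exact ⟨v, ⟨v.length - n, by omega, by omega⟩, h⟩

theorem mem_branchEnds {p : ℕ} {z : Word k} : z ∈ branchEnds f n p ↔ z.length ≤ n ∧
    f (branch f n p ++ z) = true ∧
      (z = [] ∨ ¬ extendable f n (branch f n p ++ z.take 1) = true) := by
  simp only [branchEnds, List.mem_filter, List.mem_flatMap, List.mem_range, mem_wordsOfLength,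
    Bool.and_eq_true, Bool.or_eq_true, List.isEmpty_iff, Bool.not_eq_true', Bool.not_eq_true]
  constructor
  · rintro ⟨⟨j, hj, hv⟩, h⟩
    exact ⟨by omega, h⟩
  · rintro ⟨h1, h⟩
    exact ⟨⟨_, by omega, rfl⟩, h⟩

theorem nodup_branchEnds (p : ℕ) : (branchEnds f n p).Nodup := by
  refine List.Nodup.filter _ ?_
  rw [List.nodup_flatMap]
  refine ⟨fun m _ => nodup_wordsOfLength m, List.nodup_range.imp fun {a b} hab => ?_⟩
  intro x h1 h2
  exact hab ((mem_wordsOfLength.1 h1).symm.trans (mem_wordsOfLength.1 h2))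

/-- The `i`-th script along the sequence `s`, starting at the item `(0, [])`. -/
def seqScript (f : Word k → Bool) (n : ℕ) (s : ℕ → ℕ × Word k) : ℕ → Script k
  | 0 => itemScript f n (0, []) (s 0)
  | i + 1 => itemScript f n (s i) (s (i + 1))

theorem length_itemScripts (l : List (ℕ × Word k)) : (itemScripts f n l).length = l.length := by
  simp [itemScripts]

theorem getElem_itemScripts {s : ℕ → ℕ × Word k} {l : List (ℕ × Word k)}
    (h : ∀ i, ∀ hi : i < l.length, s i = l[i]) {i : ℕ} (hi : i < (itemScripts f n l).length) :
    (itemScripts f n l)[i] = seqScript f n s i := by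
  have hi' : i < l.length := by rwa [length_itemScripts] at hi
  rcases i with _ | i
  · simp [itemScripts, seqScript, h 0 hi', List.getElem?_eq_getElem hi']
  · simp only [itemScripts, List.getElem_map, List.getElem_range, List.getD_cons_succ, seqScript]
    rw [h (i + 1) hi', h i (by omega), List.getD_eq_getElem _ _ hi',
      List.getD_eq_getElem _ _ (show i < l.length by omega)]

/-- Each script removes the end hanging off the branch, climbs the branch to the next grade and
appends the next end. By `hb` the branch words are prefixes of one another, so the climb arrives at
the right word. -/
theorem wordAfter_succ_eq {s : ℕ → ℕ × Word k} {σ : ℕ → Option (Script k)} {i : ℕ}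
    (hσ : ∀ j ≤ i, σ j = some (seqScript f n s j))
    (hmono : ∀ j < i, (s j).1 ≤ (s (j + 1)).1)
    (hb : ∀ p m, p ≤ m → branch f n p ++ (branch f n m).drop p = branch f n m) :
    wordAfter σ (i + 1) = some (branch f n (s i).1 ++ (s i).2) := by
  induction i with
  | zero =>
    rw [wordAfter, hσ 0 le_rfl]
    simp only [wordAfter, Option.bind_some, seqScript, itemScript]
    simpa using apply_replaceEnd [] [] (branch f n (s 0).1 ++ (s 0).2)
  | succ i ih =>
    rw [wordAfter, ih (fun j hj => hσ j (by omega)) (fun j hj => hmono j (by omega)),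
      hσ (i + 1) le_rfl]
    simp only [Option.bind_some, seqScript, itemScript]
    rw [apply_replaceEnd, ← List.append_assoc, hb _ _ (hmono i (by omega))]

end algorithm

section finite
variable {A : PDFA k} {f : Word k → Bool}

/-- Cutting a loop of at most `numStates` letters out of a word of length at least `2 * numStates`
leaves at least `numStates` letters. So the finitely many words tried by `extendable` decide
liveness. -/
theorem PDFA.Live.exists_bounded {q : Fin A.numStates} (h : A.Live q) :
    ∃ w, A.numStates ≤ w.length ∧ w.length < A.numStates + A.numStates ∧ A.Accepts q w := by
  obtain ⟨w, hw, ha⟩ := h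
  induction hn : w.length using Nat.strong_induction_on generalizing w with
  | _ n ih =>
    by_cases hw' : w.length < A.numStates + A.numStates
    · exact ⟨w, hw, hw', ha⟩
    · obtain ⟨p, hp, hacc⟩ := ha
      obtain ⟨a, b, c, r, rfl, hb, hbl, h1, h2, h3⟩ := PDFA.exists_loop hp hw
      have hb' := List.length_pos_iff.2 hb
      simp only [List.length_append] at hw' hn
      refine ih (a ++ c).length ?_ (w := a ++ c) ?_ ⟨p, ?_, hacc⟩ rfl
      · rw [← hn]; simp; omega
      · simp; omega
      · rw [PDFA.run_append_of_eq h1, h3]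

variable (hf : ∀ w, f w = true ↔ A.Accepts A.start w)
include hf

theorem extendable_iff_live {w : Word k} :
    extendable f A.numStates w = true ↔ ∃ p, A.run A.start w = some p ∧ A.Live p := by
  rw [extendable_iff]
  constructor
  · rintro ⟨v, h1, -, h⟩
    obtain ⟨p, hp, ha⟩ := ((hf _).1 h).exists_run
    exact ⟨p, hp, v, h1, ha⟩
  · rintro ⟨p, hp, hl⟩
    obtain ⟨v, h1, h2, ha⟩ := hl.exists_bounded
    exact ⟨v, h1, h2, (hf _).2 ((PDFA.accepts_append hp v).2 ha)⟩

/-- Without live words the branch is empty and all accepted words are ends of grade 0, of length at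
most `numStates`; a step can afford to rewrite the whole word. -/
theorem enumerates_of_not_live (h : ¬ A.Live A.start) :
    Enumerates (ultimatelyPeriodic (enumerationScripts f A.numStates).1
      (enumerationScripts f A.numStates).2) A.language ∧
    ∀ s ∈ (enumerationScripts f A.numStates).1 ++ (enumerationScripts f A.numStates).2,
      s.length ≤ 2 * A.numStates := by
  set n := A.numStates with hn
  have hext : ∀ w, ¬ extendable f n w = true := by
    intro w hw
    obtain ⟨p, hp, hl⟩ := (extendable_iff_live hf).1 hw
    exact h (hl.of_run hp)
  have hb : ∀ m, branch f n m = [] := by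
    intro m
    have : (wordsOfLength k m).filter (extendable f n) = [] :=
      List.filter_eq_nil_iff.2 fun w _ => hext w
    rw [branch, this]
    rfl
  -- Both bounds agree, so the period is empty.
  have hg : gradeBounds f n = (1, 1) := if_neg (hext _)
  set l := gradeList (branchEnds f n) 1 with hl
  have e1 : (enumerationScripts f n).1 = itemScripts f n l := by
    simp only [enumerationScripts, hg, ← hl]
    rw [← length_itemScripts (f := f) (n := n) l, List.take_length]
  have e2 : (enumerationScripts f n).2 = [] := by
    simp only [enumerationScripts, hg, ← hl]
    rw [← length_itemScripts (f := f) (n := n) l, List.drop_length]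
  rw [e1, e2]
  have hmem : ∀ x, x ∈ l ↔ x.1 = 0 ∧ x.2 ∈ A.language := by
    rintro ⟨p, z⟩
    rw [hl, mem_gradeList, mem_branchEnds, Nat.lt_one_iff, hb, List.nil_append, hf,
      PDFA.mem_language]
    refine and_congr_right fun _ => ⟨fun h => h.2.1, fun ha => ⟨?_, ha, Or.inr (hext _)⟩⟩
    by_contra hz
    exact h ⟨z, (not_le.1 hz).le, ha⟩
  have hlen : ∀ x ∈ l, x.2.length ≤ n := fun x hx => (mem_branchEnds.1 ((mem_gradeList _).1 hx).2).1
  set s : ℕ → ℕ × Word k := fun i => l.getD i (0, []) with hs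
  have hsl : ∀ i, ∀ hi : i < l.length, s i = l[i] := fun i hi => List.getD_eq_getElem _ _ hi
  have hs1 : ∀ i, (s i).1 = 0 := by
    intro i
    by_cases hi : i < l.length
    · rw [hsl i hi]
      exact ((hmem _).1 (List.getElem_mem hi)).1
    · simp only [hs]
      rw [List.getD_eq_default _ _ (by omega)]
  have hs2 : ∀ i, (s i).2.length ≤ n := by
    intro i
    by_cases hi : i < l.length
    · rw [hsl i hi]
      exact hlen _ (List.getElem_mem hi)
    · simp only [hs]
      rw [List.getD_eq_default _ _ (by omega)]
      exact Nat.zero_le _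
  have hσ : ∀ i, i < l.length → ultimatelyPeriodic (itemScripts f n l) [] i =
      some (seqScript f n s i) := by
    intro i hi
    have hi' : i < (itemScripts f n l).length := by rwa [length_itemScripts]
    rw [ultimatelyPeriodic, if_pos hi', List.getElem?_eq_getElem hi', getElem_itemScripts hsl]
  have hσ' : ∀ i, l.length ≤ i → ultimatelyPeriodic (itemScripts f n l) [] i = none := by
    intro i hi
    rw [ultimatelyPeriodic, if_neg (by rw [length_itemScripts]; omega)]
    simp
  have hword : ∀ i, i < l.length →
      wordAfter (ultimatelyPeriodic (itemScripts f n l) []) (i + 1) = some (s i).2 := by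
    intro i hi
    rw [wordAfter_succ_eq (fun j hj => hσ j (by omega)) (fun j _ => by rw [hs1, hs1])
      (fun p m _ => by simp [hb]), hb, List.nil_append]
  have hword' : ∀ i w, wordAfter (ultimatelyPeriodic (itemScripts f n l) []) (i + 1) = some w →
      i < l.length ∧ w = (s i).2 := by
    intro i w hw
    by_cases hi : i < l.length
    · rw [hword i hi] at hw
      exact ⟨hi, (Option.some.inj hw).symm⟩
    · rw [wordAfter, hσ' i (by omega)] at hw
      simp at hw
  refine ⟨⟨?_, ?_, ?_⟩, ?_⟩
  · intro i hi
    by_cases hi' : i < l.length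
    · rw [hword i hi']
      rfl
    · rw [hσ' i (by omega)] at hi
      simp at hi
  · intro i j w h1 h2
    obtain ⟨hi, rfl⟩ := hword' i w h1
    obtain ⟨hj, e⟩ := hword' j _ h2
    have e' : s i = s j := Prod.ext (by rw [hs1, hs1]) e
    rw [hsl i hi, hsl j hj] at e'
    exact (nodup_gradeList _ nodup_branchEnds 1).getElem_inj_iff.1 e'
  · intro w
    constructor
    · intro hw
      obtain ⟨i, hi, e⟩ := List.mem_iff_getElem.1 ((hmem (0, w)).2 ⟨rfl, hw⟩)
      refine ⟨i, ?_⟩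
      rw [hword i hi, hsl i hi, e]
    · rintro ⟨i, hi⟩
      obtain ⟨hil, rfl⟩ := hword' i w hi
      rw [hsl i hil]
      exact ((hmem _).1 (List.getElem_mem hil)).2
  · intro t ht
    rw [List.append_nil] at ht
    obtain ⟨i, hi, rfl⟩ := List.mem_iff_getElem.1 ht
    rw [getElem_itemScripts hsl]
    rcases i with _ | i
    · have := hs2 0
      simp [seqScript, itemScript, hb]
      omega
    · have := hs2 i
      have := hs2 (i + 1)
      simp [seqScript, itemScript, hb]
      omega

end finite

end PushPopRight

/-! ### The periodic enumeration of an infinite language -/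

namespace PushPopRight

variable {k : ℕ}

/-! ### The sequence of scripts of an infinite orderable language -/

section periodic
variable {β : Type} {Z : ℕ → List β} {s : ℕ → ℕ × β}

theorem gradeList_period_add {n P : ℕ} (hZ : ∀ p, n ≤ p → Z (p + P) = Z p) {a : ℕ} (ha : n ≤ a)
    (j : ℕ) : gradeList Z (a + P + j) = gradeList Z (a + P) ++
      ((List.range j).flatMap fun p => (Z (a + p)).map fun z => (a + p, z)).map
        fun x => (x.1 + P, x.2) := by
  rw [gradeList_add, List.map_flatMap]
  congr 1
  refine List.flatMap_congr fun p _ => ?_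
  rw [List.map_map, show a + P + p = a + p + P by omega, hZ _ (by omega)]
  rfl

theorem length_gradeList_add_length {n P : ℕ} (hZ : ∀ p, n ≤ p → Z (p + P) = Z p) :
    (gradeList Z (n + P + P)).length + (gradeList Z n).length =
      (gradeList Z (n + P)).length + (gradeList Z (n + P)).length := by
  rw [gradeList_period_add hZ le_rfl, gradeList_add Z n P]
  simp only [List.length_append, List.length_map]
  omega

/-- The lists repeat with period `P` from grade `n` on, so the listing from grade `n + P` on is the
one from grade `n` on with all grades raised by `P`. -/
theorem gradeSeq_add (h : ∀ m, ∃ p, m ≤ p ∧ Z p ≠ [])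
    (hs : ∀ m i, ∀ hi : i < (gradeList Z m).length, s i = (gradeList Z m)[i])
    {n P : ℕ} (hZ : ∀ p, n ≤ p → Z (p + P) = Z p) (i : ℕ) :
    s ((gradeList Z (n + P)).length + i) =
      ((s ((gradeList Z n).length + i)).1 + P, (s ((gradeList Z n).length + i)).2) := by
  obtain ⟨m, hm⟩ := exists_lt_length_gradeList Z h ((gradeList Z n).length + i)
  have hm' : (gradeList Z n).length + i < (gradeList Z (n + m)).length :=
    hm.trans_le (gradeList_prefix Z (by omega)).length_le
  set G := (List.range m).flatMap fun p => (Z (n + p)).map fun z => (n + p, z) with hG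
  have e1 : gradeList Z (n + m) = gradeList Z n ++ G := gradeList_add Z n m
  have e2 : gradeList Z (n + P + m) = gradeList Z (n + P) ++ G.map fun x => (x.1 + P, x.2) :=
    gradeList_period_add hZ le_rfl m
  have hi : i < G.length := by
    rw [e1, List.length_append] at hm'
    omega
  rw [hs (n + m) _ hm', hs (n + P + m) _ (by rw [e2]; simpa using hi)]
  simp only [e1, e2]
  rw [List.getElem_append_right (by omega), List.getElem_append_right (by omega)]
  simp

end periodic

theorem ultimatelyPeriodic_eq {β : Type} {σ : ℕ → β} {u v : List β} (hv : 0 < v.length)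
    (hu : ∀ i, ∀ hi : i < u.length, u[i] = σ i)
    (hv' : ∀ i, ∀ hi : i < v.length, v[i] = σ (u.length + i))
    (hσ : ∀ i, u.length ≤ i → σ (i + v.length) = σ i) (i : ℕ) :
    ultimatelyPeriodic u v i = some (σ i) := by
  rw [ultimatelyPeriodic]
  split_ifs with hi
  · rw [List.getElem?_eq_getElem hi, hu]
  · have hper : ∀ j, σ (u.length + i % v.length + j * v.length) = σ (u.length + i % v.length) := by
      intro j
      induction j with
      | zero => simp
      | succ j ih => rw [add_mul, one_mul, ← add_assoc, hσ _ (by omega), ih]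
    have hper' : ∀ i j, σ (u.length + i + j * v.length) = σ (u.length + i) := by
      intro i j
      induction j with
      | zero => simp
      | succ j ih => rw [add_mul, one_mul, ← add_assoc, hσ _ (by omega), ih]
    have hlt : (i - u.length) % v.length < v.length := Nat.mod_lt _ hv
    rw [List.getElem?_eq_getElem hlt, hv', ← hper' _ ((i - u.length) / v.length), add_assoc,
      Nat.mod_add_div']
    congr 2
    omega

section infinite
variable {A : PDFA k} {f : Word k → Bool} {q : Fin A.numStates}

/-- If the spine passes through the same state at `m` and `m'`, it continues in the same way. -/
theorem spine_shift (hq : ∀ m, (liveWords A q m).card = 1) {m m' : ℕ}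
    (h : A.run q (spine A q m) = A.run q (spine A q m')) (t : ℕ) :
    spine A q (m' + t) = spine A q m' ++ (spine A q (m + t)).drop m ∧
    A.run q (spine A q (m + t)) = A.run q (spine A q (m' + t)) := by
  have e : spine A q m ++ (spine A q (m + t)).drop m = spine A q (m + t) := by
    rw [← take_spine hq (show m ≤ m + t by omega), List.take_append_drop]
  have e2 : A.run q (spine A q m' ++ (spine A q (m + t)).drop m) = A.run q (spine A q (m + t)) := by
    conv_rhs => rw [← e]
    rw [PDFA.run_append, PDFA.run_append, h]
  obtain ⟨-, p, hp, hl⟩ := mem_liveWords.1 (spine_mem hq (m + t))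
  -- The same continuation leads to a live state after `spine A q m'` too, and live words of a given
  -- length are unique.
  have : spine A q m' ++ (spine A q (m + t)).drop m = spine A q (m' + t) :=
    (mem_liveWords_iff_eq_spine hq).1 (mem_liveWords.2
      ⟨by simp [length_spine hq], p, by rw [e2, hp], hl⟩)
  exact ⟨this.symm, by rw [← this, e2]⟩

/-- Two of the first `numStates + 1` states on the spine coincide, so from there on the states have
a period `l - j ≤ numStates`. The factorial is a multiple of it that does not depend on the spine.
-/
theorem run_spine_add_factorial (hq : ∀ m, (liveWords A q m).card = 1) {m : ℕ}
    (hm : A.numStates ≤ m) :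
    A.run q (spine A q (m + A.numStates.factorial)) = A.run q (spine A q m) := by
  obtain ⟨p, hp, -⟩ := exists_run_spine hq A.numStates
  obtain ⟨j, l, r, -, hjl, hl, h1, h2⟩ := PDFA.exists_repeat hp 0
  rw [take_spine hq (by omega)] at h1 h2
  have h3 : ∀ t, A.run q (spine A q (l + t)) = A.run q (spine A q (j + t)) := fun t =>
    (spine_shift hq (h1.trans h2.symm) t).2.symm
  have h4 : ∀ c m, j ≤ m → A.run q (spine A q (m + (l - j) * c)) = A.run q (spine A q m) := by
    intro c
    induction c with
    | zero => simp
    | succ c ih =>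
      intro m hm
      rw [mul_add, mul_one, ← add_assoc, show m + (l - j) * c + (l - j) =
        l + (m + (l - j) * c - j) by omega, h3, show j + (m + (l - j) * c - j) =
        m + (l - j) * c by omega, ih m hm]
  obtain ⟨c, hc⟩ := Nat.dvd_factorial (show 0 < l - j by omega) (show l - j ≤ A.numStates by omega)
  rw [hc]
  exact h4 c m (by omega)

variable (hf : ∀ w, f w = true ↔ A.Accepts A.start w)
  (hq : ∀ m, (liveWords A A.start m).card = 1)
include hf

theorem extendable_iff_mem_liveWords {w : Word k} :
    extendable f A.numStates w = true ↔ w ∈ liveWords A A.start w.length := by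
  rw [extendable_iff_live hf, mem_liveWords]
  simp

include hq

theorem branch_eq_spine (m : ℕ) : branch f A.numStates m = spine A A.start m := by
  have hne : (wordsOfLength k m).filter (extendable f A.numStates) ≠ [] := by
    refine List.ne_nil_of_mem (a := spine A A.start m) (List.mem_filter.2 ⟨?_, ?_⟩)
    · rw [mem_wordsOfLength, length_spine hq]
    · rw [extendable_iff_mem_liveWords hf, length_spine hq]
      exact spine_mem hq m
  rw [branch, List.head?_eq_some_head hne, Option.getD_some]
  have := List.mem_filter.1 (List.head_mem hne)
  rw [extendable_iff_mem_liveWords hf, mem_wordsOfLength.1 this.1] at this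
  exact (mem_liveWords_iff_eq_spine hq).1 this.2

/-- Since the spine is the only branch, a first letter after which the word is not extendable is one
that differs from the next letter of the spine. -/
theorem mem_branchEnds_iff {p : ℕ} {z : Word k} : z ∈ branchEnds f A.numStates p ↔
    z.length ≤ A.numStates ∧ A.Accepts A.start (spine A A.start p ++ z) ∧
      ¬ spine A A.start (p + 1) <+: spine A A.start p ++ z := by
  rw [mem_branchEnds, branch_eq_spine hf hq, hf, extendable_iff_mem_liveWords hf]
  refine and_congr_right fun _ => and_congr_right fun _ => ?_
  rcases z with _ | ⟨a, z⟩
  · simp only [true_or, true_iff, List.append_nil]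
    intro h
    have := h.length_le
    rw [length_spine hq, length_spine hq] at this
    omega
  · have e : (spine A A.start p ++ a :: z).take (p + 1) = spine A A.start p ++ [a] := by
      rw [List.take_append, length_spine hq, List.take_of_length_le (by rw [length_spine hq]; omega)]
      simp
    rw [List.prefix_iff_eq_take, length_spine hq, e]
    have hl : (spine A A.start p ++ [a]).length = p + 1 := by simp [length_spine hq]
    simp [hl, mem_liveWords_iff_eq_spine hq, eq_comm]

/-- Grade and end can thus be recovered from the word, so no word is produced twice. -/
theorem depth_of_mem_branchEnds {p : ℕ} {z : Word k} (h : z ∈ branchEnds f A.numStates p) :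
    depth A A.start (spine A A.start p ++ z) = p := by
  refine le_antisymm ?_ (le_depth hq (List.prefix_append _ _))
  by_contra hcon
  exact ((mem_branchEnds_iff hf hq).1 h).2.2 ((spine_prefix hq (by omega)).trans
    (spine_depth_prefix hq _))

theorem exists_mem_branchEnds {w : Word k} (h : A.Accepts A.start w) :
    ∃ z ∈ branchEnds f A.numStates (depth A A.start w),
      spine A A.start (depth A A.start w) ++ z = w := by
  obtain ⟨z, hz⟩ := spine_depth_prefix hq w
  refine ⟨z, (mem_branchEnds_iff hf hq).2 ⟨?_, by rwa [hz], ?_⟩, hz⟩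
  · have h1 := length_le_depth_add hq h
    have h2 := congrArg List.length hz
    rw [List.length_append, length_spine hq] at h2
    omega
  · rw [hz]
    intro hp
    have := le_depth hq hp
    omega

/-- Acceptance and extendability of a continuation are determined by the state from which it is
read. -/
theorem branchEnds_eq_of_run_eq {m m' : ℕ}
    (h : A.run A.start (spine A A.start m) = A.run A.start (spine A A.start m')) :
    branchEnds f A.numStates m = branchEnds f A.numStates m' := by
  have key : ∀ y, f (branch f A.numStates m ++ y) = f (branch f A.numStates m' ++ y) := by
    intro y
    rw [Bool.eq_iff_iff, hf, hf, branch_eq_spine hf hq, branch_eq_spine hf hq, PDFA.Accepts,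
      PDFA.Accepts, PDFA.run_append, PDFA.run_append, h]
  have key2 : ∀ y, extendable f A.numStates (branch f A.numStates m ++ y) =
      extendable f A.numStates (branch f A.numStates m' ++ y) := by
    intro y
    simp only [extendable, List.append_assoc, key]
  simp only [branchEnds, key, key2]

theorem exists_branchEnds_ne_nil (m : ℕ) : ∃ p, m ≤ p ∧ branchEnds f A.numStates p ≠ [] := by
  obtain ⟨v, -, hv⟩ := exists_accepts_spine hq m
  obtain ⟨z, hz, -⟩ := exists_mem_branchEnds hf hq hv
  exact ⟨_, le_depth hq (List.prefix_append _ _), List.ne_nil_of_mem hz⟩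

/-- Between consecutive elements of the enumeration, few letters are appended. -/
theorem length_le_of_gap {p p' : ℕ} {z : Word k} (hz : z ∈ branchEnds f A.numStates p')
    (hp : p ≤ p') (hgap : ∀ m, p < m → m < p' → branchEnds f A.numStates m = []) :
    p' - p + z.length ≤ A.numStates := by
  obtain ⟨hzl, hacc, hnp⟩ := (mem_branchEnds_iff hf hq).1 hz
  rcases hp.eq_or_lt with rfl | hlt
  · omega
  by_contra hcon
  obtain ⟨t, ht, hta⟩ := id hacc
  -- By `hcon` the accepted word has more than `p + numStates` letters, so a state occurs at two
  -- positions after `p` within the word.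
  obtain ⟨j, l, r, hj, hjl, hl, h1, h2⟩ := PDFA.exists_repeat ht (p + 1)
  set w := spine A A.start p' ++ z with hw
  have hwl : w.length = p' + z.length := by simp [hw, length_spine hq]
  by_cases hlp : l ≤ p'
  -- Repetition on the spine: the grade `j + (p' - l)` lies strictly between `p` and `p'` and has
  -- the same state as `p'`, hence the same ends, although it should have none.
  · have htake : ∀ i, i ≤ p' → w.take i = spine A A.start i := by
      intro i hi
      rw [hw, List.take_append_of_le_length (by rw [length_spine hq]; exact hi), take_spine hq hi]
    rw [htake _ (by omega)] at h1 h2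
    have h3 := (spine_shift hq (h1.trans h2.symm) (p' - l)).2
    rw [show l + (p' - l) = p' by omega] at h3
    have h4 := branchEnds_eq_of_run_eq hf hq h3
    rw [hgap _ (by omega) (by omega)] at h4
    rw [← h4] at hz
    simp at hz
  -- Repetition ending after the spine has been left: pumping shows that `w.take l` is live, hence
  -- on the spine, so `w` did not leave the spine at `p'`.
  · have hlive : w.take l ∈ liveWords A A.start l := by
      refine mem_liveWords.2 ⟨by rw [List.length_take]; omega, r, h2, ?_⟩
      set b := (w.take l).drop j with hb
      have hb' : 0 < b.length := by simp [hb]; omega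
      have hbr : A.run r b = some r := by
        rw [← PDFA.run_append_of_eq h1, hb]
        rw [show w.take j = (w.take l).take j by rw [List.take_take, min_eq_left hjl.le],
          List.take_append_drop, h2]
      refine ⟨(List.replicate A.numStates b).flatten ++ w.drop l, ?_, ?_⟩
      · simp
        nlinarith
      · rw [PDFA.accepts_append (PDFA.run_pow hbr _), ← PDFA.accepts_append h2,
          List.take_append_drop]
        exact hacc
    rw [mem_liveWords_iff_eq_spine hq] at hlive
    refine hnp ((spine_prefix hq (show p' + 1 ≤ l by omega)).trans ?_)
    rw [← hlive]
    exact List.take_prefix _ _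

theorem enumerates_of_card_liveWords_eq_one :
    Enumerates (ultimatelyPeriodic (enumerationScripts f A.numStates).1
      (enumerationScripts f A.numStates).2) A.language ∧
    ∀ s ∈ (enumerationScripts f A.numStates).1 ++ (enumerationScripts f A.numStates).2,
      s.length ≤ 2 * A.numStates := by
  set n := A.numStates with hn
  obtain ⟨P, hP⟩ : ∃ P, P = n.factorial := ⟨_, rfl⟩
  set Z := branchEnds f n with hZ
  have hPpos : 0 < P := hP ▸ Nat.factorial_pos n
  have hbr : ∀ m, branch f n m = spine A A.start m := branch_eq_spine hf hq
  have hne : ∀ m, ∃ p, m ≤ p ∧ Z p ≠ [] := exists_branchEnds_ne_nil hf hq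
  have hper : ∀ p, n ≤ p → Z (p + P) = Z p := fun p hp =>
    by
    rw [hP]
    exact branchEnds_eq_of_run_eq hf hq (run_spine_add_factorial hq hp)
  have hg : gradeBounds f n = (n + P, n + P + P) := by
    rw [hP]
    refine if_pos ?_
    rw [extendable_iff_mem_liveWords hf, List.length_nil, ← spine_zero hq]
    exact spine_mem hq 0
  obtain ⟨s, hs⟩ := exists_gradeSeq Z hne
  -- The numbers of items of grade below `n + P`, `n + P + P` and `n`. A period consists of `b - a =
  -- a - c` scripts.
  obtain ⟨a, ha⟩ : ∃ a, a = (gradeList Z (n + P)).length := ⟨_, rfl⟩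
  obtain ⟨b, hb⟩ : ∃ b, b = (gradeList Z (n + P + P)).length := ⟨_, rfl⟩
  obtain ⟨c, hc⟩ : ∃ c, c = (gradeList Z n).length := ⟨_, rfl⟩
  have hshift : ∀ i, s (a + i) = ((s (c + i)).1 + P, (s (c + i)).2) := by
    rw [ha, hc]
    exact gradeSeq_add hne hs hper
  have habc : b + c = a + a := by
    rw [ha, hb, hc]
    exact length_gradeList_add_length hper
  have hca : c < a := by
    have hle : c ≤ a := by
      rw [ha, hc]
      exact (gradeList_prefix Z (Nat.le_add_right n P)).length_le
    rcases hle.lt_or_eq with h | h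
    · exact h
    · have := congrArg Prod.fst (hshift 0)
      rw [← h] at this
      simp at this
      omega
  have hge : ∀ i, c ≤ i → n ≤ (s i).1 := by
    intro i hi
    by_contra hlt
    have hmem := gradeSeq_mem hne hs i
    have : s i ∈ gradeList Z n := (mem_gradeList Z).2 ⟨by omega, hmem⟩
    obtain ⟨j, hj, e⟩ := List.mem_iff_getElem.1 this
    rw [← hs] at e
    have := gradeSeq_injective hne hs nodup_branchEnds e
    omega
  have hmono : ∀ i, (s i).1 ≤ (s (i + 1)).1 := fun i => gradeSeq_mono hne hs (by omega)
  have hdrop : ∀ p m, n ≤ p → p ≤ m →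
      (branch f n (m + P)).drop (p + P) = (branch f n m).drop p := by
    intro p m hp hm
    have := (spine_shift hq (run_spine_add_factorial hq hp).symm (m - p)).1
    rw [← hn, ← hP] at this
    rw [show p + P + (m - p) = m + P by omega, show p + (m - p) = m by omega] at this
    rw [hbr, hbr, this]
    exact List.drop_left' (length_spine hq _)
  -- A script depends on two consecutive items. The preperiod runs up to grade `n + P` and not only
  -- `n`, so that the item before the period also has grade at least `n`, where the lists are
  -- already periodic.
  have hσ : ∀ i, a ≤ i → seqScript f n s (i + (a - c)) = seqScript f n s i := by
    intro i hi
    obtain ⟨i, rfl⟩ : ∃ j, i = j + 1 := ⟨i - 1, by omega⟩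
    have h1 : s (i + (a - c)) = ((s i).1 + P, (s i).2) := by
      have := hshift (i - c)
      rwa [show a + (i - c) = i + (a - c) by omega, show c + (i - c) = i by omega] at this
    have h2 : s (i + 1 + (a - c)) = ((s (i + 1)).1 + P, (s (i + 1)).2) := by
      have := hshift (i + 1 - c)
      rwa [show a + (i + 1 - c) = i + 1 + (a - c) by omega,
        show c + (i + 1 - c) = i + 1 by omega] at this
    rw [show i + 1 + (a - c) = i + (a - c) + 1 by omega] at h2 ⊢
    simp only [seqScript, itemScript, h1, h2]
    rw [hdrop _ _ (hge i (by omega)) (hmono i)]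
  have hS : ∀ i, ∀ hi : i < (itemScripts f n (gradeList Z (n + P + P))).length,
      (itemScripts f n (gradeList Z (n + P + P)))[i] = seqScript f n s i := fun i hi =>
    getElem_itemScripts (hs _) hi
  have hSl : (itemScripts f n (gradeList Z (n + P + P))).length = b := by
    rw [length_itemScripts, hb]
  have e1 : (enumerationScripts f n).1 = (itemScripts f n (gradeList Z (n + P + P))).take a := by
    simp only [enumerationScripts, hg, ha, hZ]
  have e2 : (enumerationScripts f n).2 = (itemScripts f n (gradeList Z (n + P + P))).drop a := by
    simp only [enumerationScripts, hg, ha, hZ]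
  set S := itemScripts f n (gradeList Z (n + P + P)) with hSdef
  rw [e1, e2, List.take_append_drop]
  have hu : (S.take a).length = a := by rw [List.length_take]; omega
  have hv : (S.drop a).length = a - c := by rw [List.length_drop]; omega
  have hup : ∀ i, ultimatelyPeriodic (S.take a) (S.drop a) i = some (seqScript f n s i) := by
    refine ultimatelyPeriodic_eq (by omega) (fun i hi => ?_) (fun i hi => ?_) fun i hi => ?_
    · rw [List.getElem_take, hS]
    · rw [List.getElem_drop, hS, hu]
    · rw [hv]
      exact hσ i (by omega)
  have hword : ∀ i, wordAfter (ultimatelyPeriodic (S.take a) (S.drop a)) (i + 1) =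
      some (spine A A.start (s i).1 ++ (s i).2) := by
    intro i
    rw [wordAfter_succ_eq (fun j _ => hup j) (fun j _ => hmono j), hbr]
    intro p m hpm
    rw [hbr, hbr, ← take_spine hq hpm, List.take_append_drop]
  have hmem := fun i => gradeSeq_mem hne hs i
  refine ⟨⟨fun i _ => by rw [hword]; rfl, fun i j w h1 h2 => ?_, fun w => ⟨fun hw => ?_, ?_⟩⟩, ?_⟩
  · rw [hword, Option.some_inj] at h1 h2
    have h3 := depth_of_mem_branchEnds hf hq (hmem i)
    have h4 := depth_of_mem_branchEnds hf hq (hmem j)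
    rw [h1] at h3
    rw [h2] at h4
    have h5 : (s i).1 = (s j).1 := h3.symm.trans h4
    rw [← h2, h5] at h1
    exact gradeSeq_injective hne hs nodup_branchEnds (Prod.ext h5 (List.append_cancel_left h1))
  · obtain ⟨z, hz, e⟩ := exists_mem_branchEnds hf hq (PDFA.mem_language.1 hw)
    obtain ⟨i, hi⟩ := exists_gradeSeq_eq hs (x := (depth A A.start w, z)) hz
    exact ⟨i, by rw [hword, hi, e]⟩
  · rintro ⟨i, hi⟩
    rw [hword, Option.some_inj] at hi
    rw [← hi]
    exact ((mem_branchEnds_iff hf hq).1 (hmem i)).2.1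
  · intro t ht
    obtain ⟨i, hi, rfl⟩ := List.mem_iff_getElem.1 ht
    rw [hS]
    rcases i with _ | i
    · have := length_le_of_gap hf hq (hmem 0) (Nat.zero_le _) fun m _ hm => by
        by_contra hcon
        obtain ⟨z, hz⟩ := List.exists_mem_of_ne_nil _ hcon
        obtain ⟨j, hj⟩ := exists_gradeSeq_eq hs (x := (m, z)) hz
        have := gradeSeq_mono hne hs (Nat.zero_le j)
        rw [hj] at this
        exact absurd hm (not_lt.2 this)
      simp [seqScript, itemScript, hbr, length_spine hq]
      omega
    -- At most `n` letters are removed, by the bound on ends, and at most `n` are appended, because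
    -- every grade strictly between those of consecutive items is empty.
    · have h1 := length_le_of_gap hf hq (hmem (i + 1)) (hmono i) fun m hm hm' => by
        by_contra hcon
        have := gradeSeq_succ_le hne hs hm hcon
        omega
      have h2 := ((mem_branchEnds_iff hf hq).1 (hmem i)).1
      simp [seqScript, itemScript, hbr, length_spine hq]
      omega

end infinite

/-- If one part suffices, the scripts enumerate the language. -/
theorem PartitionOrderable.enumerates {A : PDFA k} {f : Word k → Bool} {d : ℕ}
    (hf : ∀ w, f w = true ↔ A.Accepts A.start w) (h : PartitionOrderable pprDist 1 d A.language) :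
    Enumerates (ultimatelyPeriodic (enumerationScripts f A.numStates).1
      (enumerationScripts f A.numStates).2) A.language ∧
    ∀ s ∈ (enumerationScripts f A.numStates).1 ++ (enumerationScripts f A.numStates).2,
      s.length ≤ 2 * A.numStates := by
  by_cases hl : A.Live A.start
  · exact enumerates_of_card_liveWords_eq_one hf fun m =>
      le_antisymm (h.card_liveWords_le m) (hl.card_liveWords_pos m)
  · exact enumerates_of_not_live hf hl

end PushPopRight

/-! ### Computability of the enumeration from the code of the automaton -/

namespace PushPopRight

variable {k : ℕ}

/-! ### Reading an automaton from its code -/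

/-- The list of numbers coded in unary by a bit string. -/
def decodeUnary (c : List Bool) : List ℕ :=
  c.foldr (fun b l => if b = true then (l.headI + 1) :: l.tail else 0 :: l) []

theorem decodeUnary_unary_append (m : ℕ) (c : List Bool) :
    decodeUnary (unary m ++ c) = m :: decodeUnary c := by
  induction m with
  | zero => simp [unary, decodeUnary]
  | succ m ih =>
    have : unary (m + 1) ++ c = true :: (unary m ++ c) := by simp [unary, List.replicate_succ]
    rw [this, decodeUnary, List.foldr_cons]
    change (if true = true then ((decodeUnary (unary m ++ c)).headI + 1) ::
      (decodeUnary (unary m ++ c)).tail else _) = _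
    rw [ih]
    simp

theorem decodeUnary_flatMap (l : List ℕ) : decodeUnary (l.flatMap unary) = l := by
  induction l with
  | nil => rfl
  | cons m l ih => rw [List.flatMap_cons, decodeUnary_unary_append, ih]

/-- The state (plus one, zero if undefined) reached by reading `w`, from the decoded table. -/
def tableRun (k : ℕ) (l : List ℕ) (w : Word k) : ℕ :=
  w.foldl (fun (q : ℕ) (a : Fin k) =>
      if q = 0 then 0 else l.getD (2 + ((q - 1) * (k + 1) + ((a : ℕ) + 1))) 0)
    (l.getD 1 0 + 1)

/-- The membership test for the automaton with the given code. -/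
def codeAccepts (k : ℕ) (c : List Bool) (w : Word k) : Bool :=
  decide (tableRun k (decodeUnary c) w ≠ 0 ∧
    (decodeUnary c).getD (2 + ((tableRun k (decodeUnary c) w - 1) * (k + 1))) 0 = 1)

theorem getD_flatMap_of_length {α : Type} {g : α → List ℕ} {r : ℕ} (hg : ∀ x, (g x).length = r)
    (l : List α) (i : ℕ) (hi : i < l.length) (j : ℕ) (hj : j < r) :
    (l.flatMap g).getD (i * r + j) 0 = (g l[i]).getD j 0 := by
  induction l generalizing i with
  | nil => simp at hi
  | cons x l ih =>
    rw [List.flatMap_cons]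
    rcases i with _ | i
    · rw [zero_mul, zero_add, List.getD_append _ _ _ _ (by rwa [hg])]
      rfl
    · rw [List.getD_append_right _ _ _ _ (by rw [hg, add_mul]; omega), hg,
        show (i + 1) * r + j - r = i * r + j by rw [add_mul]; omega, ih i (by simpa using hi)]
      rfl

variable {A : PDFA k}

theorem decodeUnary_code : decodeUnary A.code =
    A.numStates :: (A.start : ℕ) :: (List.finRange A.numStates).flatMap A.row :=
  decodeUnary_flatMap _

/-- All rows have `k + 1` entries, so positions in the table are found by arithmetic; the 2 skips
the number of states and the initial state. -/
theorem getD_decodeUnary_code (q : Fin A.numStates) {j : ℕ} (hj : j < k + 1) :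
    (decodeUnary A.code).getD (2 + (q * (k + 1) + j)) 0 = (A.row q).getD j 0 := by
  rw [decodeUnary_code, show 2 + (q * (k + 1) + j) = q * (k + 1) + j + 1 + 1 by omega,
    List.getD_cons_succ, List.getD_cons_succ,
    getD_flatMap_of_length (r := k + 1) (by intro q; simp [PDFA.row]) _ _ (by simp) _ hj]
  simp

/-- A possibly undefined state as a number. -/
def stateNumber {n : ℕ} (o : Option (Fin n)) : ℕ := o.elim 0 fun p => (p : ℕ) + 1

theorem tableRun_code (w : Word k) :
    tableRun k (decodeUnary A.code) w = stateNumber (A.run A.start w) := by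
  induction w using List.reverseRecOn with
  | nil => simp [tableRun, decodeUnary_code, PDFA.run, stateNumber]
  | append_singleton w a ih =>
    rw [tableRun, List.foldl_append, ← tableRun, ih, PDFA.run_append]
    cases h : A.run A.start w with
    | none => simp [stateNumber]
    | some p =>
      have hrow := getD_decodeUnary_code p (show (a : ℕ) + 1 < k + 1 by omega)
      simp only [stateNumber, Option.elim_some, List.foldl_cons, List.foldl_nil,
        Nat.add_eq_zero_iff, one_ne_zero, and_false, if_false, Nat.add_sub_cancel,
        Option.bind_some, hrow, PDFA.run]
      rw [PDFA.row, List.getD_cons_succ, List.getD_eq_getElem _ _ (by simp)]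
      simp only [List.getElem_map, List.getElem_finRange]
      cases hst : A.step p a <;> simp [hst]

theorem codeAccepts_code (w : Word k) :
    codeAccepts k A.code w = true ↔ A.Accepts A.start w := by
  rw [codeAccepts, decide_eq_true_iff, tableRun_code, PDFA.Accepts]
  cases h : A.run A.start w with
  | none => simp [stateNumber]
  | some p =>
    have hrow := getD_decodeUnary_code p (Nat.succ_pos k)
    rw [add_zero] at hrow
    simp only [stateNumber, Option.elim_some, Nat.add_sub_cancel, hrow, PDFA.row]
    cases hacc : A.accept p <;> simp [hacc]

/-- The number of states of the automaton with the given code. -/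
def codeStates (c : List Bool) : ℕ := (decodeUnary c).getD 0 0

theorem codeStates_code : codeStates A.code = A.numStates := by
  rw [codeStates, decodeUnary_code]
  rfl

/-! ### Computability of the enumeration -/

section primrec
open Primrec

theorem primrec_decodeUnary : Primrec decodeUnary := by
  refine Primrec.list_foldr Primrec.id (Primrec.const []) (h := fun _ p =>
    if p.1 = true then (p.2.headI + 1) :: p.2.tail else 0 :: p.2) ?_
  have h2 : Primrec fun x : List Bool × Bool × List ℕ => x.2.2 := snd.comp snd
  exact Primrec.ite (Primrec.eq.comp (fst.comp snd) (const true))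
    (list_cons.comp (succ.comp (list_headI.comp h2)) (list_tail.comp h2))
    (list_cons.comp (const 0) h2)

theorem primrec_tableRun : Primrec₂ (tableRun k) := by
  refine Primrec.list_foldl (f := fun x : List ℕ × Word k => x.2)
    (g := fun x => x.1.getD 1 0 + 1) (h := fun x p =>
      if p.1 = 0 then 0 else x.1.getD (2 + ((p.1 - 1) * (k + 1) + (p.2 + 1))) 0) snd
    (succ.comp ((list_getD 0).comp fst (const 1))) ?_
  have h1 : Primrec fun x : (List ℕ × Word k) × ℕ × Fin k => x.2.1 := fst.comp snd
  have h2 : Primrec fun x : (List ℕ × Word k) × ℕ × Fin k => (x.2.2 : ℕ) :=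
    Primrec.fin_val.comp (snd.comp snd)
  exact Primrec.ite (Primrec.eq.comp h1 (const 0)) (const 0)
    ((list_getD 0).comp (fst.comp fst) (nat_add.comp (const 2) (nat_add.comp
      (nat_mul.comp (nat_sub.comp h1 (const 1)) (const (k + 1))) (succ.comp h2))))

theorem primrec_codeAccepts : Primrec₂ (codeAccepts k) := by
  have h1 : Primrec fun x : List Bool × Word k => decodeUnary x.1 := primrec_decodeUnary.comp fst
  have h2 : Primrec fun x : List Bool × Word k => tableRun k (decodeUnary x.1) x.2 :=
    primrec_tableRun.comp h1 snd
  refine PrimrecPred.decide (PrimrecPred.and (PrimrecPred.not (Primrec.eq.comp h2 (const 0)))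
    (Primrec.eq.comp ((list_getD 0).comp h1 (nat_add.comp (const 2)
      (nat_mul.comp (nat_sub.comp h2 (const 1)) (const (k + 1))))) (const 1)))

theorem primrec_codeStates : Primrec codeStates :=
  (list_getD 0).comp primrec_decodeUnary (const 0)

variable {α β : Type} [Primcodable α] [Primcodable β]

theorem primrec_filter {l : α → List β} {p : α → β → Bool} (hl : Primrec l) (hp : Primrec₂ p) :
    Primrec fun a => (l a).filter (p a) := by
  have h : Primrec₂ fun a b => bif p a b then [b] else [] :=
    Primrec.cond hp (list_cons.comp snd (const [])) (const [])
  refine (list_flatMap hl h).of_eq fun a => ?_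
  induction l a with
  | nil => rfl
  | cons b t ih => cases hb : p a b <;> simp [hb, ih]

theorem primrec_any {l : α → List β} {p : α → β → Bool} (hl : Primrec l) (hp : Primrec₂ p) :
    Primrec fun a => (l a).any (p a) := by
  refine (PrimrecPred.decide (PrimrecPred.not (Primrec.eq.comp
    (list_length.comp (primrec_filter hl hp)) (const 0)))).of_eq fun a => ?_
  rw [Bool.eq_iff_iff]
  simp

theorem primrec_wordsOfLength : Primrec (wordsOfLength k) := by
  have h : Primrec₂ fun (_ : ℕ) (l : List (Word k)) =>
      l.flatMap fun w => (List.finRange k).map fun a => a :: w :=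
    list_flatMap snd (list_map (const _) (list_cons.comp snd (snd.comp fst)))
  refine (nat_rec₁ [[]] h).of_eq fun m => ?_
  induction m with
  | zero => rfl
  | succ m ih => simp only [wordsOfLength, ← ih]

variable {f : α → Word k → Bool} {n : α → ℕ} (hf : Primrec₂ f) (hn : Primrec n)
include hf hn

/-- Here and below, every search runs through an explicitly bounded list of words, so everything is
primitive recursive as soon as the membership test and the number of states are. -/
theorem primrec_extendable : Primrec₂ fun a w => extendable (f a) (n a) w := by
  have h1 : Primrec fun x : α × Word k =>
      (List.range (n x.1)).flatMap fun j => wordsOfLength k (n x.1 + j) :=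
    list_flatMap (list_range.comp (hn.comp fst))
      (primrec_wordsOfLength.comp (nat_add.comp (hn.comp (fst.comp fst)) snd))
  exact primrec_any h1 (hf.comp (fst.comp fst) (list_append.comp (snd.comp fst) snd))

theorem primrec_branch : Primrec₂ fun a m => branch (f a) (n a) m := by
  have h1 : Primrec fun x : α × ℕ => (wordsOfLength k x.2).filter (extendable (f x.1) (n x.1)) :=
    primrec_filter (primrec_wordsOfLength.comp snd)
      ((primrec_extendable hf hn).comp (fst.comp fst) snd)
  exact option_getD.comp (list_head?.comp h1) (const [])

theorem primrec_branchEnds : Primrec₂ fun a p => branchEnds (f a) (n a) p := by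
  have h1 : Primrec fun x : α × ℕ => (List.range (n x.1 + 1)).flatMap (wordsOfLength k) :=
    list_flatMap (list_range.comp (succ.comp (hn.comp fst))) (primrec_wordsOfLength.comp snd)
  have h2 : Primrec fun x : (α × ℕ) × Word k => branch (f x.1.1) (n x.1.1) x.1.2 :=
    (primrec_branch hf hn).comp (fst.comp fst) (snd.comp fst)
  have h3 : Primrec fun x : (α × ℕ) × Word k => x.2.isEmpty :=
    (PrimrecPred.decide (Primrec.eq.comp (list_length.comp snd) (const 0))).of_eq fun x => by
      rw [Bool.eq_iff_iff]
      simp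
  exact primrec_filter h1 (Primrec.and.comp
    (hf.comp (fst.comp fst) (list_append.comp h2 snd))
    (Primrec.or.comp h3 (Primrec.not.comp ((primrec_extendable hf hn).comp (fst.comp fst)
      (list_append.comp h2 (list_take.comp (const 1) snd))))))

theorem primrec_gradeList_branchEnds :
    Primrec₂ fun a m => gradeList (branchEnds (f a) (n a)) m :=
  list_flatMap (list_range.comp snd) (list_map ((primrec_branchEnds hf hn).comp (fst.comp fst) snd)
    ((snd.comp fst).pair snd))

theorem primrec_itemScript :
    Primrec fun x : α × (ℕ × Word k) × ℕ × Word k => itemScript (f x.1) (n x.1) x.2.1 x.2.2 := by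
  have hpush : Primrec fun a : Fin k => (Edit.pushR a : Edit k) :=
    (Primrec.of_equiv_symm (e := Edit.equivOption k)).comp Primrec.option_some
  have hx : Primrec fun x : α × (ℕ × Word k) × ℕ × Word k => x.2.1 := fst.comp snd
  have hy : Primrec fun x : α × (ℕ × Word k) × ℕ × Word k => x.2.2 := snd.comp snd
  have h1 : Primrec fun x : α × (ℕ × Word k) × ℕ × Word k =>
      (List.range x.2.1.2.length).map fun _ => (Edit.popR : Edit k) :=
    list_map (list_range.comp (list_length.comp (snd.comp hx))) (const _)
  have h2 : Primrec fun x : α × (ℕ × Word k) × ℕ × Word k =>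
      ((branch (f x.1) (n x.1) x.2.2.1).drop x.2.1.1 ++ x.2.2.2).map
        fun a => (Edit.pushR a : Edit k) :=
    list_map (list_append.comp (list_drop.comp (fst.comp hx)
      ((primrec_branch hf hn).comp fst (fst.comp hy))) (snd.comp hy)) (hpush.comp snd)
  refine (list_append.comp h1 h2).of_eq fun x => ?_
  rw [itemScript, replaceEnd, List.map_const', List.length_range]

theorem primrec_itemScripts : Primrec₂ fun a l => itemScripts (f a) (n a) l := by
  have h1 : Primrec fun x : (α × List (ℕ × Word k)) × ℕ => x.1.2 := snd.comp fst
  exact list_map (list_range.comp (list_length.comp snd)) ((primrec_itemScript hf hn).comp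
    ((fst.comp fst).pair
      (((list_getD (0, [])).comp (list_cons.comp (const (0, [])) h1) snd).pair
        ((list_getD (0, [])).comp h1 snd))))

theorem primrec_enumerationScripts : Primrec fun a => enumerationScripts (f a) (n a) := by
  have hfac : Primrec Nat.factorial := by
    refine (nat_rec₁ 1 (f := fun m r => (m + 1) * r)
      (nat_mul.comp (succ.comp fst) snd)).of_eq fun m => ?_
    induction m with
    | zero => rfl
    | succ m ih => rw [Nat.factorial_succ, ← ih]
  have h1 : Primrec fun a => n a + (n a).factorial := nat_add.comp hn (hfac.comp hn)
  have hb : Primrec fun a => gradeBounds (f a) (n a) :=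
    Primrec.ite (Primrec.eq.comp ((primrec_extendable hf hn).comp Primrec.id (const []))
      (const true)) (h1.pair (nat_add.comp h1 (hfac.comp hn))) (const (1, 1))
  have hS : Primrec fun a => itemScripts (f a) (n a)
      (gradeList (branchEnds (f a) (n a)) (gradeBounds (f a) (n a)).2) :=
    (primrec_itemScripts hf hn).comp Primrec.id
      ((primrec_gradeList_branchEnds hf hn).comp Primrec.id (snd.comp hb))
  have hl : Primrec fun a =>
      (gradeList (branchEnds (f a) (n a)) (gradeBounds (f a) (n a)).1).length :=
    list_length.comp ((primrec_gradeList_branchEnds hf hn).comp Primrec.id (fst.comp hb))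
  exact (list_take.comp hl hS).pair (list_drop.comp hl hS)

end primrec

end PushPopRight

theorem mainTheorem5 (k : ℕ) :
    -- characterization of the partition-orderable languages
    (∀ A : PDFA k,
      (∃ t d : ℕ, PartitionOrderable pprDist t d A.language) ↔ Slender A.language) ∧
    -- the least number of parts is computable in polynomial time
    (∃ f : PDFA k → ℕ, PolyTime f ∧
      ∀ A : PDFA k, Slender A.language →
        IsLeast {t : ℕ | ∃ d : ℕ, PartitionOrderable pprDist t d A.language} (f A)) ∧
    -- if one part suffices, then an ultimately periodic enumeration can be computed
    (∃ g : List Bool → List (Script k) × List (Script k), Computable g ∧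
      ∀ A : PDFA k,
        IsLeast {t : ℕ | ∃ d : ℕ, PartitionOrderable pprDist t d A.language} 1 →
          Enumerates (ultimatelyPeriodic (g A.code).1 (g A.code).2) A.language ∧
          ∀ s ∈ (g A.code).1 ++ (g A.code).2, s.length ≤ 2 * A.numStates) := by
  refine ⟨fun A => ⟨fun ⟨t, d, h⟩ => h.slender, fun h => ⟨_, h.partitionOrderable⟩⟩,
    ⟨StackProgram.partCount, StackProgram.polyTime_partCount k, fun A h => h.isLeast_partCount⟩,
    ⟨fun c => enumerationScripts (codeAccepts k c) (codeStates c),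
      (primrec_enumerationScripts primrec_codeAccepts primrec_codeStates).to_comp,
      fun A h => ?_⟩⟩
  obtain ⟨d, hd⟩ := h.1
  simp only [codeStates_code]
  exact hd.enumerates codeAccepts_code
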